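/- Let $G$ be a connected complex semisimple Lie group with Lie algebra $\mathfrak g$, let $\sigma$ be an involutive automorphism of $G$ (as a real Lie group) and $\theta$ a Cartan involution of $G$ with $\sigma\theta=\theta\sigma$, and put $\tau=\sigma\theta$. Denote the differentials by the same letters, let $\mathfrak g=\mathfrak h\oplus\mathfrak q$, $\mathfrak g=\mathfrak k\oplus\mathfrak m$ be the $(+1,-1)$-eigenspace decompositions for $\sigma$ and $\theta$, and let $\mathfrak h'=\mathfrak g^\tau$. Let $H$ and $H'$ be the identity components of $G^\sigma$ and $G^\tau$, and assume that $H'$ is a simple Lie group and a real form of $G$, i.e. $\mathfrak h'$ is simple and $\mathfrak g=\mathfrak h'\oplus i\mathfrak h'$. Assume that $H'$ is of non-Hermitian type, i.e. the center of $\mathfrak k\cap\mathfrak h'$ is zero. Let $B$ be the Killing form of $\mathfrak g$ as a real Lie algebra. Let $\mathfrak t$ be a maximal abelian subspace of $\mathfrak k\cap\mathfrak q$ and $T=\exp\mathfrak t$. For a real linear form $\alpha:\mathfrak t\to i\mathbb R$ put $\mathfrak g(\mathfrak t,\alpha)=\{X\in\mathfrak g\mid [Y,X]=\alpha(Y)X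 \text{ for all } Y\in\mathfrak t\}$, and let $\Sigma(\mathfrak t)$ be the set of all $\alpha\neq0$ with $\mathfrak g(\mathfrak t,\alpha)\ne0$. Let $\alpha\in\Sigma(\mathfrak t)$ be a longest root (for the length defined by the Killing form), and suppose that $\dim_{\mathbb C}\mathfrak g(\mathfrak t,\alpha)=1$. Put $\mathfrak t_\alpha=\{Y\in\mathfrak t\mid\alpha(Y)=0\}$, let $Y_\alpha\in\mathfrak t$ be the element with $\alpha(Y_\alpha)=\pi i/2$ and $B(Y_\alpha,\mathfrak t_\alpha)=\{0\}$, and put $a_\alpha=\exp Y_\alpha$. Let $Z$ be a nonzero element of $(\mathfrak g(\mathfrak t,\alpha)\oplus\mathfrak g(\mathfrak t,-\alpha))\cap\mathfrak m\cap\mathfrak h'$ and put $Z'=\mathrm{Ad}(a_\alpha^{-1})Z$. Let $\widetilde{\mathfrak t}$ be a maximal abelian subalgebra of $\mathfrak k$ containing $\mathfrak t$, put $\mathfrak t_{\mathfrak h}=\widetilde{\mathfrak t}\cap\mathfrak h$, and let $$\mathfrak j=\mathbb R Z\oplus i\mathfrak t_\alpha\oplus i\mathfrak t_{\mathfrak h},\qquad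 \mathfrak j'=\mathrm{Ad}(a_\alpha^{-1})\mathfrak j .$$ Then there exists $t\in T\cap H$ such that $e^\alpha(t)=-1$ (that is, $e^{\alpha(Y)}=-1$ for every $Y\in\mathfrak t$ with $\exp Y=t$) and such that $\mathrm{Ad}(t)|_{\mathfrak j'}$ is the reflection with respect to $Z'$, i.e. $$\mathrm{Ad}(t)W=W-\frac{2B(W,Z')}{B(Z',Z')}\,Z'\qquad\text{for all } W\in\mathfrak j'.$$ -/

import Mathlib

open scoped Manifold ContDiff Pointwise

noncomputable section

namespace ComplexLie

/-- The Lie algebra `𝔤` of a complex Lie group `G` (the tangent space at the identity, with the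
bracket of left-invariant vector fields). -/
abbrev LieAlg (E G : Type*) [NormedAddCommGroup E] [NormedSpace ℂ E] [TopologicalSpace G]
    [ChartedSpace E G] [Group G] : Type _ :=
  GroupLieAlgebra 𝓘(ℂ, E) G

variable {E : Type*} [NormedAddCommGroup E] [NormedSpace ℂ E] [CompleteSpace E]
  {G : Type*} [TopologicalSpace G] [ChartedSpace E G] [Group G]

/-- `𝔤` regarded as a real Lie algebra. -/
instance instLieAlgebraReal [LieGroup 𝓘(ℂ, E) ω G] : LieAlgebra ℝ (LieAlg E G) where
  lie_smul r x y := by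
    rw [← Complex.coe_smul, ← Complex.coe_smul, lie_smul]

/-- The differential at the identity of a self-map `φ` of `G` fixing the identity, as a real linear
map of `𝔤` (so that it makes sense for antiholomorphic automorphisms as well). -/
def dAut (φ : G → G) : LieAlg E G →ₗ[ℝ] LieAlg E G where
  toFun X := mfderiv 𝓘(ℝ, E) 𝓘(ℝ, E) φ (1 : G) X
  map_add' X Y := ContinuousLinearMap.map_add (mfderiv 𝓘(ℝ, E) 𝓘(ℝ, E) φ (1 : G)) X Y
  map_smul' r X := ContinuousLinearMap.map_smul (mfderiv 𝓘(ℝ, E) 𝓘(ℝ, E) φ (1 : G)) r X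

/-- The adjoint action `Ad(g)` of `G` on `𝔤`. -/
def Ad (g : G) : LieAlg E G →ₗ[ℂ] LieAlg E G where
  toFun X := mfderiv 𝓘(ℂ, E) 𝓘(ℂ, E) (fun x : G => g * x * g⁻¹) (1 : G) X
  map_add' X Y := ContinuousLinearMap.map_add
    (mfderiv 𝓘(ℂ, E) 𝓘(ℂ, E) (fun x : G => g * x * g⁻¹) (1 : G)) X Y
  map_smul' c X := ContinuousLinearMap.map_smul
    (mfderiv 𝓘(ℂ, E) 𝓘(ℂ, E) (fun x : G => g * x * g⁻¹) (1 : G)) c X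

/-- `γ` is the one-parameter subgroup of `G` with initial velocity `X`. (A homomorphism `ℝ → G`
that is differentiable at `0` is automatically smooth.) -/
def IsOneParameterSubgroup (X : LieAlg E G) (γ : ℝ → G) : Prop :=
  (∀ s t : ℝ, γ (s + t) = γ s * γ t) ∧
    HasMFDerivAt 𝓘(ℝ, ℝ) 𝓘(ℝ, E) γ 0
      ((ContinuousLinearMap.toSpanSingleton ℝ (show E from X) : ℝ →L[ℝ] E))

open Classical in
/-- The exponential map of `G`: `exp X = γ 1`, where `γ` is the one-parameter subgroup with initial
velocity `X` (which exists and is unique in every Lie group). -/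
def lieExp (X : LieAlg E G) : G :=
  if h : ∃ γ : ℝ → G, IsOneParameterSubgroup X γ then h.choose 1 else 1

/-- The set of fixed points of `φ` in `𝔤`, i.e. its `+1`-eigenspace. -/
def plusSpace (φ : LieAlg E G →ₗ[ℝ] LieAlg E G) : Submodule ℝ (LieAlg E G) :=
  LinearMap.ker (φ - LinearMap.id)

/-- The `-1`-eigenspace of `φ` in `𝔤`. -/
def minusSpace (φ : LieAlg E G →ₗ[ℝ] LieAlg E G) : Submodule ℝ (LieAlg E G) :=
  LinearMap.ker (φ + LinearMap.id)

/-- An involutive automorphism of `G` as a real Lie group. -/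
def IsLieInvolution (E : Type*) [NormedAddCommGroup E] [NormedSpace ℂ E] {G : Type*}
    [TopologicalSpace G] [ChartedSpace E G] [Group G] (φ : G ≃* G) : Prop :=
  ContMDiff 𝓘(ℝ, E) 𝓘(ℝ, E) ∞ φ ∧ ∀ x, φ (φ x) = x

section Algebra

variable [LieGroup 𝓘(ℂ, E) ω G]

/-- The Killing form `B` of `𝔤` regarded as a real Lie algebra. -/
def B (X Y : LieAlg E G) : ℝ := killingForm ℝ (LieAlg E G) X Y

variable (E) in
/-- `θ` is a Cartan involution of `G`: an involution such that `-B(X, θ X)` is positive definite. -/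
def IsCartanInvolution (θ : G ≃* G) : Prop :=
  IsLieInvolution E θ ∧ ∀ X : LieAlg E G, X ≠ 0 → 0 < -B X (dAut θ X)

/-- `V` is an abelian subspace of `𝔤`. -/
def IsAbelianSubspace (V : Submodule ℝ (LieAlg E G)) : Prop :=
  ∀ X ∈ V, ∀ Y ∈ V, ⁅X, Y⁆ = 0

/-- `V` is a maximal abelian subspace of `S`. -/
def IsMaxAbelianIn (V S : Submodule ℝ (LieAlg E G)) : Prop :=
  Maximal (fun W : Submodule ℝ (LieAlg E G) => W ≤ S ∧ IsAbelianSubspace W) V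

/-- The real subspace `V` is a simple real Lie algebra under the bracket of `𝔤`. -/
def IsSimpleSubalgebra (V : Submodule ℝ (LieAlg E G)) : Prop :=
  ∃ L : LieSubalgebra ℝ (LieAlg E G), L.toSubmodule = V ∧ LieAlgebra.IsSimple ℝ L

/-- The real subspace `V` is a real form of `𝔤`: `𝔤 = V ⊕ iV`. -/
def IsRealForm (V : Submodule ℝ (LieAlg E G)) : Prop :=
  IsCompl V (Complex.I • V)

variable {𝔱 : Submodule ℝ (LieAlg E G)}

/-- The root space `𝔤(𝔱, α) = {X ∈ 𝔤 | [Y, X] = α(Y) X for all Y ∈ 𝔱}`, a complex subspace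
of `𝔤`. -/
def rootSpace (α : 𝔱 →ₗ[ℝ] ℂ) : Submodule ℂ (LieAlg E G) where
  carrier := {X | ∀ Y : 𝔱, ⁅(Y : LieAlg E G), X⁆ = α Y • X}
  add_mem' := by
    intro X X' hX hX' Y
    rw [lie_add, hX Y, hX' Y, smul_add]
  zero_mem' := by
    intro Y
    rw [lie_zero, smul_zero]
  smul_mem' := by
    intro c X hX Y
    rw [lie_smul, hX Y, smul_comm]

/-- The restricted root system `Σ(𝔱)`: nonzero linear forms `α : 𝔱 → iℝ` with
`𝔤(𝔱, α) ≠ 0`. -/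
def restrictedRoots (𝔱 : Submodule ℝ (LieAlg E G)) : Set (𝔱 →ₗ[ℝ] ℂ) :=
  {α | α ≠ 0 ∧ (∀ Y, (α Y).re = 0) ∧ rootSpace α ≠ ⊥}

/-- `A ∈ 𝔱` represents the linear form `α : 𝔱 → iℝ` through the Killing form, which is negative
definite on the subspaces `𝔱` of interest; then `-B(A, A)` is the squared length of `α`. -/
def Represents (A : 𝔱) (α : 𝔱 →ₗ[ℝ] ℂ) : Prop :=
  ∀ Y : 𝔱, α Y = -(B (A : LieAlg E G) (Y : LieAlg E G) : ℂ) * Complex.I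

/-- `α` is a longest root in `Σ(𝔱)`. -/
def IsLongestRoot (α : 𝔱 →ₗ[ℝ] ℂ) : Prop :=
  α ∈ restrictedRoots 𝔱 ∧ ∀ β ∈ restrictedRoots 𝔱, ∀ A C : 𝔱, Represents A α → Represents C β →
    -B (C : LieAlg E G) (C : LieAlg E G) ≤ -B (A : LieAlg E G) (A : LieAlg E G)

/-- `𝔱_α = {Y ∈ 𝔱 | α(Y) = 0}`. -/
def kerRoot (α : 𝔱 →ₗ[ℝ] ℂ) : Submodule ℝ (LieAlg E G) :=
  (LinearMap.ker α).map 𝔱.subtype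

/-- `Y` is the element `Y_α` of `𝔱` with `α(Y_α) = πi/2` and `B(Y_α, 𝔱_α) = 0`. -/
def IsYElement (α : 𝔱 →ₗ[ℝ] ℂ) (Y : 𝔱) : Prop :=
  α Y = (Real.pi / 2 : ℂ) * Complex.I ∧ ∀ W ∈ kerRoot α, B (Y : LieAlg E G) W = 0

/-- The subset `T = exp 𝔱` of `G`. -/
def torus (𝔱 : Submodule ℝ (LieAlg E G)) : Set G :=
  {g | ∃ Y : 𝔱, lieExp (Y : LieAlg E G) = g}

/-- The linear map `φ` restricts to `V` as the reflection with respect to the vector `Z ∈ V`, i.e.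
the orthogonal reflection for the Killing form that sends `Z` to `-Z`. -/
def IsReflectionOn (φ : LieAlg E G →ₗ[ℂ] LieAlg E G) (V : Submodule ℝ (LieAlg E G))
    (Z : LieAlg E G) : Prop :=
  Z ∈ V ∧ B Z Z ≠ 0 ∧ ∀ W ∈ V, φ W = W - (2 * B W Z / B Z Z) • Z

end Algebra

/-- Commuting involutions `σ` and `θ` of the complex Lie group `G`, `θ` a Cartan involution, such
that the Lie algebra `𝔥'` of the group `H' = (G^τ)_0`, `τ = σθ`, is a simple real form of `𝔤`. -/
structure RealFormData (E G : Type*) [NormedAddCommGroup E] [NormedSpace ℂ E] [CompleteSpace E]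
    [TopologicalSpace G] [ChartedSpace E G] [Group G] [LieGroup 𝓘(ℂ, E) ω G] where
  σ : G ≃* G
  θ : G ≃* G
  σ_involution : IsLieInvolution E σ
  θ_cartan : IsCartanInvolution E θ
  comm : ∀ x, σ (θ x) = θ (σ x)
  realForm : IsRealForm (plusSpace (dAut (E := E) (fun x : G => σ (θ x))))
  simple : IsSimpleSubalgebra (plusSpace (dAut (E := E) (fun x : G => σ (θ x))))

namespace RealFormData

variable [LieGroup 𝓘(ℂ, E) ω G] (D : RealFormData E G)

/-- `𝔥`, the Lie algebra of `H`. -/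
def 𝔥 : Submodule ℝ (LieAlg E G) := plusSpace (dAut D.σ)

/-- `𝔮`, the `-1`-eigenspace of `σ`. -/
def 𝔮 : Submodule ℝ (LieAlg E G) := minusSpace (dAut D.σ)

/-- `𝔨`, the `+1`-eigenspace of `θ`. -/
def 𝔨 : Submodule ℝ (LieAlg E G) := plusSpace (dAut D.θ)

/-- `𝔪`, the `-1`-eigenspace of `θ`. -/
def 𝔪 : Submodule ℝ (LieAlg E G) := minusSpace (dAut D.θ)

/-- `𝔥'`, the Lie algebra of the real form `H'`. -/
def 𝔥' : Submodule ℝ (LieAlg E G) := plusSpace (dAut (fun x : G => D.σ (D.θ x)))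

/-- `H`, the connected component of the identity of `G^σ`. -/
def H : Set G := connectedComponentIn {x | D.σ x = x} 1

/-- `H'` is of Hermitian type: the Lie algebra `𝔨 ∩ 𝔥'` of its maximal compact subgroup has a
nonzero center. -/
def IsHermitianType : Prop :=
  ∃ X ∈ D.𝔨 ⊓ D.𝔥', X ≠ 0 ∧ ∀ Y ∈ D.𝔨 ⊓ D.𝔥', ⁅X, Y⁆ = 0

/-- `Z` is a nonzero element of the sum of the root spaces for `α` and `-α` lying in `𝔪 ∩ 𝔥'`. -/
def IsZElement {𝔱 : Submodule ℝ (LieAlg E G)} (α : 𝔱 →ₗ[ℝ] ℂ) (Z : LieAlg E G) : Prop :=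
  Z ≠ 0 ∧ Z ∈ D.𝔪 ∧ Z ∈ D.𝔥' ∧ Z ∈ rootSpace α ⊔ rootSpace (-α)

/-- `𝔧 = ℝZ ⊕ i𝔱_α ⊕ i𝔱_𝔥` where `𝔱_𝔥 = 𝔱' ∩ 𝔥` for a maximal abelian subalgebra `𝔱'` of `𝔨`
containing `𝔱`. -/
def 𝔧 {𝔱 : Submodule ℝ (LieAlg E G)} (𝔱' : Submodule ℝ (LieAlg E G)) (α : 𝔱 →ₗ[ℝ] ℂ)
    (Z : LieAlg E G) : Submodule ℝ (LieAlg E G) :=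
  Submodule.span ℝ {Z} ⊔ Complex.I • kerRoot α ⊔ Complex.I • (𝔱' ⊓ D.𝔥)

end RealFormData

end ComplexLie

end

open scoped Manifold ContDiff Pointwise

set_option linter.unusedSectionVars false

section

/-! ### The Lie product formula -/

section LieProduct

open Filter Topology NormedSpace

/-! Suppose there is an `𝔰𝔩₂`-triple `(H, X, Y)` with `X ∈ 𝔥'`, `Y = -θX`, `iH ∈ 𝔱` and `α(H) = 1`
(`α` extended complex linearly). Put `t = exp(πiH)`. Then `t ∈ T` and `e^α(t) = e^{πi} = -1`. Inside
the image of `SL₂` one has `exp(πiH) = exp(π(X - Y)) = exp(π(X + θX))` (`lieExp_pi_of_isSl2Triple`),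
and `X + θX` is fixed by `θ` and `τ`, hence by `σ`, so `t ∈ H`. Finally `𝔧'` is spanned by `Z'`,
which lies in the root spaces of `±α` where `Ad t = -1`, and by vectors commuting with `𝔱`, where
`Ad t = 1`; hence `Ad t` is the reflection (`isReflectionOn_of_root`).

To build the triple, pass to the real form `𝔥'` with `𝔞 = i𝔱`, so that the roots become real
restricted weights. It suffices to find a weight `β` as long as `α`, with `⟨α, β⟩ > 0` and `β ≠ α`:
the coroot `H` of `β` then satisfies `0 < α(H) < 2`, and `α(H)` is an integer by `𝔰𝔩₂`-theory
(`CartanRealForm.IsTorus.exists_sl2`).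

The existence of `β` is where non-Hermitian type enters (`exists_oblique_longest_weight`), without
any classification of root systems. Let `e` span the weight space of `α` in `𝔥'`. Since `α` is
longest and of multiplicity one, `e` lies in the cone of those `u` for which `(ad u)²` is a fixed
multiple of `x ↦ ⟪u, θx⟫ u`; this cone is stable under all `exp(ad x)`. If no `β` exists, a weight
analysis shows that every zero of `⟪·, e⟫` on the cone is a critical point
(`br_eq_zero_or_exists_weight`). Along the flow of a cone element that function is a quadratic
polynomial, and all its zeros are now double, so it never changes sign. Cone elements span `𝔥'` by
simplicity, and the Lie product formula extends the conclusion to all flows: they preserve the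
closure of the positive part. So the orbit of `e` under the group `K` generated by `exp(ad Y)`, `θY
= Y`, has pairwise nonnegative inner products, and its closed convex hull, which avoids `0`,
contains a nonzero `K`-fixed vector. Its `θ`-fixed part is a nonzero central element of `𝔨 ∩ 𝔥'`,
which contradicts the non-Hermitian hypothesis (`exists_center_of_critical`). -/

lemma norm_pow_sub_pow_le_of_norm_le {𝔸 : Type*} [NormedRing 𝔸] {a b : 𝔸} {c : ℝ} (hc : 1 ≤ c)
    (ha : ‖a‖ ≤ c) (hb : ‖b‖ ≤ c) (n : ℕ) : ‖a ^ n - b ^ n‖ ≤ n * c ^ n * ‖a - b‖ := by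
  induction n with
  | zero => simp
  | succ n ih =>
    have hc0 : 0 ≤ c := zero_le_one.trans hc
    have hb' : ‖b ^ n * (a - b)‖ ≤ c ^ n * ‖a - b‖ := by
      -- The exponent `0` is separate because `‖1‖ ≤ 1` is not assumed.
      rcases Nat.eq_zero_or_pos n with rfl | hn
      · simp
      · exact (norm_mul_le _ _).trans (mul_le_mul_of_nonneg_right
          ((norm_pow_le' b hn).trans (pow_le_pow_left₀ (norm_nonneg _) hb n)) (norm_nonneg _))
    have ha' : ‖(a ^ n - b ^ n) * a‖ ≤ n * c ^ n * ‖a - b‖ * c :=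
      (norm_mul_le _ _).trans (mul_le_mul ih ha (norm_nonneg _) (by positivity))
    have hpow : c ^ n ≤ c ^ (n + 1) := pow_le_pow_right₀ hc (Nat.le_succ n)
    calc ‖a ^ (n + 1) - b ^ (n + 1)‖ = ‖(a ^ n - b ^ n) * a + b ^ n * (a - b)‖ := by
          congr 1; rw [pow_succ, pow_succ]; noncomm_ring
      _ ≤ n * c ^ n * ‖a - b‖ * c + c ^ n * ‖a - b‖ := (norm_add_le _ _).trans (add_le_add ha' hb')
      _ ≤ n * c ^ n * ‖a - b‖ * c + c ^ (n + 1) * ‖a - b‖ := by gcongr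
      _ = ((n + 1 : ℕ) : ℝ) * c ^ (n + 1) * ‖a - b‖ := by push_cast; ring

variable {𝔸 : Type*} [NormedRing 𝔸] [NormedAlgebra ℝ 𝔸]

lemma HasDerivAt.tendsto_natCast_smul_sub {f : ℝ → 𝔸} {f' : 𝔸} (h : HasDerivAt f f' 0) :
    Tendsto (fun n : ℕ => (n : ℝ) • (f (n : ℝ)⁻¹ - f 0)) atTop (𝓝 f') := by
  have h3 : Tendsto (fun n : ℕ => (n : ℝ)⁻¹) atTop (𝓝[>] 0) :=
    tendsto_inv_atTop_nhdsGT_zero.comp tendsto_natCast_atTop_atTop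
  simpa [Function.comp_def] using h.tendsto_slope_zero_right.comp h3

/-- The `n`-th powers of such elements stay bounded by `exp (‖f'‖ + 1)`, which controls the
telescoping estimate in the product formula. -/
lemma eventually_norm_le_one_add_div [NormOneClass 𝔸] {f : ℝ → 𝔸} {f' : 𝔸}
    (h : HasDerivAt f f' 0) (h0 : f 0 = 1) :
    ∀ᶠ n : ℕ in atTop, ‖f (n : ℝ)⁻¹‖ ≤ 1 + (‖f'‖ + 1) / n := by
  have := (h.tendsto_natCast_smul_sub.norm).eventually_le_const (lt_add_one _)
  filter_upwards [this, eventually_gt_atTop 0] with n hn hpos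
  have hpos' : (0 : ℝ) < n := Nat.cast_pos.2 hpos
  rw [norm_smul, Real.norm_natCast, h0, mul_comm, ← le_div_iff₀ hpos'] at hn
  calc ‖f (n : ℝ)⁻¹‖ = ‖1 + (f (n : ℝ)⁻¹ - 1)‖ := by congr 1; abel
    _ ≤ ‖(1 : 𝔸)‖ + ‖f (n : ℝ)⁻¹ - 1‖ := norm_add_le _ _
    _ ≤ _ := by rw [norm_one]; gcongr

/-- The Lie product formula. -/
theorem tendsto_exp_mul_exp_pow [CompleteSpace 𝔸] [NormOneClass 𝔸] (X Y : 𝔸) :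
    Tendsto (fun n : ℕ => (exp ((n : ℝ)⁻¹ • X) * exp ((n : ℝ)⁻¹ • Y)) ^ n) atTop
      (𝓝 (exp (X + Y))) := by
  have h1 : HasDerivAt (fun s : ℝ => exp (s • X) * exp (s • Y)) (X + Y) 0 := by
    have := ((hasDerivAt_exp_smul_const X (0 : ℝ)).fun_mul (hasDerivAt_exp_smul_const Y (0 : ℝ)))
    simpa using this
  have h2 : HasDerivAt (fun s : ℝ => exp (s • (X + Y))) (X + Y) 0 := by
    simpa [-smul_add] using hasDerivAt_exp_smul_const (X + Y) (0 : ℝ)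
  -- The two curves agree to first order at `0`, so `n` times their distance at `1/n` tends to `0`.
  have hlim := (h1.fun_sub h2).tendsto_natCast_smul_sub
  rw [sub_self] at hlim
  have hn1 := eventually_norm_le_one_add_div h1 (by simp)
  have hn2 := eventually_norm_le_one_add_div h2 (by simp)
  set M : ℝ := ‖X + Y‖ + 1 with hM
  have hM0 : 0 ≤ M := by positivity
  rw [tendsto_iff_norm_sub_tendsto_zero]
  refine squeeze_zero' (Eventually.of_forall fun _ => norm_nonneg _) ?_
    (by simpa using hlim.norm.const_mul (Real.exp M))
  filter_upwards [hn1, hn2, eventually_gt_atTop 0] with n ha hb hpos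
  have hpos' : (0 : ℝ) < n := Nat.cast_pos.2 hpos
  let _ : NormedAlgebra ℚ 𝔸 := NormedAlgebra.restrictScalars ℚ ℝ 𝔸
  have hexp : exp (X + Y) = exp ((n : ℝ)⁻¹ • (X + Y)) ^ n := by
    rw [← exp_nsmul, ← Nat.cast_smul_eq_nsmul ℝ, smul_inv_smul₀ hpos'.ne']
  rw [hexp]
  refine (norm_pow_sub_pow_le_of_norm_le (by simp; positivity) ha hb n).trans ?_
  have hpow : (1 + M / n) ^ n ≤ Real.exp M := by
    have := pow_le_pow_left₀ (by positivity) (Real.add_one_le_exp (M / n)) n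
    rwa [← Real.exp_nat_mul, mul_div_cancel₀ _ hpos'.ne', add_comm] at this
  rw [← smul_add, norm_smul, Real.norm_natCast]
  calc (n : ℝ) * (1 + M / n) ^ n * _ ≤ (n : ℝ) * Real.exp M * _ := by gcongr
    _ = _ := by ring

end LieProduct

end

section

/-! ### Real Lie algebras with a Cartan involution -/

open Filter Topology NormedSpace
open scoped RealInnerProductSpace

/-- A Lie bracket on a Euclidean space together with a Cartan involution `θ`, such that the inner
product is the one attached to an invariant bilinear form and to `θ`. -/
structure EuclideanCartanAlgebra (V : Type*) [NormedAddCommGroup V] [InnerProductSpace ℝ V] where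
  br : V →ₗ[ℝ] V →ₗ[ℝ] V
  br_self : ∀ x, br x x = 0
  jacobi : ∀ x y z, br x (br y z) = br (br x y) z + br y (br x z)
  θ : V →ₗ[ℝ] V
  θ_θ : ∀ x, θ (θ x) = x
  θ_br : ∀ x y, θ (br x y) = br (θ x) (θ y)
  inner_θ : ∀ x y, ⟪θ x, θ y⟫ = ⟪x, y⟫
  inner_br : ∀ x y z, ⟪br x y, z⟫ = -⟪y, br (θ x) z⟫

namespace EuclideanCartanAlgebra

variable {V : Type*} [NormedAddCommGroup V] [InnerProductSpace ℝ V] (D : EuclideanCartanAlgebra V)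

lemma br_swap (x y : V) : D.br x y = -D.br y x := by
  have h := D.br_self (x + y)
  simp only [map_add, LinearMap.add_apply, D.br_self, zero_add, add_zero] at h
  exact eq_neg_of_add_eq_zero_right h

variable [FiniteDimensional ℝ V]

/-- The adjoint operator `ad x` as a continuous linear map. -/
noncomputable def ad (x : V) : V →L[ℝ] V := LinearMap.toContinuousLinearMap (D.br x)

@[simp] lemma ad_apply (x y : V) : D.ad x y = D.br x y := rfl

lemma ad_add (x y : V) : D.ad (x + y) = D.ad x + D.ad y := by ext; simp

lemma ad_smul (c : ℝ) (x : V) : D.ad (c • x) = c • D.ad x := by ext; simp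

lemma ad_neg (x : V) : D.ad (-x) = -D.ad x := by ext; simp

/-- The bracket as a continuous bilinear map. -/
noncomputable def brL : V →L[ℝ] V →L[ℝ] V := LinearMap.toContinuousLinearMap
  ({ toFun := D.ad, map_add' := D.ad_add, map_smul' := D.ad_smul } : V →ₗ[ℝ] V →L[ℝ] V)

@[simp] lemma brL_apply (x y : V) : D.brL x y = D.br x y := rfl

lemma hasDerivAt_exp_ad (x y : V) (s : ℝ) :
    HasDerivAt (fun s : ℝ => exp (s • D.ad x) y) (D.br x (exp (s • D.ad x) y)) s := by
  have := (hasDerivAt_exp_smul_const' (D.ad x) s).clm_apply (hasDerivAt_const s y)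
  simpa using this

lemma exp_neg_ad_exp_ad (x y : V) : exp (-D.ad x) (exp (D.ad x) y) = y := by
  let _ : NormedAlgebra ℚ (V →L[ℝ] V) := NormedAlgebra.restrictScalars ℚ ℝ _
  have : exp (-D.ad x) * exp (D.ad x) = 1 := by
    rw [← exp_add_of_commute (Commute.refl (D.ad x)).neg_left]; simp
  exact DFunLike.congr_fun this y

lemma exp_ad_exp_neg_ad (x y : V) : exp (D.ad x) (exp (-D.ad x) y) = y := by
  simpa [ad_neg] using D.exp_neg_ad_exp_ad (-x) y

/-- Since `ad x` is a derivation, `exp(-s ad x)` applied to the bracket of the two transported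
vectors has zero derivative in `s`. -/
lemma exp_ad_br (x y z : V) :
    exp (D.ad x) (D.br y z) = D.br (exp (D.ad x) y) (exp (D.ad x) z) := by
  have hconst : ∀ s : ℝ, HasDerivAt (fun s : ℝ =>
      exp (s • D.ad (-x)) (D.br (exp (s • D.ad x) y) (exp (s • D.ad x) z))) 0 s := by
    intro s
    have h1 : HasDerivAt (fun s : ℝ => D.br (exp (s • D.ad x) y) (exp (s • D.ad x) z))
        (D.br x (D.br (exp (s • D.ad x) y) (exp (s • D.ad x) z))) s := by
      have := (D.brL.hasFDerivAt.comp_hasDerivAt s (D.hasDerivAt_exp_ad x y s)).clm_apply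
        (D.hasDerivAt_exp_ad x z s)
      simpa [D.jacobi x] using this
    have h2 := (hasDerivAt_exp_smul_const (D.ad (-x)) s).clm_apply h1
    convert h2 using 1
    simp [ad_neg]
  have hc := is_const_of_deriv_eq_zero (fun s => (hconst s).differentiableAt)
    (fun s => (hconst s).deriv) 1 0
  simp only [one_smul, zero_smul, exp_zero, one_apply_eq_self, ad_neg] at hc
  rw [← hc, exp_ad_exp_neg_ad]

/-- The adjoint of `ad x` is `-ad (θ x)`, so the two flows compensate each other. In particular
`exp(ad x)` is an isometry when `θ x = x`. -/
lemma inner_exp_ad_exp_ad (x y z : V) :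
    ⟪exp (D.ad x) y, exp (D.ad (D.θ x)) z⟫ = ⟪y, z⟫ := by
  have hconst : ∀ s : ℝ, HasDerivAt (fun s : ℝ =>
      ⟪exp (s • D.ad x) y, exp (s • D.ad (D.θ x)) z⟫) 0 s := by
    intro s
    have := (D.hasDerivAt_exp_ad x y s).inner ℝ (D.hasDerivAt_exp_ad (D.θ x) z s)
    simpa [D.inner_br x] using this
  have hc := is_const_of_deriv_eq_zero (fun s => (hconst s).differentiableAt)
    (fun s => (hconst s).deriv) 1 0
  simpa only [one_smul, zero_smul, exp_zero, one_apply_eq_self] using hc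

lemma inner_exp_ad (x y z : V) :
    ⟪exp (D.ad x) y, z⟫ = ⟪y, exp (-D.ad (D.θ x)) z⟫ := by
  rw [← D.inner_exp_ad_exp_ad x y, exp_ad_exp_neg_ad]

lemma θ_exp_ad (x y : V) : D.θ (exp (D.ad x) y) = exp (D.ad (D.θ x)) (D.θ y) := by
  have hconst : ∀ s : ℝ, HasDerivAt (fun s : ℝ =>
      exp (s • D.ad (-D.θ x)) (D.θ (exp (s • D.ad x) y))) 0 s := by
    intro s
    have h1 : HasDerivAt (fun s : ℝ => D.θ (exp (s • D.ad x) y))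
        (D.θ (D.br x (exp (s • D.ad x) y))) s :=
      (LinearMap.toContinuousLinearMap D.θ).hasFDerivAt.comp_hasDerivAt s
        (D.hasDerivAt_exp_ad x y s)
    have h2 := (hasDerivAt_exp_smul_const (D.ad (-D.θ x)) s).clm_apply h1
    convert h2 using 1
    simp [ad_neg, D.θ_br]
  have hc := is_const_of_deriv_eq_zero (fun s => (hconst s).differentiableAt)
    (fun s => (hconst s).deriv) 1 0
  simp only [one_smul, zero_smul, exp_zero, one_apply_eq_self, ad_neg] at hc
  rw [← hc, exp_ad_exp_neg_ad]

/-- The cone of elements `u` for which `(ad u)²` is the rank one operator attached to `u` and to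
the constant `c`; long root vectors are of this kind. -/
def rankOneCone (c : ℝ) : Set V := {u | ∀ x, D.br u (D.br u x) = (c * ⟪u, D.θ x⟫) • u}

/-! ### The rank one cone and the flows that preserve it. -/

variable {D} {c : ℝ} {e : V}

/-- The cone is defined through the bracket and the pairing `⟪u, θ x⟫`, and both are invariant under
`exp(ad x)`. -/
lemma exp_ad_mem_rankOneCone {u : V} (hu : u ∈ D.rankOneCone c) (x : V) :
    exp (D.ad x) u ∈ D.rankOneCone c := by
  intro z
  obtain ⟨y, rfl⟩ : ∃ y, exp (D.ad x) y = z := ⟨_, D.exp_ad_exp_neg_ad x z⟩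
  rw [← exp_ad_br, ← exp_ad_br, hu y, θ_exp_ad, inner_exp_ad_exp_ad, map_smul]

/-- On the cone `(ad X)² y` is a multiple of `X`, so `(ad X)³ = 0` and the exponential series stops
in degree two. -/
lemma exp_smul_ad_apply_of_mem {X : V} (hX : X ∈ D.rankOneCone c) (s : ℝ) (y : V) :
    exp (s • D.ad X) y = y + s • D.br X y + (s ^ 2 / 2) • D.br X (D.br X y) := by
  have h3 : D.ad X ^ 3 = 0 := by
    ext y
    simp [pow_succ, hX y, D.br_self]
  have hexp : exp (s • D.ad X) = 1 + s • D.ad X + (s ^ 2 / 2) • D.ad X ^ 2 := by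
    simp only [exp_eq_tsum ℝ]
    rw [tsum_eq_sum (s := Finset.range 3)]
    · simp [Finset.sum_range_succ, smul_pow, smul_smul]
      congr 1; ring
    · intro n hn
      obtain ⟨k, rfl⟩ := Nat.exists_eq_add_of_le (by simpa using hn : 3 ≤ n)
      simp [pow_add, smul_pow, h3]
  rw [hexp]
  simp [pow_succ]

/-- If a zero of `⟪·, e⟫` on the cone is always a critical point, then the closure of the
positive part of the cone is stable under the flows attached to the elements of the cone. -/
lemma exp_ad_mem_closure_pos (hcrit : ∀ u ∈ D.rankOneCone c, ⟪u, e⟫ = 0 → D.br u (D.θ e) = 0)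
    {X : V} (hX : X ∈ D.rankOneCone c) (s : ℝ) {u : V}
    (hu : u ∈ closure {u | u ∈ D.rankOneCone c ∧ 0 < ⟪u, e⟫}) :
    exp (s • D.ad X) u ∈ closure {u | u ∈ D.rankOneCone c ∧ 0 < ⟪u, e⟫} := by
  suffices h : Set.MapsTo (exp (s • D.ad X) : V →L[ℝ] V) {u | u ∈ D.rankOneCone c ∧ 0 < ⟪u, e⟫}
      (closure {u | u ∈ D.rankOneCone c ∧ 0 < ⟪u, e⟫}) by
    simpa using h.closure (exp (s • D.ad X)).continuous hu
  rintro u ⟨hu, hpos⟩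
  have hmem : ∀ t : ℝ, exp (t • D.ad X) u ∈ D.rankOneCone c := fun t => by
    rw [← ad_smul]; exact exp_ad_mem_rankOneCone hu _
  set p : ℝ → ℝ := fun t => ⟪exp (t • D.ad X) u, e⟫ with hp
  have hcont : Continuous fun t : ℝ => exp (t • D.ad X) u :=
    continuous_iff_continuousAt.2 fun t => (D.hasDerivAt_exp_ad X u t).continuousAt
  have hpcont : Continuous p := hcont.inner continuous_const
  set b := ⟪D.br X u, e⟫
  set d := ⟪D.br X (D.br X u), e⟫ / 2
  have hpoly : ∀ t, p t = p 0 + b * t + d * t ^ 2 := by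
    intro t
    simp only [hp, exp_smul_ad_apply_of_mem hX, inner_add_left, inner_smul_left, b, d]
    simp
    ring
  have hp0 : 0 < p 0 := by simpa [hp] using hpos
  -- With `v = exp(r ad X) u`, the derivative at `r` is `⟪[X, v], e⟫ = ⟪X, [θv, e]⟫`, and `[θv, e] =
  -- θ[v, θe]` vanishes by `hcrit`.
  have hzero : ∀ r, p r = 0 → b + 2 * d * r = 0 := by
    intro r hr
    have h1 : HasDerivAt p ⟪D.br X (exp (r • D.ad X) u), e⟫ r := by
      simpa using (D.hasDerivAt_exp_ad X u r).inner ℝ (hasDerivAt_const r e)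
    have h2 : HasDerivAt p (b + 2 * d * r) r := by
      have : p = fun t => p 0 + b * t + d * t ^ 2 := funext hpoly
      rw [this]
      exact ((((hasDerivAt_id' r).const_mul b).const_add (p 0)).fun_add
        (((hasDerivAt_id' r).fun_pow 2).const_mul d)).congr_deriv (by simp; ring)
    rw [← h1.unique h2, D.br_swap, inner_neg_left, D.inner_br, neg_neg]
    have h3 := congrArg D.θ (hcrit _ (hmem r) hr)
    rw [D.θ_br, D.θ_θ, map_zero] at h3
    rw [h3, inner_zero_right]
  -- A zero is therefore double; the leading coefficient is positive because `p 0 > 0`.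
  have hsq : ∀ r, p r = 0 → 0 < d ∧ ∀ t, p t = d * (t - r) ^ 2 := by
    intro r hr
    have h1 := hzero r hr
    have h2 : ∀ t, p t = d * (t - r) ^ 2 := by
      intro t
      have h3 := hpoly r
      rw [hpoly t]
      linear_combination h1 * (t - r) + hr - h3
    refine ⟨?_, h2⟩
    rw [h2 0] at hp0
    exact pos_of_mul_pos_left hp0 (sq_nonneg _)
  by_cases hroot : ∃ r, p r = 0
  · obtain ⟨r, hr⟩ := hroot
    obtain ⟨hd, hsq⟩ := hsq r hr
    by_cases hsr : s = r
    · refine mem_closure_of_tendsto (b := 𝓝[≠] s) (hcont.continuousAt.mono_left inf_le_left) ?_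
      filter_upwards [self_mem_nhdsWithin] with t ht
      refine ⟨hmem t, ?_⟩
      have : t - r ≠ 0 := sub_ne_zero.2 (hsr ▸ ht)
      change 0 < p t
      rw [hsq t]; positivity
    · refine subset_closure ⟨hmem s, ?_⟩
      have : s - r ≠ 0 := sub_ne_zero.2 hsr
      change 0 < p s
      rw [hsq s]; positivity
  · refine subset_closure ⟨hmem s, ?_⟩
    change 0 < p s
    by_contra! hneg
    exact hroot (mem_range_of_exists_le_of_exists_ge hpcont ⟨s, hneg⟩ ⟨0, hp0.le⟩)

/-- The set of `Y` whose flow preserves a closed set is stable under addition. -/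
lemma mapsTo_exp_ad_add {C : Set V} (hC : IsClosed C) {X Y : V}
    (hX : ∀ s : ℝ, Set.MapsTo (exp (s • D.ad X) : V →L[ℝ] V) C C)
    (hY : ∀ s : ℝ, Set.MapsTo (exp (s • D.ad Y) : V →L[ℝ] V) C C) (s : ℝ) :
    Set.MapsTo (exp (s • D.ad (X + Y)) : V →L[ℝ] V) C C := by
  -- The operator algebra has `‖1‖ = 1` only when `V` is nontrivial.
  rcases subsingleton_or_nontrivial V with hV | hV
  · intro u hu
    rwa [Subsingleton.elim ((exp (s • D.ad (X + Y)) : V →L[ℝ] V) u) u]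
  intro u hu
  have h := tendsto_exp_mul_exp_pow (s • D.ad X) (s • D.ad Y)
  rw [← smul_add, ← ad_add] at h
  have h' := ((ContinuousLinearMap.apply ℝ V u).continuous.tendsto _).comp h
  refine hC.mem_of_tendsto h' (Eventually.of_forall fun n => ?_)
  have hpow : ∀ k : ℕ, Set.MapsTo (((exp ((n : ℝ)⁻¹ • s • D.ad X) *
      exp ((n : ℝ)⁻¹ • s • D.ad Y)) ^ k : V →L[ℝ] V)) C C := by
    intro k
    induction k with
    | zero => intro x hx; simpa using hx
    | succ k ih =>
      intro x hx
      rw [pow_succ]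
      refine ih ?_
      rw [smul_smul, smul_smul]
      exact hX _ (hY _ hx)
  exact hpow n hu

/-- The span is stable under `exp(t ad x)`, hence under the limit `[x, ·]` of difference quotients;
it is a nonzero ideal. -/
lemma span_rankOneCone_eq_top (hsimple : ∀ W : Submodule ℝ V, (∀ x, ∀ y ∈ W, D.br x y ∈ W) →
    W = ⊥ ∨ W = ⊤) (he : e ∈ D.rankOneCone c) (he0 : e ≠ 0) :
    Submodule.span ℝ (D.rankOneCone c) = ⊤ := by
  refine (hsimple _ ?_).resolve_left ?_
  · intro x y hy
    induction hy using Submodule.span_induction with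
    | mem y hy =>
      have h1 := (D.hasDerivAt_exp_ad x y 0).tendsto_slope_zero_right
      simp only [zero_smul, exp_zero, one_apply_eq_self, zero_add] at h1
      refine (Submodule.closed_of_finiteDimensional _).mem_of_tendsto h1
        (Eventually.of_forall fun t => ?_)
      refine Submodule.smul_mem _ _ (Submodule.sub_mem _ (Submodule.subset_span ?_)
        (Submodule.subset_span hy))
      rw [← ad_smul]
      exact exp_ad_mem_rankOneCone hy _
    | zero => simp
    | add y z _ _ hy hz => rw [map_add]; exact Submodule.add_mem _ hy hz
    | smul a y _ hy => rw [map_smul]; exact Submodule.smul_mem _ _ hy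
  · intro h
    exact he0 ((Submodule.eq_bot_iff _).1 h e (Submodule.subset_span he))

/-- Under the same hypothesis, all flows preserve the half space `⟪·, e⟫ ≥ 0` along the orbit. -/
lemma mapsTo_exp_ad_closure_pos
    (hsimple : ∀ W : Submodule ℝ V, (∀ x, ∀ y ∈ W, D.br x y ∈ W) → W = ⊥ ∨ W = ⊤)
    (he : e ∈ D.rankOneCone c) (he0 : e ≠ 0)
    (hcrit : ∀ u ∈ D.rankOneCone c, ⟪u, e⟫ = 0 → D.br u (D.θ e) = 0) (Y : V) :
    Set.MapsTo (exp (D.ad Y) : V →L[ℝ] V) (closure {u | u ∈ D.rankOneCone c ∧ 0 < ⟪u, e⟫})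
      (closure {u | u ∈ D.rankOneCone c ∧ 0 < ⟪u, e⟫}) := by
  have hY : Y ∈ Submodule.span ℝ (D.rankOneCone c) := by
    rw [span_rankOneCone_eq_top hsimple he he0]; trivial
  suffices h : ∀ s : ℝ, Set.MapsTo (exp (s • D.ad Y) : V →L[ℝ] V)
      (closure {u | u ∈ D.rankOneCone c ∧ 0 < ⟪u, e⟫})
      (closure {u | u ∈ D.rankOneCone c ∧ 0 < ⟪u, e⟫}) by simpa using h 1
  induction hY using Submodule.span_induction with
  | mem X hX => exact fun s u hu => exp_ad_mem_closure_pos hcrit hX s hu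
  | zero => intro s u hu; simpa [show D.ad 0 = 0 by ext; simp] using hu
  | add X Y _ _ hX hY => exact mapsTo_exp_ad_add isClosed_closure hX hY
  | smul a X _ hX => intro s; rw [ad_smul, smul_smul]; exact hX _

end EuclideanCartanAlgebra

/-! ### Fixed vectors of groups of isometries -/

/-- A monoid of isometries of a Euclidean space, one of whose orbits consists of vectors with
pairwise nonnegative inner products, has a nonzero fixed vector. -/
theorem exists_fixed_vector_of_inner_nonneg {V : Type*} [NormedAddCommGroup V]
    [InnerProductSpace ℝ V] [FiniteDimensional ℝ V] (K : Submonoid (V →L[ℝ] V))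
    (hiso : ∀ k ∈ K, ∀ x, ‖k x‖ = ‖x‖) {e : V} (he : e ≠ 0)
    (hpos : ∀ k ∈ K, ∀ k' ∈ K, 0 ≤ ⟪k e, k' e⟫) : ∃ w ≠ 0, ∀ k ∈ K, k w = w := by
  set S : Set V := {x | ∃ k ∈ K, k e = x} with hS
  have heS : e ∈ S := ⟨1, K.one_mem, rfl⟩
  have hnorm : ∀ x ∈ S, ‖x‖ = ‖e‖ := by
    rintro _ ⟨k, hk, rfl⟩; exact hiso k hk e
  have hr : 0 < ‖e‖ := norm_pos_iff.2 he
  have hinner : ∀ x ∈ S, ∀ y ∈ S, 0 ≤ ⟪x, y⟫ := by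
    rintro _ ⟨k, hk, rfl⟩ _ ⟨k', hk', rfl⟩; exact hpos k hk k' hk'
  have htb : TotallyBounded S := by
    have : Bornology.IsBounded S := isBounded_iff_forall_norm_le.2 ⟨‖e‖, fun x hx => (hnorm x hx).le⟩
    exact (this.isCompact_closure.totallyBounded).subset subset_closure
  -- Let `y` be the sum of a finite `‖e‖/2`-net of the orbit. Every orbit point is close to some net
  -- point, pairs with it to at least `‖e‖²/2`, and pairs nonnegatively with the others. So a half
  -- space away from `0` contains the closed convex hull `Q`.
  obtain ⟨F, hFS, hF, hcover⟩ :=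
    Metric.finite_approx_of_totallyBounded htb (‖e‖ / 2) (by positivity)
  set y : V := ∑ x ∈ hF.toFinset, x
  have hy : ∀ x ∈ S, ‖e‖ ^ 2 / 2 ≤ ⟪x, y⟫ := by
    intro x hx
    obtain ⟨z, hz, hxz⟩ := Set.mem_iUnion₂.1 (hcover hx)
    have hzS := hFS hz
    have h1 : ⟪x, z⟫ ≤ ⟪x, y⟫ := by
      rw [inner_sum]
      exact Finset.single_le_sum (f := fun z => ⟪x, z⟫) (fun i hi => hinner x hx i
        (hFS (by simpa using hi))) (by simpa using hz)
    refine le_trans ?_ h1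
    have h2 : ‖x - z‖ < ‖e‖ / 2 := by rwa [← dist_eq_norm]
    have h3 : ⟪x, z⟫ = ⟪z, z⟫ + ⟪x - z, z⟫ := by rw [inner_sub_left]; ring
    have h4 := abs_le.1 (abs_real_inner_le_norm (x - z) z)
    rw [hnorm z hzS] at h4
    rw [h3, real_inner_self_eq_norm_sq, hnorm z hzS]
    nlinarith
  set Q : Set V := closure (convexHull ℝ S)
  have hQy : ∀ x ∈ Q, ‖e‖ ^ 2 / 2 ≤ ⟪x, y⟫ := by
    have hcl : IsClosed {x : V | ‖e‖ ^ 2 / 2 ≤ ⟪x, y⟫} :=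
      isClosed_le continuous_const (continuous_id.inner continuous_const)
    have hcv : Convex ℝ {x : V | ‖e‖ ^ 2 / 2 ≤ ⟪x, y⟫} :=
      convex_halfSpace_ge ⟨fun a b => inner_add_left a b y, fun a b => by simp [inner_smul_left]⟩ _
    exact closure_minimal (convexHull_min hy hcv) hcl
  have hQcv : Convex ℝ Q := (convex_convexHull ℝ S).closure
  have hQK : ∀ k ∈ K, ∀ x ∈ Q, k x ∈ Q := by
    intro k hk x hx
    have h1 : Set.MapsTo k (convexHull ℝ S) (convexHull ℝ S) := by
      intro x hx
      have h2 : k.toLinearMap '' S ⊆ S := by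
        rintro _ ⟨_, ⟨k', hk', rfl⟩, rfl⟩
        exact ⟨k * k', K.mul_mem hk hk', rfl⟩
      have h3 := LinearMap.image_convexHull k.toLinearMap S
      exact convexHull_mono h2 (h3 ▸ Set.mem_image_of_mem _ hx)
    exact h1.closure k.continuous hx
  -- The point of `Q` nearest to `0` is unique, and `K` preserves `Q` and norms, so this point is
  -- fixed.
  obtain ⟨w, hwQ, hw⟩ := exists_norm_eq_iInf_of_complete_convex
    (⟨e, subset_closure (subset_convexHull ℝ S heS)⟩ : Q.Nonempty) isClosed_closure.isComplete hQcv 0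
  rw [norm_eq_iInf_iff_real_inner_le_zero hQcv hwQ] at hw
  refine ⟨w, ?_, fun k hk => ?_⟩
  · rintro rfl
    have := hQy 0 hwQ
    rw [inner_zero_left] at this
    nlinarith
  · have h1 := hw _ (hQK k hk w hwQ)
    rw [zero_sub, inner_neg_left, inner_sub_right, real_inner_self_eq_norm_sq] at h1
    have h2 := norm_sub_sq_real (k w) w
    rw [hiso k hk w, real_inner_comm] at h2
    have h3 : ‖k w - w‖ ^ 2 ≤ 0 := by linarith
    exact sub_eq_zero.1 (norm_eq_zero.1 (pow_eq_zero_iff two_ne_zero |>.1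
      (le_antisymm h3 (sq_nonneg _))))

namespace EuclideanCartanAlgebra

variable {V : Type*} [NormedAddCommGroup V] [InnerProductSpace ℝ V] [FiniteDimensional ℝ V]
  {D : EuclideanCartanAlgebra V} {c : ℝ} {e : V}

/-- If a zero of `⟪·, e⟫` on the rank one cone is always a critical point, then the fixed
subalgebra of the Cartan involution has a nonzero center. -/
theorem exists_center_of_critical
    (hsimple : ∀ W : Submodule ℝ V, (∀ x, ∀ y ∈ W, D.br x y ∈ W) → W = ⊥ ∨ W = ⊤)
    (hcenter : ∀ x, (∀ y, D.br x y = 0) → x = 0)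
    (he : e ∈ D.rankOneCone c) (he0 : e ≠ 0)
    (hcrit : ∀ u ∈ D.rankOneCone c, ⟪u, e⟫ = 0 → D.br u (D.θ e) = 0) :
    ∃ w ≠ 0, D.θ w = w ∧ ∀ y, D.θ y = y → D.br w y = 0 := by
  set C : Set V := closure {u | u ∈ D.rankOneCone c ∧ 0 < ⟪u, e⟫}
  have heC : e ∈ C := subset_closure ⟨he, by rw [real_inner_self_eq_norm_sq]; positivity⟩
  have hCpos : C ⊆ {x | 0 ≤ ⟪x, e⟫} :=
    closure_minimal (fun x hx => hx.2.le)
      (isClosed_le continuous_const (continuous_id.inner continuous_const))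
  set K : Submonoid (V →L[ℝ] V) :=
    Submonoid.closure {k | ∃ Y, D.θ Y = Y ∧ exp (D.ad Y) = k}
  have hKC : ∀ k ∈ K, ∀ x ∈ C, k x ∈ C := by
    intro k hk
    induction hk using Submonoid.closure_induction with
    | mem k hk =>
      obtain ⟨Y, -, rfl⟩ := hk
      exact fun x hx => mapsTo_exp_ad_closure_pos hsimple he he0 hcrit Y hx
    | one => exact fun x hx => hx
    | mul a b _ _ ha hb => exact fun x hx => ha _ (hb _ hx)
  -- The monoid `K` is closed under adjoints, which turns `⟪k e, k' e⟫` into the pairing of an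
  -- element of `C` with `e`.
  have hadj : ∀ k ∈ K, (∃ k' ∈ K, ∀ x y, ⟪k x, y⟫ = ⟪x, k' y⟫) ∧ ∀ x, ‖k x‖ = ‖x‖ := by
    intro k hk
    induction hk using Submonoid.closure_induction with
    | mem k hk =>
      obtain ⟨Y, hY, rfl⟩ := hk
      refine ⟨⟨exp (-D.ad Y), Submonoid.subset_closure ⟨-Y, by rw [map_neg, hY], by rw [ad_neg]⟩,
        fun x y => by rw [inner_exp_ad, hY]⟩, fun x => ?_⟩
      have := D.inner_exp_ad_exp_ad Y x x
      rw [hY, real_inner_self_eq_norm_sq, real_inner_self_eq_norm_sq] at this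
      exact (sq_eq_sq₀ (norm_nonneg _) (norm_nonneg _)).1 this
    | one => exact ⟨⟨1, K.one_mem, fun _ _ => rfl⟩, fun _ => rfl⟩
    | mul a b _ _ ha hb =>
      obtain ⟨⟨a', ha', haa⟩, ha2⟩ := ha
      obtain ⟨⟨b', hb', hbb⟩, hb2⟩ := hb
      exact ⟨⟨b' * a', K.mul_mem hb' ha', fun x y => by
        simp [haa, hbb]⟩, fun x => by simp [ha2, hb2]⟩
  obtain ⟨w, hw0, hw⟩ := exists_fixed_vector_of_inner_nonneg K (fun k hk => (hadj k hk).2) he0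
    (by
      intro k hk k' hk'
      obtain ⟨l, hl, hkl⟩ := (hadj k' hk').1
      rw [real_inner_comm, hkl, real_inner_comm]
      exact hCpos (hKC l hl _ (hKC k hk _ heC)))
  have hbr : ∀ y, D.θ y = y → D.br y w = 0 := by
    intro y hy
    have h1 : HasDerivAt (fun s : ℝ => exp (s • D.ad y) w) (D.br y w) 0 := by
      simpa using D.hasDerivAt_exp_ad y w 0
    have h2 : (fun s : ℝ => exp (s • D.ad y) w) = fun _ => w := by
      funext s
      exact hw _ (Submonoid.subset_closure ⟨s • y, by rw [map_smul, hy], by rw [ad_smul]⟩)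
    rw [h2] at h1
    exact h1.unique (hasDerivAt_const _ _)
  have hbrθ : ∀ y, D.θ y = y → D.br y (D.θ w) = 0 := by
    intro y hy
    have := congrArg D.θ (hbr y hy)
    rwa [D.θ_br, hy, map_zero] at this
  refine ⟨w + D.θ w, ?_, ?_, ?_⟩
  -- If `θw = -w`, then `w` is central: it kills the `+1`-eigenspace, and for `θy = -y` the bracket
  -- `[w, y]` is `θ`-fixed, so `‖[w, y]‖² = ⟪y, [w, [w, y]]⟫ = 0`.
  · intro h
    have hθw : D.θ w = -w := by rw [← sub_eq_zero, sub_neg_eq_add, add_comm]; exact h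
    apply hw0
    apply hcenter
    intro y
    have hk : ∀ y, D.θ y = y → D.br w y = 0 := fun y hy => by
      rw [D.br_swap, hbr y hy, neg_zero]
    have hp : ∀ y, D.θ y = -y → D.br w y = 0 := by
      intro y hy
      have h1 : D.θ (D.br w y) = D.br w y := by rw [D.θ_br, hθw, hy]; simp
      rw [← inner_self_eq_zero (𝕜 := ℝ), D.inner_br, hθw, map_neg, LinearMap.neg_apply, hk _ h1]
      simp
    have h1 := hk (y + D.θ y) (by rw [map_add, D.θ_θ, add_comm])
    have h2 := hp (y - D.θ y) (by rw [map_sub, D.θ_θ, neg_sub])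
    rw [map_add] at h1
    rw [map_sub] at h2
    have h3 : (2 : ℝ) • D.br w y = 0 := by
      rw [two_smul]
      calc _ = (D.br w y + D.br w (D.θ y)) + (D.br w y - D.br w (D.θ y)) := by abel
        _ = 0 := by rw [h1, h2, add_zero]
    simpa using h3
  · rw [map_add, D.θ_θ, add_comm]
  · intro y hy
    rw [D.br_swap, map_add, hbr y hy, hbrθ y hy, add_zero, neg_zero]

end EuclideanCartanAlgebra

end

section

open Filter Topology NormedSpace
open scoped RealInnerProductSpace

/-! ### Restricted weights -/

namespace EuclideanCartanAlgebra

variable {V : Type*} [NormedAddCommGroup V] [InnerProductSpace ℝ V]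
  (D : EuclideanCartanAlgebra V) (𝔞 : Submodule ℝ V)

/-- The weight space of `𝔞` attached to the linear form `⟪·, A⟫` on `𝔞`. -/
def weightSpace (A : V) : Submodule ℝ V where
  carrier := {x | ∀ H ∈ 𝔞, D.br H x = ⟪H, A⟫ • x}
  add_mem' := by
    intro x y hx hy H hH
    rw [map_add, hx H hH, hy H hH, smul_add]
  zero_mem' := by
    intro H _
    rw [map_zero, smul_zero]
  smul_mem' := by
    intro c x hx H hH
    rw [map_smul, hx H hH, smul_comm]

/-- `𝔞` is a maximal abelian subspace of the `-1`-eigenspace of the Cartan involution. -/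
structure IsCartanSubspace : Prop where
  br_eq_zero : ∀ H ∈ 𝔞, ∀ H' ∈ 𝔞, D.br H H' = 0
  θ_eq_neg : ∀ H ∈ 𝔞, D.θ H = -H
  mem_of_br_eq_zero : ∀ x, D.θ x = -x → (∀ H ∈ 𝔞, D.br H x = 0) → x ∈ 𝔞

variable {D 𝔞} {A A' x y : V}

lemma br_mem_weightSpace (hx : x ∈ D.weightSpace 𝔞 A) (hy : y ∈ D.weightSpace 𝔞 A') :
    D.br x y ∈ D.weightSpace 𝔞 (A + A') := by
  intro H hH
  rw [D.jacobi, hx H hH, hy H hH, inner_add_right, map_smul, map_smul, add_smul,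
    LinearMap.smul_apply]

namespace IsCartanSubspace

lemma inner_br_left (h : D.IsCartanSubspace 𝔞) {H : V} (hH : H ∈ 𝔞) (x y : V) :
    ⟪D.br H x, y⟫ = ⟪x, D.br H y⟫ := by
  rw [D.inner_br, h.θ_eq_neg H hH, map_neg, LinearMap.neg_apply, inner_neg_right, neg_neg]

lemma θ_mem_weightSpace (h : D.IsCartanSubspace 𝔞) (hx : x ∈ D.weightSpace 𝔞 A) :
    D.θ x ∈ D.weightSpace 𝔞 (-A) := by
  intro H hH
  have := congrArg D.θ (hx H hH)
  rw [D.θ_br, h.θ_eq_neg H hH, map_neg, LinearMap.neg_apply, map_smul] at this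
  rw [inner_neg_right, neg_smul, ← this, neg_neg]

/-- The operators `ad H`, `H ∈ 𝔞`, are symmetric, and `H = A - A'` separates the two weights. -/
lemma inner_eq_zero (h : D.IsCartanSubspace 𝔞) (hx : x ∈ D.weightSpace 𝔞 A)
    (hy : y ∈ D.weightSpace 𝔞 A') (hA : A ∈ 𝔞) (hA' : A' ∈ 𝔞) (hne : A ≠ A') : ⟪x, y⟫ = 0 := by
  have h1 := h.inner_br_left (𝔞.sub_mem hA hA') x y
  rw [hx _ (𝔞.sub_mem hA hA'), hy _ (𝔞.sub_mem hA hA'), real_inner_smul_left,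
    real_inner_smul_right, ← sub_eq_zero, ← sub_mul, ← inner_sub_right] at h1
  refine (mul_eq_zero.1 h1).resolve_left ?_
  rwa [inner_self_eq_zero, sub_eq_zero]

/-- The bracket has weight `0` and is negated by `θ`, so maximality puts it in `𝔞`, where its
pairings with `𝔞` determine it. -/
lemma br_θ_self (h : D.IsCartanSubspace 𝔞) (hx : x ∈ D.weightSpace 𝔞 A) (hA : A ∈ 𝔞) :
    D.br x (D.θ x) = -(‖x‖ ^ 2) • A := by
  have hθ : D.θ (D.br x (D.θ x)) = -D.br x (D.θ x) := by
    rw [D.θ_br, D.θ_θ, D.br_swap]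
  have hmem : D.br x (D.θ x) ∈ 𝔞 := by
    refine h.mem_of_br_eq_zero _ hθ fun H hH => ?_
    have := br_mem_weightSpace hx (h.θ_mem_weightSpace hx) H hH
    simpa using this
  have hmem' : D.br x (D.θ x) - -(‖x‖ ^ 2) • A ∈ 𝔞 := 𝔞.sub_mem hmem (𝔞.smul_mem _ hA)
  have key : ∀ H ∈ 𝔞, ⟪D.br x (D.θ x) - -(‖x‖ ^ 2) • A, H⟫ = 0 := by
    intro H hH
    have hxH := hx H hH
    have h1 := h.θ_mem_weightSpace hx H hH
    rw [inner_sub_left, D.inner_br, D.br_swap (D.θ x) H, h1, inner_neg_right, real_inner_smul_right,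
      D.inner_θ, real_inner_smul_left, inner_neg_right, real_inner_self_eq_norm_sq,
      real_inner_comm H A]
    ring
  exact sub_eq_zero.1 (inner_self_eq_zero.1 (key _ hmem'))

variable [FiniteDimensional ℝ V]

/-- Commuting symmetric operators are jointly diagonalizable. A joint eigenvalue that occurs is
linear on `𝔞`, hence represented by some `A ∈ 𝔞`. -/
lemma iSup_weightSpace (h : D.IsCartanSubspace 𝔞) : ⨆ A : 𝔞, D.weightSpace 𝔞 A = ⊤ := by
  have hcomm : Pairwise (Function.onFun Commute fun H : 𝔞 => (D.br H : V →ₗ[ℝ] V)) := by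
    intro H H' _
    refine LinearMap.ext fun x => ?_
    have := D.jacobi H H' x
    rw [h.br_eq_zero H H.2 H' H'.2, map_zero, LinearMap.zero_apply, zero_add] at this
    exact this
  rw [eq_top_iff, ← LinearMap.IsSymmetric.iSup_iInf_eq_top_of_commute
    (fun H : 𝔞 => fun x y => h.inner_br_left H.2 x y) hcomm]
  refine iSup_le fun χ => ?_
  rcases eq_or_ne (⨅ H : 𝔞, Module.End.eigenspace (D.br H) (χ H)) ⊥ with hbot | hne
  · rw [hbot]; exact bot_le
  obtain ⟨x, hx, hx0⟩ := Submodule.exists_mem_ne_zero_of_ne_bot hne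
  simp only [Submodule.mem_iInf, Module.End.mem_eigenspace_iff] at hx
  let χL : 𝔞 →ₗ[ℝ] ℝ :=
    { toFun := χ
      map_add' := fun H H' => smul_left_injective ℝ hx0 (by
        change χ (H + H') • x = (χ H + χ H') • x
        rw [add_smul, ← hx, ← hx, ← hx, Submodule.coe_add, map_add, LinearMap.add_apply])
      map_smul' := fun c H => smul_left_injective ℝ hx0 (by
        change χ (c • H) • x = (c • χ H) • x
        rw [smul_assoc, ← hx, ← hx, Submodule.coe_smul, map_smul, LinearMap.smul_apply]) }
  let A : 𝔞 := (InnerProductSpace.toDual ℝ 𝔞).symm (LinearMap.toContinuousLinearMap χL)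
  have hA : ∀ H : 𝔞, ⟪(H : V), (A : V)⟫ = χ H := by
    intro H
    have : ⟪A, H⟫ = χ H := by
      simp only [A, InnerProductSpace.toDual_symm_apply]; rfl
    rw [← this, real_inner_comm, Submodule.coe_inner]
  refine le_iSup_of_le A fun y hy => ?_
  simp only [Submodule.mem_iInf, Module.End.mem_eigenspace_iff] at hy
  intro H hH
  rw [hA ⟨H, hH⟩, ← hy ⟨H, hH⟩]

/-- Every vector is a finite sum of nonzero weight vectors. -/
lemma exists_sum_weight (h : D.IsCartanSubspace 𝔞) (x : V) :
    ∃ (s : Finset V) (f : V → V), (∀ A ∈ s, A ∈ 𝔞 ∧ f A ∈ D.weightSpace 𝔞 A ∧ f A ≠ 0) ∧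
      ∑ A ∈ s, f A = x := by
  classical
  have hx : x ∈ ⨆ A : 𝔞, D.weightSpace 𝔞 A := by rw [h.iSup_weightSpace]; trivial
  obtain ⟨F, hF, hsum⟩ := (Submodule.mem_iSup_iff_exists_finsupp _ _).1 hx
  refine ⟨F.support.map ⟨Subtype.val, Subtype.val_injective⟩,
    fun A => if hA : A ∈ 𝔞 then F ⟨A, hA⟩ else 0, ?_, ?_⟩
  · intro A hA
    obtain ⟨B, hB, rfl⟩ := Finset.mem_map.1 hA
    simp only [Function.Embedding.coeFn_mk, SetLike.coe_mem, dif_pos]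
    exact ⟨trivial, hF B, Finsupp.mem_support_iff.1 hB⟩
  · rw [Finset.sum_map]
    simpa [Finsupp.sum] using hsum

lemma exp_smul_ad_apply (hx : x ∈ D.weightSpace 𝔞 A) {H : V} (hH : H ∈ 𝔞) (t : ℝ) :
    exp (t • D.ad H) x = Real.exp (t * ⟪H, A⟫) • x := by
  have hconst : ∀ s : ℝ, HasDerivAt
      (fun s : ℝ => Real.exp (-(s * ⟪H, A⟫)) • exp (s • D.ad H) x) 0 s := by
    intro s
    have h1 : HasDerivAt (fun s : ℝ => exp (s • D.ad H) x) (⟪H, A⟫ • exp (s • D.ad H) x) s := by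
      have := (hasDerivAt_exp_smul_const (D.ad H) s).clm_apply (hasDerivAt_const s x)
      simpa [hx H hH] using this
    have h2 : HasDerivAt (fun s : ℝ => Real.exp (-(s * ⟪H, A⟫)))
        (Real.exp (-(s * ⟪H, A⟫)) * -⟪H, A⟫) s := by
      simpa using (((hasDerivAt_id' s).mul_const ⟪H, A⟫).fun_neg).exp
    refine (h2.fun_smul h1).congr_deriv ?_
    rw [smul_smul, ← add_smul]
    simp
  have hc := is_const_of_deriv_eq_zero (fun s => (hconst s).differentiableAt)
    (fun s => (hconst s).deriv) t 0
  simp only [zero_mul, neg_zero, Real.exp_zero, zero_smul, exp_zero, one_apply_eq_self,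
    one_smul] at hc
  conv_rhs => rw [← hc, smul_smul, ← Real.exp_add]
  simp

/-- The rank one cone is stable under passing to the components of highest weight. -/
lemma sum_filter_mem_rankOneCone {c : ℝ} {s : Finset V} {f : V → V}
    (hf : ∀ A ∈ s, f A ∈ D.weightSpace 𝔞 A) (hs : ∑ A ∈ s, f A ∈ D.rankOneCone c)
    {H : V} (hH : H ∈ 𝔞) {M : ℝ} (hM : ∀ A ∈ s, ⟪H, A⟫ ≤ M) :
    ∑ A ∈ s with ⟪H, A⟫ = M, f A ∈ D.rankOneCone c := by
  have hclosed : IsClosed (D.rankOneCone c) := by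
    have : D.rankOneCone c = ⋂ x, {u | D.brL u (D.brL u x) = (c * ⟪u, D.θ x⟫) • u} := by
      ext u; simp [rankOneCone]
    rw [this]
    refine isClosed_iInter fun x => isClosed_eq ?_ ?_
    · exact D.brL.continuous.clm_apply (D.brL.continuous.clm_apply continuous_const)
    · exact (continuous_const.mul (continuous_id.inner continuous_const)).smul continuous_id
  have hscale : ∀ (a : ℝ), ∀ u ∈ D.rankOneCone c, a • u ∈ D.rankOneCone c := by
    intro a u hu x
    simp only [map_smul, LinearMap.smul_apply, hu x, smul_smul, real_inner_smul_left]
    congr 1; ring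
  -- Flow along `H` and rescale by `exp(-tM)`: as `t → ∞` only the components with `⟪H, A⟫ = M`
  -- survive. The cone is closed and stable under scaling.
  have hlim : Tendsto (fun t : ℝ => ∑ A ∈ s, Real.exp (t * (⟪H, A⟫ - M)) • f A) atTop
      (𝓝 (∑ A ∈ s, if ⟪H, A⟫ = M then f A else 0)) := by
    refine tendsto_finsetSum _ fun A hA => ?_
    split_ifs with hAM
    · simp [hAM]
    · have hneg : ⟪H, A⟫ - M < 0 := sub_neg.2 (lt_of_le_of_ne (hM A hA) hAM)
      have := (Real.tendsto_exp_atBot.comp (tendsto_id.atTop_mul_const_of_neg hneg)).smul_const (f A)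
      simpa [Function.comp_def] using this
  rw [Finset.sum_filter]
  refine hclosed.mem_of_tendsto hlim (Eventually.of_forall fun t => ?_)
  have h1 : ∑ A ∈ s, Real.exp (t * (⟪H, A⟫ - M)) • f A =
      Real.exp (-(t * M)) • exp (D.ad (t • H)) (∑ A ∈ s, f A) := by
    rw [map_sum, Finset.smul_sum]
    refine Finset.sum_congr rfl fun A hA => ?_
    rw [ad_smul, exp_smul_ad_apply (hf A hA) hH, smul_smul, ← Real.exp_add]
    congr 2; ring
  rw [h1]
  exact hscale _ _ (exp_ad_mem_rankOneCone hs _)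

variable {A₀ e : V}

/-- A root vector spanning the root space of a longest root lies in the rank one cone. -/
lemma mem_rankOneCone_of_longest (h : D.IsCartanSubspace 𝔞) (hA₀ : A₀ ∈ 𝔞)
    (he : e ∈ D.weightSpace 𝔞 A₀) (hone : ∀ x ∈ D.weightSpace 𝔞 A₀, ∃ t : ℝ, x = t • e)
    (hlong : ∀ A ∈ 𝔞, ∀ x ∈ D.weightSpace 𝔞 A, x ≠ 0 → ‖A‖ ≤ ‖A₀‖) :
    e ∈ D.rankOneCone (‖A₀‖ ^ 2) := by
  intro x
  have hx : x ∈ ⨆ A : 𝔞, D.weightSpace 𝔞 A := by rw [h.iSup_weightSpace]; trivial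
  induction hx using Submodule.iSup_induction' with
  | zero => simp
  | add x y _ _ hx hy =>
    rw [map_add, map_add, hx, hy, map_add, inner_add_right, mul_add, add_smul]
  | mem A x hx =>
    -- Only weight `-A₀` contributes; it is spanned by `θ e`, and there the constant `‖A₀‖²` arises
    -- from `[A₀, e] = ‖A₀‖² e`.
    by_cases hA : (A : V) = -A₀
    · have hθx := h.θ_mem_weightSpace hx
      rw [hA, neg_neg] at hθx
      obtain ⟨t, ht⟩ := hone _ hθx
      have hxt : x = t • D.θ e := by rw [← D.θ_θ x, ht, map_smul]
      rw [hxt, map_smul, map_smul, h.br_θ_self he hA₀, map_smul, D.br_swap, he A₀ hA₀, map_smul,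
        D.θ_θ, real_inner_smul_right, real_inner_self_eq_norm_sq, real_inner_self_eq_norm_sq,
        smul_neg, neg_smul, neg_neg, smul_smul, smul_smul]
      congr 1; ring
    · have hzero : ⟪e, D.θ x⟫ = 0 :=
        h.inner_eq_zero he (h.θ_mem_weightSpace hx) hA₀ (𝔞.neg_mem A.2)
          (fun h' => hA (by rw [h', neg_neg]))
      rw [hzero, mul_zero, zero_smul]
      -- Otherwise `A` and `A + 2A₀` are both weights of length at most `‖A₀‖`, and the
      -- parallelogram law forces `A + A₀ = 0`.
      by_contra hne
      have hx0 : x ≠ 0 := by rintro rfl; simp at hne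
      have h1 := hlong A A.2 x hx hx0
      have h2 := hlong _ (𝔞.add_mem hA₀ (𝔞.add_mem hA₀ A.2)) _
        (br_mem_weightSpace he (br_mem_weightSpace he hx)) hne
      have h3 := parallelogram_law_with_norm ℝ (A + A₀) A₀
      have h4 : ‖(A : V) + A₀ + A₀‖ = ‖A₀ + (A₀ + A)‖ := by congr 1; abel
      rw [h4, add_sub_cancel_right] at h3
      have h5 : ‖(A : V) + A₀‖ = 0 := by
        have := norm_nonneg ((A : V) + A₀)
        nlinarith [norm_nonneg (A : V), norm_nonneg (A₀ + (A₀ + (A : V)))]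
      exact hA (eq_neg_of_add_eq_zero_left (norm_eq_zero.1 h5))

/-- Either a zero `u` of `⟪·, e⟫` on the rank one cone is a critical point, or there is a root of
maximal length which is neither equal nor orthogonal to the given longest root. -/
lemma br_eq_zero_or_exists_weight (h : D.IsCartanSubspace 𝔞) (hA₀ : A₀ ∈ 𝔞)
    (he : e ∈ D.weightSpace 𝔞 A₀) (he0 : e ≠ 0)
    (hone : ∀ x ∈ D.weightSpace 𝔞 A₀, ∃ t : ℝ, x = t • e)
    (hlong : ∀ A ∈ 𝔞, ∀ x ∈ D.weightSpace 𝔞 A, x ≠ 0 → ‖A‖ ≤ ‖A₀‖)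
    {u : V} (hu : u ∈ D.rankOneCone (‖A₀‖ ^ 2)) (hue : ⟪u, e⟫ = 0) :
    D.br u (D.θ e) = 0 ∨ ∃ A ∈ 𝔞, ∃ w ∈ D.weightSpace 𝔞 A, w ≠ 0 ∧ ‖A‖ = ‖A₀‖ ∧
      0 < ⟪A₀, A⟫ ∧ A ≠ A₀ := by
  classical
  obtain ⟨s, f, hf, rfl⟩ := h.exists_sum_weight u
  -- A component of weight `A₀` would be a multiple of `e`, which `⟪u, e⟫ = 0` excludes.
  have hA₀s : A₀ ∉ s := by
    intro hmem
    obtain ⟨t, ht⟩ := hone _ (hf A₀ hmem).2.1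
    rw [sum_inner, Finset.sum_eq_single_of_mem A₀ hmem (fun A hA hne =>
      h.inner_eq_zero (hf A hA).2.1 he (hf A hA).1 hA₀ hne), ht, real_inner_smul_left,
      real_inner_self_eq_norm_sq] at hue
    have ht0 : t = 0 := (mul_eq_zero.1 hue).resolve_right (by positivity)
    exact (hf A₀ hmem).2.2 (by rw [ht, ht0, zero_smul])
  by_cases hpos : ∃ A ∈ s, 0 < ⟪A₀, A⟫
  · right
    obtain ⟨A₁, hA₁, hA₁pos⟩ := hpos
    -- Two successive limits isolate one weight vector in the cone: first along `A₀`, then along a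
    -- longest remaining weight `B`, which by Cauchy–Schwarz alone attains `⟪B, A⟫ = ‖B‖²`.
    obtain ⟨A₂, hA₂, hmax⟩ := s.exists_max_image (fun A => ⟪A₀, A⟫) ⟨A₁, hA₁⟩
    have hm := sum_filter_mem_rankOneCone (fun A hA => (hf A hA).2.1) hu hA₀ hmax
    set s' := s.filter fun A => ⟪A₀, A⟫ = ⟪A₀, A₂⟫ with hs'
    have hsub : ∀ A ∈ s', A ∈ s ∧ ⟪A₀, A⟫ = ⟪A₀, A₂⟫ := fun A hA => by simpa [hs'] using hA
    obtain ⟨B, hB, hBmax⟩ := s'.exists_max_image (fun A => ‖A‖) ⟨A₂, by simp [hs', hA₂]⟩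
    obtain ⟨hBs, hBA⟩ := hsub B hB
    have hle : ∀ A ∈ s', ⟪B, A⟫ ≤ ‖B‖ ^ 2 := fun A hA =>
      (real_inner_le_norm B A).trans (by nlinarith [hBmax A hA, norm_nonneg B])
    have hm' := sum_filter_mem_rankOneCone (fun A hA => (hf A (hsub A hA).1).2.1) hm (hf B hBs).1 hle
    have hfilter : s'.filter (fun A => ⟪B, A⟫ = ‖B‖ ^ 2) = {B} := by
      ext A
      simp only [Finset.mem_filter, Finset.mem_singleton]
      constructor
      · rintro ⟨hA, hBA⟩
        have h1 := norm_sub_sq_real B A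
        have h2 := hBmax A hA
        have h3 : ‖B - A‖ ^ 2 ≤ 0 := by nlinarith [norm_nonneg A]
        have h4 : B - A = 0 := norm_eq_zero.1 (pow_eq_zero_iff two_ne_zero |>.1
          (le_antisymm h3 (sq_nonneg _)))
        exact (sub_eq_zero.1 h4).symm
      · rintro rfl
        exact ⟨hB, real_inner_self_eq_norm_sq _⟩
    rw [hfilter, Finset.sum_singleton] at hm'
    obtain ⟨hBa, hfB, hfB0⟩ := hf B hBs
    refine ⟨B, hBa, f B, hfB, hfB0, ?_, ?_, ?_⟩
    -- The cone equation tested on `θ (f B)` compares `‖B‖²` with the constant `‖A₀‖²`.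
    · have h1 := hm' (D.θ (f B))
      rw [h.br_θ_self hfB hBa, map_smul, D.br_swap, hfB B hBa, D.θ_θ, smul_neg, neg_smul, neg_neg,
        smul_smul, real_inner_self_eq_norm_sq, real_inner_self_eq_norm_sq] at h1
      have h2 := smul_left_injective ℝ hfB0 h1
      have h3 : ‖f B‖ ^ 2 ≠ 0 := by positivity
      have h4 : ‖B‖ ^ 2 = ‖A₀‖ ^ 2 := mul_left_cancel₀ h3 (by simpa [mul_comm] using h2)
      exact (sq_eq_sq₀ (norm_nonneg _) (norm_nonneg _)).1 h4
    · rw [hBA]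
      exact hA₁pos.trans_le (hmax A₁ hA₁)
    · rintro rfl
      exact hA₀s hBs
  · left
    push Not at hpos
    -- A nonzero bracket would have weight `A - A₀`, which is longer than `A₀` since `⟪A₀, A⟫ ≤ 0`,
    -- unless `A = 0`.
    have hterm : ∀ A ∈ s, A ≠ 0 → D.br (f A) (D.θ e) = 0 := by
      intro A hA hne
      by_contra hbr
      have h1 := hlong _ (𝔞.add_mem (hf A hA).1 (𝔞.neg_mem hA₀)) _
        (br_mem_weightSpace (hf A hA).2.1 (h.θ_mem_weightSpace he)) hbr
      have h2 := norm_sub_sq_real A A₀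
      rw [← sub_eq_add_neg] at h1
      have h3 := hpos A hA
      rw [real_inner_comm] at h3
      have h4 : ‖A‖ ^ 2 ≤ 0 := by nlinarith [norm_nonneg (A - A₀)]
      exact hne (norm_eq_zero.1 (pow_eq_zero_iff two_ne_zero |>.1
        (le_antisymm h4 (sq_nonneg _))))
    have hmul : ∃ t : ℝ, D.br (∑ A ∈ s, f A) (D.θ e) = t • D.θ e := by
      rw [map_sum, LinearMap.sum_apply]
      by_cases h0 : (0 : V) ∈ s
      · rw [Finset.sum_eq_single_of_mem 0 h0 hterm]
        have h1 := h.θ_mem_weightSpace (br_mem_weightSpace (hf 0 h0).2.1 (h.θ_mem_weightSpace he))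
        rw [zero_add, neg_neg] at h1
        obtain ⟨t, ht⟩ := hone _ h1
        exact ⟨t, by rw [← D.θ_θ (D.br _ _), ht, map_smul]⟩
      · exact ⟨0, by
          rw [zero_smul]
          exact Finset.sum_eq_zero fun A hA => hterm A hA fun h' => h0 (h' ▸ hA)⟩
    obtain ⟨t, ht⟩ := hmul
    -- Now `[u, θe] = t θe`, while the cone equation gives `(ad u)² θe = 0`; hence `t² = 0`.
    have h1 := hu (D.θ e)
    rw [D.θ_θ, hue, mul_zero, zero_smul, ht, map_smul, ht, smul_smul] at h1
    have hθe : D.θ e ≠ 0 := fun h' => he0 (by rw [← D.θ_θ e, h', map_zero])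
    have ht0 : t = 0 := mul_self_eq_zero.1 ((smul_eq_zero.1 h1).resolve_right hθe)
    rw [ht, ht0, zero_smul]

/-- In a simple algebra for which the fixed subalgebra of the Cartan involution has no center, a
longest restricted root of multiplicity one is not orthogonal to all other roots of its length. -/
theorem exists_oblique_longest_weight (h : D.IsCartanSubspace 𝔞)
    (hsimple : ∀ W : Submodule ℝ V, (∀ x, ∀ y ∈ W, D.br x y ∈ W) → W = ⊥ ∨ W = ⊤)
    (hcenter : ∀ x, (∀ y, D.br x y = 0) → x = 0)
    (hk : ∀ w, D.θ w = w → (∀ y, D.θ y = y → D.br w y = 0) → w = 0)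
    (hA₀ : A₀ ∈ 𝔞) (he : e ∈ D.weightSpace 𝔞 A₀) (he0 : e ≠ 0)
    (hone : ∀ x ∈ D.weightSpace 𝔞 A₀, ∃ t : ℝ, x = t • e)
    (hlong : ∀ A ∈ 𝔞, ∀ x ∈ D.weightSpace 𝔞 A, x ≠ 0 → ‖A‖ ≤ ‖A₀‖) :
    ∃ A ∈ 𝔞, ∃ w ∈ D.weightSpace 𝔞 A, w ≠ 0 ∧ ‖A‖ = ‖A₀‖ ∧ 0 < ⟪A₀, A⟫ ∧ A ≠ A₀ ∧
      D.br w e = 0 := by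
  suffices hex : ∃ A ∈ 𝔞, ∃ w ∈ D.weightSpace 𝔞 A, w ≠ 0 ∧ ‖A‖ = ‖A₀‖ ∧ 0 < ⟪A₀, A⟫ ∧
      A ≠ A₀ by
    obtain ⟨A, hA, w, hw, hw0, hnorm, hpos, hne⟩ := hex
    refine ⟨A, hA, w, hw, hw0, hnorm, hpos, hne, ?_⟩
    -- A nonzero bracket would have weight `A + A₀`, longer than `A₀` because `⟪A₀, A⟫ > 0`.
    by_contra hbr
    have h1 := hlong _ (𝔞.add_mem hA hA₀) _ (br_mem_weightSpace hw he) hbr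
    have h2 := norm_add_sq_real A A₀
    rw [real_inner_comm] at h2
    nlinarith [norm_nonneg (A + A₀), sq_nonneg ‖A‖]
  by_contra hno
  obtain ⟨w, hw0, hθw, hw⟩ := exists_center_of_critical hsimple hcenter
    (h.mem_rankOneCone_of_longest hA₀ he hone hlong) he0
    (fun u hu hue => (h.br_eq_zero_or_exists_weight hA₀ he he0 hone hlong hu hue).resolve_right hno)
  exact hw0 (hk w hθw hw)

end IsCartanSubspace
end EuclideanCartanAlgebra

end

section

/-! ### Restriction of scalars for complex Lie groups -/

section RestrictScalars

variable {E : Type*} [NormedAddCommGroup E] [NormedSpace ℂ E]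
  {G : Type*} [TopologicalSpace G] [ChartedSpace E G]

/-- The involutions need not be holomorphic and one-parameter subgroups have a real parameter, so
`G` is also needed as a real Lie group. -/
lemma isManifold_real_of_complex {n : WithTop ℕ∞} [IsManifold 𝓘(ℂ, E) n G] :
    IsManifold 𝓘(ℝ, E) n G := by
  refine isManifold_of_contDiffOn _ _ _ fun e e' he he' => ?_
  have h := (contDiffGroupoid n 𝓘(ℂ, E)).compatible he he'
  rw [contDiffGroupoid, mem_groupoid_of_pregroupoid] at h
  exact h.1.restrict_scalars ℝ

lemma ContMDiff.real_of_complex {n : WithTop ℕ∞} {f : G → G}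
    (hf : ContMDiff 𝓘(ℂ, E) 𝓘(ℂ, E) n f) : ContMDiff 𝓘(ℝ, E) 𝓘(ℝ, E) n f := by
  intro x
  have h := contMDiffAt_iff.1 (hf x)
  exact contMDiffAt_iff.2 ⟨h.1, h.2.restrict_scalars ℝ⟩

variable [Group G]

lemma lieGroup_real_of_complex {n : WithTop ℕ∞} [LieGroup 𝓘(ℂ, E) n G] :
    LieGroup 𝓘(ℝ, E) n G := by
  have : IsManifold 𝓘(ℝ, E) n G := isManifold_real_of_complex
  refine { contMDiff_mul := fun p => ?_, contMDiff_inv := ?_ }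
  · have h := contMDiffAt_iff.1 (contMDiff_mul 𝓘(ℂ, E) n (G := G) p)
    exact contMDiffAt_iff.2 ⟨h.1, h.2.restrict_scalars ℝ⟩
  · exact (contMDiff_inv 𝓘(ℂ, E) n).real_of_complex

end RestrictScalars

/-! ### One-parameter subgroups of real Lie groups -/

section OneParameter

open Set

variable {E : Type*} [NormedAddCommGroup E] [NormedSpace ℝ E]
  {G : Type*} [TopologicalSpace G] [ChartedSpace E G] [Group G] [LieGroup 𝓘(ℝ, E) ω G]

lemma mfderiv_mul_left_mulInvariantVectorField (X : GroupLieAlgebra 𝓘(ℝ, E) G) (g h : G) :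
    mfderiv 𝓘(ℝ, E) 𝓘(ℝ, E) (fun x : G => g * x) h (mulInvariantVectorField X h) =
      mulInvariantVectorField X (g * h) := by
  simp only [mulInvariantVectorField]
  have h1 : (fun x : G => g * h * x) = (fun x : G => g * x) ∘ fun x : G => h * x := by
    funext x; simp [mul_assoc]
  -- The base points `h * 1` and `h` agree only propositionally; viewing the derivatives as maps `E
  -- → E` allows the substitution.
  have key : ∀ p, p = h → (mfderiv 𝓘(ℝ, E) 𝓘(ℝ, E) (fun x : G => g * x) p : E →L[ℝ] E)
      ((mfderiv 𝓘(ℝ, E) 𝓘(ℝ, E) (fun x : G => h * x) 1 : E →L[ℝ] E) X) =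
      (mfderiv 𝓘(ℝ, E) 𝓘(ℝ, E) (fun x : G => g * x) h : E →L[ℝ] E)
      ((mfderiv 𝓘(ℝ, E) 𝓘(ℝ, E) (fun x : G => h * x) 1 : E →L[ℝ] E) X) := by rintro _ rfl; rfl
  rw [h1, mfderiv_comp (I' := 𝓘(ℝ, E)) _ mdifferentiableAt_mul_left mdifferentiableAt_mul_left]
  exact (key _ (mul_one h)).symm

lemma contMDiff_mulInvariantVectorField_one (X : GroupLieAlgebra 𝓘(ℝ, E) G) :
    ContMDiff 𝓘(ℝ, E) 𝓘(ℝ, E).tangent 1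
      (fun g : G => (⟨g, mulInvariantVectorField X g⟩ : TangentBundle 𝓘(ℝ, E) G)) :=
  (contMDiff_mulInvariantVectorField X).of_le (by simp)

lemma IsMIntegralCurveOn.mul_left {X : GroupLieAlgebra 𝓘(ℝ, E) G} {γ : ℝ → G} {s : Set ℝ}
    (hγ : IsMIntegralCurveOn (I := 𝓘(ℝ, E)) γ (mulInvariantVectorField X) s) (g : G) :
    IsMIntegralCurveOn (I := 𝓘(ℝ, E)) (fun t => g * γ t) (mulInvariantVectorField X) s := by
  intro t ht
  have h1 := (mdifferentiableAt_mul_left (I := 𝓘(ℝ, E)) (a := g) (b := γ t)).hasMFDerivAt.comp_hasMFDerivWithinAt t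
    (hγ t ht)
  refine h1.congr_mfderiv ?_
  ext
  change (mfderiv 𝓘(ℝ, E) 𝓘(ℝ, E) (fun x : G => g * x) (γ t) : E →L[ℝ] E)
    ((1 : ℝ) • (mulInvariantVectorField X (γ t) : E)) =
      (1 : ℝ) • (mulInvariantVectorField X (g * γ t) : E)
  rw [one_smul, one_smul]
  exact mfderiv_mul_left_mulInvariantVectorField X g (γ t)

lemma IsMIntegralCurve.mul_left {X : GroupLieAlgebra 𝓘(ℝ, E) G} {γ : ℝ → G}
    (hγ : IsMIntegralCurve (I := 𝓘(ℝ, E)) γ (mulInvariantVectorField X)) (g : G) :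
    IsMIntegralCurve (I := 𝓘(ℝ, E)) (fun t => g * γ t) (mulInvariantVectorField X) := by
  rw [isMIntegralCurve_iff_isMIntegralCurveOn] at hγ ⊢
  exact hγ.mul_left g

/-- A homomorphism `ℝ → G` differentiable at the origin is an integral curve of a left-invariant
vector field. -/
lemma isMIntegralCurve_of_hom {X : GroupLieAlgebra 𝓘(ℝ, E) G} {γ : ℝ → G}
    (hγ : ∀ s t, γ (s + t) = γ s * γ t)
    (hd : HasMFDerivAt 𝓘(ℝ, ℝ) 𝓘(ℝ, E) γ 0 (ContinuousLinearMap.toSpanSingleton ℝ (show E from X))) :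
    IsMIntegralCurve (I := 𝓘(ℝ, E)) γ (mulInvariantVectorField X) := by
  intro t
  have h1 : HasMFDerivAt 𝓘(ℝ, ℝ) 𝓘(ℝ, ℝ) (fun s : ℝ => s - t) t (ContinuousLinearMap.id ℝ ℝ) :=
    ((hasFDerivAt_id t).sub_const t).hasMFDerivAt
  have hd' : HasMFDerivAt 𝓘(ℝ, ℝ) 𝓘(ℝ, E) γ (t - t)
      (ContinuousLinearMap.toSpanSingleton ℝ (show E from X)) := by rw [sub_self]; exact hd
  have h2 := HasMFDerivAt.comp (g := γ) (f := fun s : ℝ => s - t) t hd' h1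
  have h3 := (mdifferentiableAt_mul_left (I := 𝓘(ℝ, E)) (a := γ t)
    (b := γ (t - t))).hasMFDerivAt.comp t h2
  -- Near `t` the curve is `γ(t)` times the curve near `0`, so its velocity is the left translate of
  -- `X`.
  have hfun : (fun x => γ t * x) ∘ γ ∘ (fun s => s - t) = γ := by
    funext s
    simp [← hγ]
  have hval : ∀ p : G, p = 1 → (mfderiv 𝓘(ℝ, E) 𝓘(ℝ, E) (fun x : G => γ t * x) p : E →L[ℝ] E) X =
      mulInvariantVectorField X (γ t) := by
    rintro _ rfl; rfl
  rw [hfun] at h3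
  refine h3.congr_mfderiv ?_
  ext
  change (mfderiv 𝓘(ℝ, E) 𝓘(ℝ, E) (fun x : G => γ t * x) (γ (t - t)) : E →L[ℝ] E)
    ((1 : ℝ) • (X : E)) = (1 : ℝ) • (mulInvariantVectorField X (γ t) : E)
  rw [one_smul, one_smul]
  exact hval (γ (t - t)) (by rw [sub_self]; simpa using hγ 0 0)

variable [T2Space G]

/-- A one-parameter subgroup is determined by its velocity. -/
theorem oneParameterSubgroup_unique {X : GroupLieAlgebra 𝓘(ℝ, E) G} {γ γ' : ℝ → G}
    (hγ : ∀ s t, γ (s + t) = γ s * γ t) (hγ' : ∀ s t, γ' (s + t) = γ' s * γ' t)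
    (hd : HasMFDerivAt 𝓘(ℝ, ℝ) 𝓘(ℝ, E) γ 0 (ContinuousLinearMap.toSpanSingleton ℝ (show E from X)))
    (hd' : HasMFDerivAt 𝓘(ℝ, ℝ) 𝓘(ℝ, E) γ' 0
      (ContinuousLinearMap.toSpanSingleton ℝ (show E from X))) : γ = γ' := by
  have h0 : γ 0 = 1 := by simpa using hγ 0 0
  have h0' : γ' 0 = 1 := by simpa using hγ' 0 0
  exact isMIntegralCurve_Ioo_eq_of_contMDiff_boundaryless (I := 𝓘(ℝ, E)) (t₀ := 0)
    (contMDiff_mulInvariantVectorField_one X) (isMIntegralCurve_of_hom hγ hd)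
    (isMIntegralCurve_of_hom hγ' hd') (by rw [h0, h0'])

variable [CompleteSpace E]

/-- Existence of one-parameter subgroups. -/
theorem exists_oneParameterSubgroup (X : GroupLieAlgebra 𝓘(ℝ, E) G) :
    ∃ γ : ℝ → G, (∀ s t, γ (s + t) = γ s * γ t) ∧
      HasMFDerivAt 𝓘(ℝ, ℝ) 𝓘(ℝ, E) γ 0
        (ContinuousLinearMap.toSpanSingleton ℝ (show E from X)) := by
  have hV := contMDiff_mulInvariantVectorField_one X
  obtain ⟨γ₀, hγ₀, hloc⟩ := exists_isMIntegralCurveAt_of_contMDiffAt_boundaryless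
    (I := 𝓘(ℝ, E)) (t₀ := 0) (hV 1)
  obtain ⟨ε, hε, hγε⟩ := isMIntegralCurveAt_iff'.1 hloc
  -- Left translates of one local integral curve give curves through every point on the same time
  -- interval, so the field is complete.
  obtain ⟨γ, hγ1, hγ⟩ := exists_isMIntegralCurve_of_isMIntegralCurveOn (I := 𝓘(ℝ, E)) hV hε
    (fun g => ⟨fun t => g * γ₀ t, by simp [hγ₀], by
      have := hγε.mul_left g
      rwa [Real.ball_eq_Ioo, zero_sub, zero_add] at this⟩) 1
  refine ⟨γ, fun s t => ?_, ?_⟩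
  rotate_left
  · have h1 : ∀ p : G, p = 1 → (mulInvariantVectorField (I := 𝓘(ℝ, E)) X p : E) = X := by
      rintro _ rfl
      have h2 : HasMFDerivAt 𝓘(ℝ, E) 𝓘(ℝ, E) (fun x : G => 1 * x) 1 (ContinuousLinearMap.id ℝ E) :=
        (hasMFDerivAt_id (I := 𝓘(ℝ, E)) (1 : G)).congr_of_eventuallyEq
          (Filter.Eventually.of_forall fun x => one_mul x)
      exact DFunLike.congr_fun (f := (mfderiv 𝓘(ℝ, E) 𝓘(ℝ, E) (fun x : G => 1 * x) 1 : E →L[ℝ] E))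
        h2.mfderiv X
    refine (hγ 0).congr_mfderiv ?_
    ext
    change (1 : ℝ) • (mulInvariantVectorField (I := 𝓘(ℝ, E)) X (γ 0) : E) = (1 : ℝ) • (X : E)
    exact congrArg ((1 : ℝ) • ·) (h1 (γ 0) hγ1)
  -- Both `γ(s) γ(·)` and `γ(· + s)` are integral curves with value `γ(s)` at `0`.
  have h1 := hγ.mul_left (γ s)
  have h2 := hγ.comp_add s
  have h3 := isMIntegralCurve_Ioo_eq_of_contMDiff_boundaryless (I := 𝓘(ℝ, E)) (t₀ := 0) hV h2 h1
    (by simp [hγ1])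
  have := congrFun h3 t
  simpa [add_comm] using this

end OneParameter

end

section

/-! ### The derivative of the adjoint representation -/

open Filter Topology

/-- The second order calculus behind the formula for the derivative of the adjoint representation:
`m` is a local group law with neutral element `e` and `A` the corresponding conjugation. -/
lemma hasFDerivAt_conj_of_local_group {E : Type*} [NormedAddCommGroup E] [NormedSpace ℂ E]
    {m A : E × E → E} {e : E} (hm : ContDiffAt ℂ 2 m (e, e)) (hA : ContDiffAt ℂ 2 A (e, e))
    (hme : ∀ᶠ x in 𝓝 e, m (x, e) = x) (hAe : ∀ᶠ x in 𝓝 e, A (x, e) = e)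
    (heA : ∀ᶠ x in 𝓝 e, A (e, x) = x) (hrel : ∀ᶠ p in 𝓝 (e, e), m (A p, p.1) = m p) (Y : E) :
    ∃ L : E →L[ℂ] E, HasFDerivAt (fun x => fderiv ℂ A (x, e) (0, Y)) L e ∧
      ∀ X, L X = fderiv ℂ (fun x => fderiv ℂ m (x, e) (0, Y)) e X -
        fderiv ℂ (fun x => fderiv ℂ m (x, e) (0, X)) e Y := by
  have hdm : DifferentiableAt ℂ (fderiv ℂ m) (e, e) :=
    (hm.fderiv_right (m := 1) (by norm_num)).differentiableAt (by norm_num)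
  have hdA : DifferentiableAt ℂ (fderiv ℂ A) (e, e) :=
    (hA.fderiv_right (m := 1) (by norm_num)).differentiableAt (by norm_num)
  have hinl : HasFDerivAt (fun x : E => (x, e)) (ContinuousLinearMap.inl ℂ E E) e :=
    hasFDerivAt_prodMk_left e e
  have hinr : HasFDerivAt (fun x : E => (e, x)) (ContinuousLinearMap.inr ℂ E E) e :=
    hasFDerivAt_prodMk_right e e
  set m2 := fderiv ℂ (fderiv ℂ m) (e, e) with hm2
  have hsymm : ∀ v w, m2 v w = m2 w v := by
    have := hm.isSymmSndFDerivAt (by simp)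
    exact fun v w => this v w
  have hleft : ∀ Y, HasFDerivAt (fun x => fderiv ℂ m (x, e) (0, Y))
      ((m2.flip (0, Y)).comp (ContinuousLinearMap.inl ℂ E E)) e := by
    intro Y
    have h1 := (HasFDerivAt.comp (g := fderiv ℂ m) (f := fun x : E => (x, e)) e hdm.hasFDerivAt
      hinl).clm_apply (hasFDerivAt_const ((0, Y) : E × E) e)
    refine h1.congr_fderiv ?_
    ext X
    simp [hm2]
  set a : E → E := fun x => fderiv ℂ A (x, e) (0, Y) with ha
  have hae : a e = Y := by
    have h1 : HasFDerivAt (fun x => A (e, x)) ((fderiv ℂ A (e, e)).comp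
        (ContinuousLinearMap.inr ℂ E E)) e :=
      HasFDerivAt.comp (g := A) (f := fun x : E => (e, x)) e
        (hA.differentiableAt (by norm_num)).hasFDerivAt hinr
    have h2 : HasFDerivAt (fun x => A (e, x)) (ContinuousLinearMap.id ℂ E) e :=
      (hasFDerivAt_id e).congr_of_eventuallyEq heA
    simpa [ha] using DFunLike.congr_fun (h1.unique h2) Y
  have hm1 : ∀ Z, fderiv ℂ m (e, e) (Z, 0) = Z := by
    intro Z
    have h1 : HasFDerivAt (fun x => m (x, e)) ((fderiv ℂ m (e, e)).comp
        (ContinuousLinearMap.inl ℂ E E)) e :=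
      HasFDerivAt.comp (g := m) (f := fun x : E => (x, e)) e
        (hm.differentiableAt (by norm_num)).hasFDerivAt hinl
    have h2 : HasFDerivAt (fun x => m (x, e)) (ContinuousLinearMap.id ℂ E) e :=
      (hasFDerivAt_id e).congr_of_eventuallyEq hme
    simpa using DFunLike.congr_fun (h1.unique h2) Z
  obtain ⟨L, hL⟩ : ∃ L : E →L[ℂ] E, HasFDerivAt a L e := by
    have h1 := (HasFDerivAt.comp (g := fderiv ℂ A) (f := fun x : E => (x, e)) e hdA.hasFDerivAt
      hinl).clm_apply (hasFDerivAt_const ((0, Y) : E × E) e)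
    exact ⟨_, h1⟩
  refine ⟨L, hL, fun X => ?_⟩
  have hright : HasFDerivAt (fun x => fderiv ℂ m (e, x) (a x, 0))
      ((fderiv ℂ m (e, e)).comp ((ContinuousLinearMap.inl ℂ E E).comp L) +
        (m2.comp (ContinuousLinearMap.inr ℂ E E)).flip (Y, 0)) e := by
    have h1 := (HasFDerivAt.comp (g := fderiv ℂ m) (f := fun x : E => (e, x)) e hdm.hasFDerivAt
      hinr).clm_apply ((ContinuousLinearMap.inl ℂ E E).hasFDerivAt.comp e hL)
    refine (h1.congr_fderiv ?_)
    ext X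
    simp [hm2, hae]
  have hcl : Tendsto (fun x : E => (x, e)) (𝓝 e) (𝓝 (e, e)) := hinl.continuousAt
  have hcr : Tendsto (fun x : E => (e, x)) (𝓝 e) (𝓝 (e, e)) := hinr.continuousAt
  -- Differentiate `(x y x⁻¹) x = x y` in `y` at the identity; `a x` is `Ad(x) Y` read in the chart.
  have heq : (fun x => fderiv ℂ m (x, e) (0, Y)) =ᶠ[𝓝 e] fun x => fderiv ℂ m (e, x) (a x, 0) := by
    have hdiffA : ∀ᶠ p in 𝓝 (e, e), DifferentiableAt ℂ A p :=
      (hA.eventually (by simp)).mono fun p hp => hp.differentiableAt (by norm_num)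
    have hdiffm : ∀ᶠ p in 𝓝 (e, e), DifferentiableAt ℂ m p :=
      (hm.eventually (by simp)).mono fun p hp => hp.differentiableAt (by norm_num)
    filter_upwards [hcl.eventually hrel.eventually_nhds, hcl.eventually hdiffA,
      hcr.eventually hdiffm, hAe] with x hx hxA hxm hxe
    have h1 : HasFDerivAt (fun p : E × E => (A p, p.1))
        ((fderiv ℂ A (x, e)).prod (ContinuousLinearMap.fst ℂ E E)) (x, e) :=
      hxA.hasFDerivAt.prodMk hasFDerivAt_fst
    have hxm' : DifferentiableAt ℂ m (A (x, e), x) := by rw [hxe]; exact hxm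
    have h2 := HasFDerivAt.comp (g := m) (f := fun p : E × E => (A p, p.1)) (x, e)
      hxm'.hasFDerivAt h1
    have h3 := h2.congr_of_eventuallyEq (hx.mono fun p hp => hp.symm)
    rw [h3.fderiv, hxe]
    simp [ha]
  -- Differentiating once more in `x` gives `L X` plus one mixed second derivative of `m` on one
  -- side and another on the other; symmetry of `m2` identifies the result.
  have hX := DFunLike.congr_fun ((hleft Y).unique (hright.congr_of_eventuallyEq heq)) X
  rw [(hleft Y).fderiv, (hleft X).fderiv, eq_sub_iff_add_eq]
  simp only [ContinuousLinearMap.comp_apply, ContinuousLinearMap.flip_apply,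
    add_apply, ContinuousLinearMap.inl_apply, ContinuousLinearMap.inr_apply, hm1] at hX ⊢
  rw [hX, hsymm (Y, 0)]

end

section

/-! ### The Lie bracket in the chart at the identity -/

open Filter Topology VectorField

namespace ComplexLie

variable {E : Type*} [NormedAddCommGroup E] [NormedSpace ℂ E]
  {G : Type*} [TopologicalSpace G] [ChartedSpace E G] [Group G]

variable (E G) in
/-- The preferred chart at the identity. -/
abbrev oneChart : OpenPartialHomeomorph G E := chartAt E (1 : G)

lemma oneChart_symm_one : (oneChart E G).symm (oneChart E G 1) = 1 :=
  (oneChart E G).left_inv (mem_chart_source E 1)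

/-- In the chart at the identity, the derivative of a map fixing the identity is its `mfderiv`. -/
lemma hasFDerivAt_of_hasMFDerivAt {𝕜 : Type*} [NontriviallyNormedField 𝕜] [NormedSpace 𝕜 E]
    {f : G → G} (hf : f 1 = 1) {L : E →L[𝕜] E} (h : HasMFDerivAt 𝓘(𝕜, E) 𝓘(𝕜, E) f 1 L) :
    HasFDerivAt (fun y => oneChart E G (f ((oneChart E G).symm y))) L (oneChart E G 1) := by
  have h2 := h.2
  simp only [writtenInExtChartAt, hf, mfld_simps] at h2
  exact hasFDerivWithinAt_univ.1 h2

lemma eventually_symm_oneChart {X : Type*} [TopologicalSpace X] {γ : X → G} {x : X}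
    (hγ : ContinuousAt γ x) (h1 : γ x = 1) :
    ∀ᶠ s in 𝓝 x, (oneChart E G).symm (oneChart E G (γ s)) = γ s := by
  have : ∀ᶠ g in 𝓝 (γ x), g ∈ (oneChart E G).source := by
    rw [h1]
    exact (oneChart E G).open_source.mem_nhds (mem_chart_source E 1)
  exact (hγ.eventually this).mono fun p hp => (oneChart E G).left_inv hp

variable [LieGroup 𝓘(ℂ, E) ω G]

lemma contMDiffAt_oneChart :
    ContMDiffAt 𝓘(ℂ, E) 𝓘(ℂ, E) ω (oneChart E G) 1 :=
  contMDiffAt_of_mem_maximalAtlas (IsManifold.chart_mem_maximalAtlas 1) (mem_chart_source E 1)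

lemma contMDiffAt_oneChart_symm :
    ContMDiffAt 𝓘(ℂ, E) 𝓘(ℂ, E) ω (oneChart E G).symm (oneChart E G 1) :=
  contMDiffAt_symm_of_mem_maximalAtlas (IsManifold.chart_mem_maximalAtlas 1)
    (mem_chart_target E 1)

/-- The multiplication, read in the chart at the identity. -/
def chartMul (E G : Type*) [NormedAddCommGroup E] [TopologicalSpace G] [ChartedSpace E G] [Group G]
    (p : E × E) : E :=
  oneChart E G ((oneChart E G).symm p.1 * (oneChart E G).symm p.2)

/-- The conjugation, read in the chart at the identity. -/
def chartConj (E G : Type*) [NormedAddCommGroup E] [TopologicalSpace G] [ChartedSpace E G] [Group G]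
    (p : E × E) : E :=
  oneChart E G ((oneChart E G).symm p.1 * (oneChart E G).symm p.2 * ((oneChart E G).symm p.1)⁻¹)

lemma contMDiffAt_oneChart_symm_fst :
    ContMDiffAt 𝓘(ℂ, E × E) 𝓘(ℂ, E) ω (fun p : E × E => (oneChart E G).symm p.1)
      (oneChart E G 1, oneChart E G 1) :=
  ContMDiffAt.comp (g := (oneChart E G).symm) (f := Prod.fst) _ contMDiffAt_oneChart_symm
    contDiff_fst.contMDiff.contMDiffAt

lemma contMDiffAt_oneChart_symm_snd :
    ContMDiffAt 𝓘(ℂ, E × E) 𝓘(ℂ, E) ω (fun p : E × E => (oneChart E G).symm p.2)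
      (oneChart E G 1, oneChart E G 1) :=
  ContMDiffAt.comp (g := (oneChart E G).symm) (f := Prod.snd) _ contMDiffAt_oneChart_symm
    contDiff_snd.contMDiff.contMDiffAt

lemma contDiffAt_chartMul : ContDiffAt ℂ ω (chartMul E G) (oneChart E G 1, oneChart E G 1) := by
  rw [← contMDiffAt_iff_contDiffAt]
  have h1 := (contMDiffAt_oneChart_symm_fst (E := E) (G := G)).mul contMDiffAt_oneChart_symm_snd
  refine ContMDiffAt.comp (g := oneChart E G)
    (f := fun p : E × E => (oneChart E G).symm p.1 * (oneChart E G).symm p.2) _ ?_ h1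
  rw [oneChart_symm_one, one_mul]
  exact contMDiffAt_oneChart

lemma contDiffAt_chartConj : ContDiffAt ℂ ω (chartConj E G) (oneChart E G 1, oneChart E G 1) := by
  rw [← contMDiffAt_iff_contDiffAt]
  have h1 := ((contMDiffAt_oneChart_symm_fst (E := E) (G := G)).mul
    contMDiffAt_oneChart_symm_snd).mul contMDiffAt_oneChart_symm_fst.inv
  refine ContMDiffAt.comp (g := oneChart E G) (f := fun p : E × E =>
    (oneChart E G).symm p.1 * (oneChart E G).symm p.2 * ((oneChart E G).symm p.1)⁻¹) _ ?_ h1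
  rw [oneChart_symm_one, one_mul, inv_one, one_mul]
  exact contMDiffAt_oneChart

lemma chartMul_one : ∀ᶠ x in 𝓝 (oneChart E G 1), chartMul E G (x, oneChart E G 1) = x := by
  filter_upwards [chart_target_mem_nhds E (1 : G)] with x hx
  simp only [chartMul, oneChart_symm_one, mul_one]
  exact (oneChart E G).right_inv hx

lemma chartConj_one_left :
    ∀ᶠ x in 𝓝 (oneChart E G 1), chartConj E G (oneChart E G 1, x) = x := by
  filter_upwards [chart_target_mem_nhds E (1 : G)] with x hx
  simp only [chartConj, oneChart_symm_one, one_mul, inv_one, mul_one]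
  exact (oneChart E G).right_inv hx

lemma chartConj_one_right (x : E) : chartConj E G (x, oneChart E G 1) = oneChart E G 1 := by
  simp [chartConj]

/-- This is `(x y x⁻¹) x = x y`, valid as long as the conjugate stays in the domain of the chart. -/
lemma chartMul_chartConj : ∀ᶠ p in 𝓝 (oneChart E G 1, oneChart E G 1),
    chartMul E G (chartConj E G p, p.1) = chartMul E G p := by
  have h1 := ((contMDiffAt_oneChart_symm_fst (E := E) (G := G)).mul
    contMDiffAt_oneChart_symm_snd).mul contMDiffAt_oneChart_symm_fst.inv
  filter_upwards [eventually_symm_oneChart (E := E) h1.continuousAt (by simp)]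
    with p hp
  simp only [chartMul, chartConj]
  simp only [Pi.mul_apply] at hp
  rw [hp, inv_mul_cancel_right]

variable [CompleteSpace E]

/-- The left-invariant field at `g` is the derivative of `h ↦ g h` at the identity, here computed in
the chart. -/
lemma mpullbackWithin_mulInvariantVectorField (X : LieAlg E G) :
    (mpullbackWithin 𝓘(ℂ, E) 𝓘(ℂ, E) (extChartAt 𝓘(ℂ, E) (1 : G)).symm
      (mulInvariantVectorField X) (Set.range 𝓘(ℂ, E)) : E → E) =ᶠ[𝓝 (oneChart E G 1)]
      fun x => fderiv ℂ (chartMul E G) (x, oneChart E G 1) (0, X) := by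
  have hdiff : ∀ᶠ p in 𝓝 (oneChart E G 1, oneChart E G 1), DifferentiableAt ℂ (chartMul E G) p :=
    ((contDiffAt_chartMul.of_le (m := 1) le_top).eventually (by simp)).mono
      fun p hp => hp.differentiableAt (by norm_num)
  have hcl : Tendsto (fun x : E => (x, oneChart E G 1)) (𝓝 (oneChart E G 1))
      (𝓝 (oneChart E G 1, oneChart E G 1)) := (Continuous.prodMk_left _).continuousAt
  filter_upwards [chart_target_mem_nhds E (1 : G), hcl.eventually hdiff] with x hx hxd
  have hx' : x ∈ (extChartAt 𝓘(ℂ, E) (1 : G)).target := by simpa using hx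
  set g : G := (extChartAt 𝓘(ℂ, E) (1 : G)).symm x with hg
  have hgs : g ∈ (chartAt E (1 : G)).source := by
    have := (extChartAt 𝓘(ℂ, E) (1 : G)).map_target hx'
    rwa [extChartAt_source] at this
  have hinv : (mfderivWithin 𝓘(ℂ, E) 𝓘(ℂ, E) (extChartAt 𝓘(ℂ, E) (1 : G)).symm
      (Set.range 𝓘(ℂ, E)) x).inverse = mfderiv 𝓘(ℂ, E) 𝓘(ℂ, E) (extChartAt 𝓘(ℂ, E) (1 : G)) g :=
    ContinuousLinearMap.inverse_eq (mfderivWithin_extChartAt_symm_comp_mfderiv_extChartAt hx')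
      (mfderiv_extChartAt_comp_mfderivWithin_extChartAt_symm hx')
  let L₁ : G → E →L[ℂ] E := fun p => mfderiv 𝓘(ℂ, E) 𝓘(ℂ, E) (extChartAt 𝓘(ℂ, E) (1 : G)) p
  let L₂ : E →L[ℂ] E := mfderiv 𝓘(ℂ, E) 𝓘(ℂ, E) (fun h : G => g * h) 1
  have key : ∀ p, p = g → HasFDerivAt (fun y => chartMul E G (x, y))
      ((L₁ p).comp L₂) (oneChart E G 1) := by
    intro p hp
    have h1 : HasMFDerivAt 𝓘(ℂ, E) 𝓘(ℂ, E) (fun h : G => g * h) 1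
        (mfderiv 𝓘(ℂ, E) 𝓘(ℂ, E) (fun h : G => g * h) 1) :=
      mdifferentiableAt_mul_left.hasMFDerivAt
    have h2 : HasMFDerivAt 𝓘(ℂ, E) 𝓘(ℂ, E) (extChartAt 𝓘(ℂ, E) (1 : G)) (g * 1)
        (mfderiv 𝓘(ℂ, E) 𝓘(ℂ, E) (extChartAt 𝓘(ℂ, E) (1 : G)) (g * 1)) :=
      (mdifferentiableAt_extChartAt (by rwa [mul_one])).hasMFDerivAt
    have hpg : p = g * 1 := by rw [hp, mul_one]
    subst hpg
    have h3 := (h2.comp 1 h1).2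
    rw [modelWithCornersSelf_coe, Set.range_id] at h3
    exact hasFDerivWithinAt_univ.1 h3
  have h4 : HasFDerivAt (fun y => chartMul E G (x, y)) ((fderiv ℂ (chartMul E G)
      (x, oneChart E G 1)).comp (ContinuousLinearMap.inr ℂ E E)) (oneChart E G 1) :=
    HasFDerivAt.comp (g := chartMul E G) (f := fun y : E => (x, y)) _ hxd.hasFDerivAt
      (hasFDerivAt_prodMk_right x (oneChart E G 1))
  have h5 : ∀ X : E, L₁ g (L₂ X) = fderiv ℂ (chartMul E G) (x, oneChart E G 1) (0, X) :=
    fun X => DFunLike.congr_fun ((key g rfl).unique h4) X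
  rw [mpullbackWithin_apply, hinv]
  exact h5 X

/-- The Lie bracket in terms of the second derivative of the multiplication in the chart. -/
lemma lie_eq_fderiv_chartMul (X Y : LieAlg E G) :
    (⁅X, Y⁆ : LieAlg E G) =
      (fderiv ℂ (fun x => fderiv ℂ (chartMul E G) (x, oneChart E G 1) (0, Y)) (oneChart E G 1) X -
      fderiv ℂ (fun x => fderiv ℂ (chartMul E G) (x, oneChart E G 1) (0, X)) (oneChart E G 1) Y :
        E) := by
  have hself : ∀ Z : E, fderiv ℂ (chartMul E G) (oneChart E G 1, oneChart E G 1) (0, Z) = Z := by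
    intro Z
    have h1 : HasFDerivAt (fun y => chartMul E G (oneChart E G 1, y)) ((fderiv ℂ (chartMul E G)
        (oneChart E G 1, oneChart E G 1)).comp (ContinuousLinearMap.inr ℂ E E)) (oneChart E G 1) :=
      HasFDerivAt.comp (g := chartMul E G) (f := fun y : E => (oneChart E G 1, y)) _
        (contDiffAt_chartMul.differentiableAt (by simp)).hasFDerivAt
        (hasFDerivAt_prodMk_right _ (oneChart E G 1))
    have h2 : HasFDerivAt (fun y => chartMul E G (oneChart E G 1, y))
        (ContinuousLinearMap.id ℂ E) (oneChart E G 1) := by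
      refine (hasFDerivAt_id _).congr_of_eventuallyEq ?_
      filter_upwards [chart_target_mem_nhds E (1 : G)] with x hx
      simp only [chartMul, oneChart_symm_one, one_mul]
      exact (oneChart E G).right_inv hx
    simpa using DFunLike.congr_fun (h1.unique h2) Z
  let V : LieAlg E G → E → E := fun X x => mpullbackWithin 𝓘(ℂ, E) 𝓘(ℂ, E)
    (extChartAt 𝓘(ℂ, E) (1 : G)).symm (mulInvariantVectorField X) (Set.range 𝓘(ℂ, E)) x
  have hV : ∀ X, V X =ᶠ[𝓝 (oneChart E G 1)]
      fun x => fderiv ℂ (chartMul E G) (x, oneChart E G 1) (0, X) :=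
    mpullbackWithin_mulInvariantVectorField
  have hset : (extChartAt 𝓘(ℂ, E) (1 : G)).symm ⁻¹' Set.univ ∩ Set.range 𝓘(ℂ, E) = Set.univ := by
    simp
  have hid : (mfderiv 𝓘(ℂ, E) 𝓘(ℂ, E) (extChartAt 𝓘(ℂ, E) (1 : G)) 1 : E →L[ℂ] E).inverse =
      ContinuousLinearMap.id ℂ E := by
    have hinv : ∀ L : E →L[ℂ] E, L = ContinuousLinearMap.id ℂ E →
        L.inverse = ContinuousLinearMap.id ℂ E := by
      rintro _ rfl; exact ContinuousLinearMap.inverse_id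
    exact hinv _ mfderiv_extChartAt_self
  have h1 : (⁅X, Y⁆ : LieAlg E G) =
      (lieBracketWithin ℂ (V X) (V Y) Set.univ (oneChart E G 1) : E) := by
    rw [← hset]
    exact congrArg (fun L : E →L[ℂ] E => L (lieBracketWithin ℂ (V X) (V Y)
      ((extChartAt 𝓘(ℂ, E) (1 : G)).symm ⁻¹' Set.univ ∩ Set.range 𝓘(ℂ, E)) (oneChart E G 1))) hid
  rw [h1, lieBracketWithin_univ, (hV X).lieBracket_vectorField_eq (hV Y), lieBracket]
  exact congrArg₂ (fun a b : E =>
    fderiv ℂ (fun x => fderiv ℂ (chartMul E G) (x, oneChart E G 1) (0, Y)) (oneChart E G 1) a -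
    fderiv ℂ (fun x => fderiv ℂ (chartMul E G) (x, oneChart E G 1) (0, X)) (oneChart E G 1) b)
    (hself X) (hself Y)

end ComplexLie

end

section

/-! ### The adjoint representation and the exponential map -/

open Filter Topology

namespace ComplexLie

variable {E : Type*} [NormedAddCommGroup E] [NormedSpace ℂ E]
  {G : Type*} [TopologicalSpace G] [ChartedSpace E G] [Group G]

variable (E) in
/-- A self-map of `G` read in the chart at the identity. -/
def chartRep (f : G → G) (y : E) : E := oneChart E G (f ((oneChart E G).symm y))

lemma continuousAt_oneChart_symm :
    ContinuousAt (oneChart E G).symm (oneChart E G 1) :=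
  (oneChart E G).symm.continuousAt (mem_chart_target E 1)

lemma HasFDerivAt.chartRep_comp {𝕜 : Type*} [NontriviallyNormedField 𝕜] [NormedSpace 𝕜 E]
    {f g : G → G} {Lf Lg : E →L[𝕜] E} (hf : HasFDerivAt (chartRep E f) Lf (oneChart E G 1))
    (hg : HasFDerivAt (chartRep E g) Lg (oneChart E G 1)) (hgc : ContinuousAt g 1) (hg1 : g 1 = 1) :
    HasFDerivAt (chartRep E fun x => f (g x)) (Lf.comp Lg) (oneChart E G 1) := by
  have hb : chartRep E g (oneChart E G 1) = oneChart E G 1 := by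
    simp [chartRep, hg1]
  rw [← hb] at hf
  refine (hf.comp _ hg).congr_of_eventuallyEq ?_
  have hc : ContinuousAt (fun y => g ((oneChart E G).symm y)) (oneChart E G 1) :=
    ContinuousAt.comp (by rwa [oneChart_symm_one]) continuousAt_oneChart_symm
  filter_upwards [eventually_symm_oneChart (E := E) hc (by rw [oneChart_symm_one, hg1])] with y hy
  simp only [chartRep, Function.comp_apply, hy]

/-- A curve through the identity has velocity `X` there. -/
def HasVelocity (γ : ℝ → G) (X : E) : Prop :=
  γ 0 = 1 ∧ ContinuousAt γ 0 ∧ HasDerivAt (fun s => oneChart E G (γ s)) X 0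

lemma hasMFDerivAt_iff_hasVelocity {γ : ℝ → G} (hγ : γ 0 = 1) (X : E) :
    HasMFDerivAt 𝓘(ℝ, ℝ) 𝓘(ℝ, E) γ 0 (ContinuousLinearMap.toSpanSingleton ℝ X) ↔
      HasVelocity γ X := by
  have h1 : HasDerivAt (fun s => oneChart E G (γ s)) X 0 ↔
      HasFDerivWithinAt (writtenInExtChartAt 𝓘(ℝ, ℝ) 𝓘(ℝ, E) (0 : ℝ) γ)
        (ContinuousLinearMap.toSpanSingleton ℝ X) (Set.range 𝓘(ℝ, ℝ))
        (extChartAt 𝓘(ℝ, ℝ) (0 : ℝ) 0) := by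
    rw [modelWithCornersSelf_coe, Set.range_id, hasFDerivWithinAt_univ,
      hasDerivAt_iff_hasFDerivAt]
    simp only [writtenInExtChartAt, hγ]
    rfl
  exact ⟨fun h => ⟨hγ, h.1, h1.2 h.2⟩, fun h => ⟨h.2.1, h1.1 h.2.2⟩⟩

lemma HasVelocity.comp {γ : ℝ → G} {X : E} (hγ : HasVelocity γ X) {f : G → G} {L : E →L[ℝ] E}
    (hf : HasFDerivAt (chartRep E f) L (oneChart E G 1)) (hfc : ContinuousAt f 1) (hf1 : f 1 = 1) :
    HasVelocity (fun s => f (γ s)) (L X) := by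
  obtain ⟨h0, hc, hd⟩ := hγ
  refine ⟨by simp only [h0, hf1], ContinuousAt.comp (by rwa [h0]) hc, ?_⟩
  have hf' : HasFDerivAt (chartRep E f) L (oneChart E G (γ 0)) := by rwa [h0]
  refine (hf'.comp_hasDerivAt 0 hd).congr_of_eventuallyEq ?_
  filter_upwards [eventually_symm_oneChart (E := E) hc h0] with s hs
  simp only [chartRep, Function.comp_apply, hs]

variable [LieGroup 𝓘(ℂ, E) ω G]

/-- The adjoint action as a continuous linear map. -/
noncomputable def AdL (g : G) : E →L[ℂ] E :=
  mfderiv 𝓘(ℂ, E) 𝓘(ℂ, E) (fun x : G => g * x * g⁻¹) (1 : G)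

lemma contMDiff_conj (g : G) : ContMDiff 𝓘(ℂ, E) 𝓘(ℂ, E) ω (fun x : G => g * x * g⁻¹) :=
  (contMDiff_mul_right (I := 𝓘(ℂ, E)) (n := ω) (a := g⁻¹)).comp
    (contMDiff_mul_left (I := 𝓘(ℂ, E)) (n := ω) (a := g))

lemma hasFDerivAt_chartRep_conj (g : G) :
    HasFDerivAt (chartRep E fun x : G => g * x * g⁻¹) (AdL (E := E) g) (oneChart E G 1) :=
  hasFDerivAt_of_hasMFDerivAt (by simp)
    ((contMDiff_conj g).contMDiffAt.mdifferentiableAt (by simp)).hasMFDerivAt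

lemma AdL_mul (g h : G) : AdL (E := E) (g * h) = (AdL g).comp (AdL h) := by
  have h1 := HasFDerivAt.chartRep_comp (hasFDerivAt_chartRep_conj g)
    (hasFDerivAt_chartRep_conj (E := E) h) (contMDiff_conj (E := E) h).continuous.continuousAt
    (by simp)
  have h2 := hasFDerivAt_chartRep_conj (E := E) (g * h)
  refine h2.unique ?_
  convert h1 using 2
  funext x
  group

lemma AdL_one : AdL (E := E) (1 : G) = ContinuousLinearMap.id ℂ E := by
  refine (hasFDerivAt_chartRep_conj (E := E) (1 : G)).unique
    ((hasFDerivAt_id _).congr_of_eventuallyEq ?_)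
  filter_upwards [chart_target_mem_nhds E (1 : G)] with x hx
  simp only [chartRep, one_mul, inv_one, mul_one]
  exact (oneChart E G).right_inv hx

lemma AdL_oneChart_symm (Y : E) : (fun x => AdL (E := E) ((oneChart E G).symm x) Y)
    =ᶠ[𝓝 (oneChart E G 1)] fun x => fderiv ℂ (chartConj E G) (x, oneChart E G 1) (0, Y) := by
  have hdiff : ∀ᶠ p in 𝓝 (oneChart E G 1, oneChart E G 1), DifferentiableAt ℂ (chartConj E G) p :=
    ((contDiffAt_chartConj.of_le (m := 1) le_top).eventually (by simp)).mono
      fun p hp => hp.differentiableAt (by norm_num)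
  have hcl : Tendsto (fun x : E => (x, oneChart E G 1)) (𝓝 (oneChart E G 1))
      (𝓝 (oneChart E G 1, oneChart E G 1)) := (Continuous.prodMk_left _).continuousAt
  filter_upwards [hcl.eventually hdiff] with x hx
  have h1 : HasFDerivAt (fun y => chartConj E G (x, y)) ((fderiv ℂ (chartConj E G)
      (x, oneChart E G 1)).comp (ContinuousLinearMap.inr ℂ E E)) (oneChart E G 1) :=
    HasFDerivAt.comp (g := chartConj E G) (f := fun y : E => (x, y)) _ hx.hasFDerivAt
      (hasFDerivAt_prodMk_right x (oneChart E G 1))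
  exact DFunLike.congr_fun ((hasFDerivAt_chartRep_conj ((oneChart E G).symm x)).unique h1) Y

variable [CompleteSpace E]

/-- The derivative of the adjoint representation along a curve is the Lie bracket. -/
theorem HasVelocity.hasDerivAt_Ad {γ : ℝ → G} {X : LieAlg E G} (hγ : HasVelocity (E := E) γ X)
    (Y : LieAlg E G) :
    HasDerivAt (F := E) (fun s => AdL (E := E) (γ s) Y) (⁅X, Y⁆ : LieAlg E G) 0 := by
  obtain ⟨L, hL, hLX⟩ := hasFDerivAt_conj_of_local_group (E := E)
    (contDiffAt_chartMul.of_le (m := 2) le_top) (contDiffAt_chartConj.of_le (m := 2) le_top)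
    (chartMul_one (E := E) (G := G)) (Eventually.of_forall chartConj_one_right) chartConj_one_left
    chartMul_chartConj Y
  obtain ⟨h0, hc, hd⟩ := hγ
  have h1 := (hL.congr_of_eventuallyEq (AdL_oneChart_symm (E := E) Y)).restrictScalars ℝ
  have h1' : HasFDerivAt (fun x => AdL (E := E) ((oneChart E G).symm x) Y) (L.restrictScalars ℝ)
    (oneChart E G (γ 0)) := by rw [h0]; exact h1
  have h2 := h1'.comp_hasDerivAt 0 hd
  have h3 : (⁅X, Y⁆ : LieAlg E G) = (L X : E) := by
    rw [lie_eq_fderiv_chartMul]; exact (hLX X).symm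
  rw [h3]
  refine h2.congr_of_eventuallyEq ?_
  filter_upwards [eventually_symm_oneChart (E := E) hc h0] with s hs
  simp only [Function.comp_apply, hs]

/-! ### Automorphisms -/

/-- The differential of a map at the identity as a continuous linear map. -/
noncomputable def dAutL (φ : G → G) : E →L[ℝ] E := mfderiv 𝓘(ℝ, E) 𝓘(ℝ, E) φ (1 : G)

lemma IsLieInvolution.hasFDerivAt {φ : G ≃* G} (hφ : IsLieInvolution E φ) :
    HasFDerivAt (chartRep E φ) (dAutL (E := E) φ) (oneChart E G 1) :=
  hasFDerivAt_of_hasMFDerivAt (map_one φ)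
    (hφ.1.contMDiffAt.mdifferentiableAt (by simp)).hasMFDerivAt

lemma IsLieInvolution.continuousAt {φ : G ≃* G} (hφ : IsLieInvolution E φ) (g : G) :
    ContinuousAt φ g := hφ.1.continuous.continuousAt

lemma dAut_comp {φ ψ : G ≃* G} (hφ : IsLieInvolution E φ) (hψ : IsLieInvolution E ψ)
    (X : LieAlg E G) : dAut (fun x => φ (ψ x)) X = dAut φ (dAut ψ X) := by
  have h1 := HasFDerivAt.chartRep_comp hφ.hasFDerivAt hψ.hasFDerivAt (hψ.continuousAt 1)
    (map_one ψ)
  have h2 : HasFDerivAt (chartRep E fun x => φ (ψ x)) (dAutL (E := E) fun x => φ (ψ x))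
      (oneChart E G 1) :=
    hasFDerivAt_of_hasMFDerivAt (by simp)
      ((hφ.1.comp hψ.1).contMDiffAt.mdifferentiableAt (by simp)).hasMFDerivAt
  exact DFunLike.congr_fun (h2.unique h1) (show E from X)

lemma IsLieInvolution.dAut_dAut {φ : G ≃* G} (hφ : IsLieInvolution E φ) (X : LieAlg E G) :
    dAut φ (dAut φ X) = X := by
  have h1 := HasFDerivAt.chartRep_comp hφ.hasFDerivAt hφ.hasFDerivAt (hφ.continuousAt 1)
    (map_one φ)
  have h2 : HasFDerivAt (chartRep E fun x => φ (φ x)) (ContinuousLinearMap.id ℝ E)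
      (oneChart E G 1) := by
    refine (hasFDerivAt_id _).congr_of_eventuallyEq ?_
    filter_upwards [chart_target_mem_nhds E (1 : G)] with x hx
    simp only [chartRep, hφ.2]
    exact (oneChart E G).right_inv hx
  exact DFunLike.congr_fun (h1.unique h2) (show E from X)

/-- Differentiate `φ(g x g⁻¹) = φ(g) φ(x) φ(g)⁻¹` at `x = 1`. -/
lemma IsLieInvolution.dAut_Ad {φ : G ≃* G} (hφ : IsLieInvolution E φ) (g : G) (X : LieAlg E G) :
    dAut φ (Ad g X) = Ad (φ g) (dAut φ X) := by
  have h1 := HasFDerivAt.chartRep_comp hφ.hasFDerivAt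
    ((hasFDerivAt_chartRep_conj (E := E) g).restrictScalars ℝ)
    (contMDiff_conj (E := E) g).continuous.continuousAt (by simp)
  have h2 := HasFDerivAt.chartRep_comp
    ((hasFDerivAt_chartRep_conj (E := E) (φ g)).restrictScalars ℝ) hφ.hasFDerivAt
    (hφ.continuousAt 1) (map_one φ)
  have h3 : (fun x => φ (g * x * g⁻¹)) = fun x => φ g * φ x * (φ g)⁻¹ := by
    funext x; simp
  rw [h3] at h1
  exact DFunLike.congr_fun (h1.unique h2) (show E from X)

/-! ### One-parameter subgroups and the exponential map of `G`. -/

lemma isOneParameterSubgroup_iff {X : LieAlg E G} {γ : ℝ → G} : IsOneParameterSubgroup X γ ↔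
    (∀ s t : ℝ, γ (s + t) = γ s * γ t) ∧ HasVelocity (E := E) γ X := by
  refine and_congr_right fun h => ?_
  exact hasMFDerivAt_iff_hasVelocity (by simpa using h 0 0) (show E from X)

lemma IsOneParameterSubgroup.hasVelocity {X : LieAlg E G} {γ : ℝ → G}
    (hγ : IsOneParameterSubgroup X γ) : HasVelocity (E := E) γ X :=
  (isOneParameterSubgroup_iff.1 hγ).2

lemma IsOneParameterSubgroup.map_zero {X : LieAlg E G} {γ : ℝ → G}
    (hγ : IsOneParameterSubgroup X γ) : γ 0 = 1 := hγ.hasVelocity.1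

lemma IsLieInvolution.comp_oneParameterSubgroup {φ : G ≃* G} (hφ : IsLieInvolution E φ)
    {X : LieAlg E G} {γ : ℝ → G} (hγ : IsOneParameterSubgroup X γ) :
    IsOneParameterSubgroup (dAut φ X) (fun s => φ (γ s)) :=
  isOneParameterSubgroup_iff.2 ⟨fun s t => by rw [hγ.1, map_mul],
    hγ.hasVelocity.comp hφ.hasFDerivAt (hφ.continuousAt 1) (map_one φ)⟩

lemma IsOneParameterSubgroup.conj {X : LieAlg E G} {γ : ℝ → G}
    (hγ : IsOneParameterSubgroup X γ) (g : G) :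
    IsOneParameterSubgroup (Ad g X) (fun s => g * γ s * g⁻¹) :=
  isOneParameterSubgroup_iff.2 ⟨fun s t => by rw [hγ.1]; group,
    hγ.hasVelocity.comp ((hasFDerivAt_chartRep_conj (E := E) g).restrictScalars ℝ)
      (contMDiff_conj (E := E) g).continuous.continuousAt (by simp)⟩

lemma IsOneParameterSubgroup.smul {X : LieAlg E G} {γ : ℝ → G}
    (hγ : IsOneParameterSubgroup X γ) (c : ℝ) :
    IsOneParameterSubgroup (c • X) (fun s => γ (c * s)) := by
  obtain ⟨h0, hc, hd⟩ := hγ.hasVelocity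
  have h1 : HasDerivAt (fun s : ℝ => c * s) c 0 := by
    simpa using (hasDerivAt_id (0 : ℝ)).const_mul c
  have hd' : HasDerivAt (fun s => oneChart E G (γ s)) (show E from X) (c * 0) := by
    rw [mul_zero]; exact hd
  refine isOneParameterSubgroup_iff.2 ⟨fun s t => by rw [mul_add, hγ.1], by simpa using h0, ?_, ?_⟩
  · exact ContinuousAt.comp (g := γ) (by rwa [mul_zero]) h1.continuousAt
  · exact hd'.scomp (0 : ℝ) h1

variable [T2Space G]

lemma exists_isOneParameterSubgroup (X : LieAlg E G) : ∃ γ, IsOneParameterSubgroup X γ := by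
  have : LieGroup 𝓘(ℝ, E) ω G := lieGroup_real_of_complex
  exact exists_oneParameterSubgroup (show E from X)

lemma IsOneParameterSubgroup.unique {X : LieAlg E G} {γ γ' : ℝ → G}
    (hγ : IsOneParameterSubgroup X γ) (hγ' : IsOneParameterSubgroup X γ') : γ = γ' := by
  have : LieGroup 𝓘(ℝ, E) ω G := lieGroup_real_of_complex
  exact oneParameterSubgroup_unique (X := (show E from X)) hγ.1 hγ'.1 hγ.2 hγ'.2

lemma IsOneParameterSubgroup.lieExp_eq {X : LieAlg E G} {γ : ℝ → G}
    (hγ : IsOneParameterSubgroup X γ) : lieExp X = γ 1 := by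
  have h : ∃ γ, IsOneParameterSubgroup X γ := ⟨γ, hγ⟩
  rw [lieExp, dif_pos h, h.choose_spec.unique hγ]

lemma isOneParameterSubgroup_lieExp (X : LieAlg E G) :
    IsOneParameterSubgroup X (fun s => lieExp (s • X)) := by
  obtain ⟨γ, hγ⟩ := exists_isOneParameterSubgroup X
  convert hγ using 1
  funext s
  rw [(hγ.smul s).lieExp_eq, mul_one]

lemma lieExp_conj (g : G) (X : LieAlg E G) : lieExp (Ad g X) = g * lieExp X * g⁻¹ := by
  have := ((isOneParameterSubgroup_lieExp X).conj g).lieExp_eq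
  rwa [one_smul] at this

lemma IsLieInvolution.lieExp_dAut {φ : G ≃* G} (hφ : IsLieInvolution E φ) (X : LieAlg E G) :
    lieExp (dAut φ X) = φ (lieExp X) := by
  have := (hφ.comp_oneParameterSubgroup (isOneParameterSubgroup_lieExp X)).lieExp_eq
  rwa [one_smul] at this

lemma continuous_lieExp_smul (X : LieAlg E G) : Continuous fun s : ℝ => lieExp (s • X) := by
  have hγ := isOneParameterSubgroup_lieExp X
  refine continuous_iff_continuousAt.2 fun t => ?_
  have h1 : (fun s : ℝ => lieExp (s • X)) = fun s : ℝ => lieExp (t • X) * lieExp ((s - t) • X) := by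
    funext s
    rw [← hγ.1, add_sub_cancel]
  rw [h1]
  have h2 : ContinuousAt (fun s : ℝ => lieExp ((s - t) • X)) t :=
    ContinuousAt.comp (g := fun s : ℝ => lieExp (s • X)) (f := fun s => s - t)
      (by rw [sub_self]; exact hγ.hasVelocity.2.1) (continuous_sub_right t).continuousAt
  exact ((contMDiff_mul_left (I := 𝓘(ℂ, E)) (n := ω)
    (a := lieExp (t • X))).continuous.continuousAt).comp h2

/-- Eigenvectors of `ad X` are eigenvectors of `Ad (exp X)`. -/
theorem Ad_lieExp_of_lie_eq_smul {X W : LieAlg E G} {c : ℂ} (h : ⁅X, W⁆ = c • W) :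
    Ad (lieExp X) W = Complex.exp c • W := by
  have hγ := isOneParameterSubgroup_lieExp X
  have hderiv : ∀ t : ℝ, HasDerivAt (F := E) (fun s : ℝ => AdL (E := E) (lieExp (s • X)) W)
      (c • AdL (E := E) (lieExp (t • X)) W) t := by
    intro t
    have h1 := hγ.hasVelocity.hasDerivAt_Ad W
    rw [h] at h1
    have h2 : HasDerivAt (F := E) (fun s : ℝ => AdL (E := E) (lieExp (s • X)) W)
        (c • (show E from W)) (t - t) := by rw [sub_self]; exact h1
    have h3 := ((AdL (E := E) (lieExp (t • X))).restrictScalars ℝ).hasFDerivAt.comp_hasDerivAt t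
      (h2.comp_sub_const t t)
    have h4 : (AdL (E := E) (lieExp (t • X))) (c • (show E from W)) =
      c • AdL (E := E) (lieExp (t • X)) W := map_smul _ _ _
    rw [← h4]
    refine h3.congr_of_eventuallyEq (Eventually.of_forall fun s => ?_)
    have h5 : lieExp (s • X) = lieExp (t • X) * lieExp ((s - t) • X) := by
      rw [← hγ.1, add_sub_cancel]
    simp only [h5, AdL_mul]
    rfl
  have hexp : ∀ t : ℝ, HasDerivAt (fun s : ℝ => Complex.exp (-(s * c)))
      (Complex.exp (-(t * c)) * -c) t := by
    intro t
    have h1 : HasDerivAt (fun s : ℝ => -((s : ℂ) * c)) (-c) t := by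
      simpa using ((Complex.ofRealCLM.hasDerivAt (x := t)).mul_const c).fun_neg
    exact h1.cexp
  -- The curve `s ↦ Ad(exp sX) W` solves `f' = c f`, so `exp(-sc) f` is constant.
  have hconst : ∀ t : ℝ, HasDerivAt (F := E) (fun s : ℝ => Complex.exp (-(s * c)) •
      AdL (E := E) (lieExp (s • X)) W) 0 t := by
    intro t
    refine ((hexp t).fun_smul (hderiv t)).congr_deriv ?_
    rw [smul_smul, ← add_smul]
    simp
  have hc := is_const_of_deriv_eq_zero (fun s => (hconst s).differentiableAt)
    (fun s => (hconst s).deriv) 1 0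
  have h0 : lieExp ((0 : ℝ) • X) = 1 := hγ.map_zero
  rw [h0, AdL_one, one_smul] at hc
  simp only [Complex.ofReal_one, one_mul, Complex.ofReal_zero, zero_mul, neg_zero,
    Complex.exp_zero, one_smul] at hc
  have h6 : Complex.exp c • (Complex.exp (-c) • AdL (E := E) (lieExp X) W) =
    Complex.exp c • (show E from W) := congrArg (Complex.exp c • ·) hc
  rw [smul_smul, ← Complex.exp_add, add_neg_cancel, Complex.exp_zero, one_smul] at h6
  exact h6

lemma Ad_lieExp_of_lie_eq_zero {X W : LieAlg E G} (h : ⁅X, W⁆ = 0) : Ad (lieExp X) W = W := by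
  have := Ad_lieExp_of_lie_eq_smul (c := 0) (by rw [h, zero_smul])
  rwa [Complex.exp_zero, one_smul] at this

/-- The differential of an automorphism is a homomorphism of Lie algebras. -/
theorem IsLieInvolution.dAut_lie {φ : G ≃* G} (hφ : IsLieInvolution E φ) (X Y : LieAlg E G) :
    dAut φ ⁅X, Y⁆ = ⁅dAut φ X, dAut φ Y⁆ := by
  have hγ := isOneParameterSubgroup_lieExp X
  -- Differentiate `dφ(Ad(exp sX) Y) = Ad(φ(exp sX)) (dφ Y)` at `s = 0`.
  have h1 := (dAutL (E := E) φ).hasFDerivAt.comp_hasDerivAt 0 (hγ.hasVelocity.hasDerivAt_Ad Y)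
  have h2 := (hφ.comp_oneParameterSubgroup hγ).hasVelocity.hasDerivAt_Ad (dAut φ Y)
  refine h1.unique (h2.congr_of_eventuallyEq (Eventually.of_forall fun s => ?_))
  exact hφ.dAut_Ad (lieExp (s • X)) Y

end ComplexLie

end

section

/-! ### Cartan involutions and real forms of complex Lie algebras -/

section RealForm

variable {𝔤 : Type*} [LieRing 𝔤] [LieAlgebra ℂ 𝔤] [LieAlgebra ℝ 𝔤] [IsScalarTower ℝ ℂ 𝔤]

lemma killingForm_smul_left (c : ℂ) (x y : 𝔤) :
    killingForm ℝ 𝔤 (c • x) y = killingForm ℝ 𝔤 x (c • y) := by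
  rw [killingForm_apply_apply, killingForm_apply_apply]
  congr 1
  ext z
  simp

lemma killingForm_map_of_involutive {f : 𝔤 →ₗ[ℝ] 𝔤} (hf : ∀ x, f (f x) = x)
    (hlie : ∀ x y, f ⁅x, y⁆ = ⁅f x, f y⁆) (x y : 𝔤) :
    killingForm ℝ 𝔤 (f x) (f y) = killingForm ℝ 𝔤 x y :=
  let e : 𝔤 ≃ₗ⁅ℝ⁆ 𝔤 :=
    { f with map_lie' := hlie _ _, invFun := f, left_inv := hf, right_inv := hf }
  LieAlgebra.killingForm_of_equiv_apply e x y

lemma killingForm_lie_left (x y z : 𝔤) :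
    killingForm ℝ 𝔤 ⁅x, y⁆ z = -killingForm ℝ 𝔤 y ⁅x, z⁆ := by
  have h := LieModule.traceForm_apply_lie_apply ℝ 𝔤 𝔤 y x z
  rw [← lie_skew, map_neg, LinearMap.neg_apply]
  exact congrArg Neg.neg h

/-- A complex Lie algebra `𝔤` with commuting involutive automorphisms of `𝔤` as a real Lie algebra:
a Cartan involution `Θ`, and `T` whose fixed points form a real form of `𝔤`. -/
structure CartanRealForm (𝔤 : Type*) [LieRing 𝔤] [LieAlgebra ℂ 𝔤] [LieAlgebra ℝ 𝔤] where
  Θ : 𝔤 →ₗ[ℝ] 𝔤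
  T : 𝔤 →ₗ[ℝ] 𝔤
  Θ_Θ : ∀ x, Θ (Θ x) = x
  T_T : ∀ x, T (T x) = x
  Θ_lie : ∀ x y, Θ ⁅x, y⁆ = ⁅Θ x, Θ y⁆
  T_lie : ∀ x y, T ⁅x, y⁆ = ⁅T x, T y⁆
  Θ_T : ∀ x, Θ (T x) = T (Θ x)
  pos : ∀ x, x ≠ 0 → 0 < -killingForm ℝ 𝔤 x (Θ x)
  exists_eq_add : ∀ x, ∃ a b, T a = a ∧ T b = b ∧ x = a + Complex.I • b
  eq_zero_of_eq_smul : ∀ a b, T a = a → T b = b → a = Complex.I • b → a = 0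

namespace CartanRealForm

lemma eq_zero_of_lie_eq_zero (D : CartanRealForm 𝔤) {x : 𝔤} (h : ∀ y : 𝔤, ⁅x, y⁆ = 0) : x = 0 := by
  by_contra hx
  have h1 := D.pos x hx
  rw [killingForm_apply_apply] at h1
  have : LieAlgebra.ad ℝ 𝔤 x = 0 := by
    ext y
    simp [h]
  simp [this] at h1

variable (D : CartanRealForm 𝔤)

lemma killingForm_Θ (x y : 𝔤) : killingForm ℝ 𝔤 (D.Θ x) (D.Θ y) = killingForm ℝ 𝔤 x y :=
  killingForm_map_of_involutive D.Θ_Θ D.Θ_lie x y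

lemma killingForm_T (x y : 𝔤) : killingForm ℝ 𝔤 (D.T x) (D.T y) = killingForm ℝ 𝔤 x y :=
  killingForm_map_of_involutive D.T_T D.T_lie x y

lemma eq_zero_of_killingForm_Θ_nonneg {x : 𝔤} (h : 0 ≤ killingForm ℝ 𝔤 x (D.Θ x)) : x = 0 := by
  by_contra hx
  linarith [D.pos x hx]

lemma unique_decomp {a b a' b' : 𝔤} (ha : D.T a = a) (hb : D.T b = b) (ha' : D.T a' = a')
    (hb' : D.T b' = b') (h : a + Complex.I • b = a' + Complex.I • b') : a = a' ∧ b = b' := by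
  have h1 : a - a' = Complex.I • (b' - b) := by
    rw [smul_sub, sub_eq_sub_iff_add_eq_add, h, add_comm]
  have h2 := D.eq_zero_of_eq_smul _ _ (by rw [map_sub, ha, ha']) (by rw [map_sub, hb, hb']) h1
  rw [h2, eq_comm, smul_eq_zero_iff_right Complex.I_ne_zero] at h1
  exact ⟨sub_eq_zero.1 h2, (sub_eq_zero.1 h1).symm⟩

lemma smul_I_smul_I (x : 𝔤) : Complex.I • Complex.I • x = -x := by
  rw [smul_smul, Complex.I_mul_I, neg_one_smul]

/-- The conjugation `c : a + ib ↦ a - ib` of the real form is a real Lie automorphism, so it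
preserves the Killing form; it fixes `x` and negates `iy`. It is built by hand because `T` is not
yet known to be antilinear. -/
lemma killingForm_smul_I_eq_zero {x y : 𝔤} (hx : D.T x = x) (hy : D.T y = y) :
    killingForm ℝ 𝔤 x (Complex.I • y) = 0 := by
  choose a b ha hb hab using D.exists_eq_add
  have key : ∀ u v : 𝔤, D.T u = u → D.T v = v →
      a (u + Complex.I • v) = u ∧ b (u + Complex.I • v) = v := fun u v hu hv =>
    D.unique_decomp (ha _) (hb _) hu hv (hab _).symm
  have hadd : ∀ u v, a (u + v) = a u + a v ∧ b (u + v) = b u + b v := fun u v => by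
    have h := key (a u + a v) (b u + b v) (by rw [map_add, ha, ha]) (by rw [map_add, hb, hb])
    rwa [show a u + a v + Complex.I • (b u + b v) = u + v by
      conv_rhs => rw [hab u, hab v]
      rw [smul_add]; abel] at h
  have hsm : ∀ (r : ℝ) u, a (r • u) = r • a u ∧ b (r • u) = r • b u := fun r u => by
    have h := key (r • a u) (r • b u) (by rw [map_smul, ha]) (by rw [map_smul, hb])
    rwa [show r • a u + Complex.I • r • b u = r • u by
      conv_rhs => rw [hab u]
      rw [smul_add, smul_comm]] at h
  let c : 𝔤 →ₗ[ℝ] 𝔤 :=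
    { toFun := fun u => a u - Complex.I • b u
      map_add' := fun u v => by rw [(hadd u v).1, (hadd u v).2, smul_add]; abel
      map_smul' := fun r u => by
        rw [(hsm r u).1, (hsm r u).2, smul_comm, ← smul_sub, RingHom.id_apply] }
  have hc : ∀ u v, D.T u = u → D.T v = v → c (u + Complex.I • v) = u - Complex.I • v :=
    fun u v hu hv => by
      change a _ - Complex.I • b _ = _
      rw [(key u v hu hv).1, (key u v hu hv).2]
  have hcc : ∀ u, c (c u) = u := fun u => by
    conv_lhs => rw [hab u, hc _ _ (ha u) (hb u), sub_eq_add_neg, ← smul_neg,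
      hc _ _ (ha u) (by rw [map_neg, hb]), smul_neg, sub_neg_eq_add]
    exact (hab u).symm
  have hclie : ∀ u v, c ⁅u, v⁆ = ⁅c u, c v⁆ := fun u v => by
    have h1 : ∀ ε : ℂ, ε * ε = -1 → ⁅a u + ε • b u, a v + ε • b v⁆ =
        (⁅a u, a v⁆ - ⁅b u, b v⁆) + ε • (⁅a u, b v⁆ + ⁅b u, a v⁆) := fun ε hε => by
      simp only [add_lie, lie_add, smul_lie, lie_smul, smul_add, smul_smul, hε, neg_one_smul]
      abel
    have h2 := h1 Complex.I Complex.I_mul_I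
    have h3 := h1 (-Complex.I) (by simp)
    rw [← hab, ← hab] at h2
    rw [h2, hc _ _ (by simp only [map_sub, D.T_lie, ha, hb])
      (by simp only [map_add, D.T_lie, ha, hb])]
    simp only [neg_smul, ← sub_eq_add_neg] at h3
    exact h3.symm
  have hcx : c x = x := by simpa using hc x 0 hx (map_zero _)
  have hcy : c (Complex.I • y) = -(Complex.I • y) := by simpa using hc 0 y (map_zero _) hy
  have := killingForm_map_of_involutive hcc hclie x (Complex.I • y)
  rw [hcx, hcy, map_neg] at this
  linarith

/-- For `y` in the real form, `P = iy + T(iy)` is fixed by `T` and orthogonal to all fixed vectors,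
in particular to `ΘP`; definiteness gives `P = 0`. -/
lemma T_smul_I (x : 𝔤) : D.T (Complex.I • x) = -(Complex.I • D.T x) := by
  have key : ∀ y, D.T y = y → D.T (Complex.I • y) = -(Complex.I • y) := fun y hy => by
    set P := Complex.I • y + D.T (Complex.I • y) with hP
    have hTP : D.T P = P := by rw [hP, map_add, D.T_T, add_comm]
    have hort : ∀ u, D.T u = u → killingForm ℝ 𝔤 u P = 0 := fun u hu => by
      rw [hP, map_add, D.killingForm_smul_I_eq_zero hu hy, zero_add]
      conv_lhs => rw [← hu]
      rw [D.killingForm_T, D.killingForm_smul_I_eq_zero hu hy]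
    have h0 : P = 0 := D.eq_zero_of_killingForm_Θ_nonneg (le_of_eq (by
      rw [← D.killingForm_Θ, D.Θ_Θ, hort _ (by rw [← D.Θ_T, hTP])]))
    rw [hP, add_comm] at h0
    exact eq_neg_of_add_eq_zero_left h0
  obtain ⟨a, b, ha, hb, rfl⟩ := D.exists_eq_add x
  have e1 : Complex.I • (a + Complex.I • b) = -b + Complex.I • a := by
    rw [smul_add, smul_I_smul_I, add_comm]
  rw [e1, map_add, map_add, map_neg, key a ha, key b hb, ha, hb, smul_add, smul_neg, smul_I_smul_I]
  abel

/-- The conjugated complex structure `J' = ΘiΘ` is compatible with the bracket, so `J'i` is an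
involution. On its `-1`-eigenspace `Θ` is complex linear, and then `-B(x, Θx)` takes opposite signs
at `w` and `iw`. -/
lemma Θ_smul_I (x : 𝔤) : D.Θ (Complex.I • x) = -(Complex.I • D.Θ x) := by
  set J' : 𝔤 → 𝔤 := fun x => D.Θ (Complex.I • D.Θ x) with hJ'
  have hl : ∀ x y, ⁅J' x, y⁆ = J' ⁅x, y⁆ := fun x y => by
    simp only [hJ', D.Θ_lie, ← smul_lie]
    rw [D.Θ_Θ]
  have hcomm : ∀ x, Complex.I • J' x = J' (Complex.I • x) := fun x => by
    rw [← sub_eq_zero]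
    refine D.eq_zero_of_lie_eq_zero fun y => ?_
    rw [sub_lie, hl, smul_lie, ← lie_smul, hl, lie_smul, smul_lie, sub_self]
  have hN : ∀ x, J' (Complex.I • J' (Complex.I • x)) = x := fun x => by
    rw [hcomm, smul_I_smul_I]
    simp only [hJ', D.Θ_Θ, smul_I_smul_I, map_neg, smul_neg, neg_neg]
  have hJneg : ∀ x y, J' (Complex.I • (x - y)) = J' (Complex.I • x) - J' (Complex.I • y) :=
    fun x y => by simp only [hJ', smul_sub, map_sub]
  set w := x - J' (Complex.I • x) with hw
  have h1 : J' (Complex.I • w) = -w := by rw [hw, hJneg, hN, neg_sub]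
  have h2 : D.Θ (Complex.I • w) = Complex.I • D.Θ w := by
    have h3 := congrArg (fun u => Complex.I • D.Θ u) h1
    simp only [hJ', D.Θ_Θ, smul_I_smul_I, map_neg, smul_neg, neg_inj] at h3
    exact h3
  have h0 : w = 0 := by
    by_contra hne
    have p1 := D.pos w hne
    have p2 := D.pos (Complex.I • w) ((smul_ne_zero_iff_right Complex.I_ne_zero).2 hne)
    rw [h2, killingForm_smul_left, smul_I_smul_I, map_neg] at p2
    linarith
  have h3 : J' (Complex.I • x) = x := (sub_eq_zero.1 h0).symm
  have h4 := congrArg (fun u => Complex.I • D.Θ u) h3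
  simp only [hJ', D.Θ_Θ, smul_I_smul_I] at h4
  rw [← h4, neg_neg]

end CartanRealForm

end RealForm

end

section

/-! ### Weights of a real form -/

open scoped RealInnerProductSpace

namespace CartanRealForm

variable {𝔤 : Type*} [LieRing 𝔤] [LieAlgebra ℂ 𝔤] [LieAlgebra ℝ 𝔤] [IsScalarTower ℝ ℂ 𝔤]
  (D : CartanRealForm 𝔤)

/-- The real form: the fixed points of `T`. -/
def fixed : Submodule ℝ 𝔤 where
  carrier := {x | D.T x = x}
  add_mem' hx hy := by simp only [Set.mem_ofPred_eq, map_add] at *; rw [hx, hy]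
  zero_mem' := map_zero _
  smul_mem' r x hx := by simp only [Set.mem_ofPred_eq, map_smul] at *; rw [hx]

lemma mem_fixed {x : 𝔤} : x ∈ D.fixed ↔ D.T x = x := Iff.rfl

/-- The inner product `-B(x, Θ y)` on the real form. -/
@[reducible] noncomputable def core : InnerProductSpace.Core ℝ D.fixed where
  inner x y := -killingForm ℝ 𝔤 (x : 𝔤) (D.Θ y)
  conj_inner_symm x y := by
    rw [← D.killingForm_Θ, D.Θ_Θ, LieModule.traceForm_comm]
    rfl
  re_inner_nonneg x := by
    by_cases hx : (x : 𝔤) = 0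
    · simp [hx]
    · exact (D.pos x hx).le
  add_left x y z := by
    simp only [Submodule.coe_add, map_add, LinearMap.add_apply]
    ring
  smul_left x y r := by
    simp only [Submodule.coe_smul, map_smul, LinearMap.smul_apply, smul_eq_mul, conj_trivial]
    ring
  definite x h := by
    rw [neg_eq_zero] at h
    exact Subtype.ext (D.eq_zero_of_killingForm_Θ_nonneg h.ge)

noncomputable instance : NormedAddCommGroup D.fixed := D.core.toNormedAddCommGroup

noncomputable instance : InnerProductSpace ℝ D.fixed := InnerProductSpace.ofCore D.core.toCore

lemma inner_eq (x y : D.fixed) : ⟪x, y⟫ = -killingForm ℝ 𝔤 (x : 𝔤) (D.Θ y) := rfl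

/-- The real form with its bracket and Cartan involution as a Euclidean Cartan algebra. -/
noncomputable def euclidean : EuclideanCartanAlgebra D.fixed where
  br := LinearMap.mk₂ ℝ (fun x y => ⟨⁅(x : 𝔤), (y : 𝔤)⁆, by
      rw [mem_fixed, D.T_lie, D.mem_fixed.1 x.2, D.mem_fixed.1 y.2]⟩)
    (fun _ _ _ => Subtype.ext (by simp)) (fun _ _ _ => Subtype.ext (by simp))
    (fun _ _ _ => Subtype.ext (by simp)) (fun _ _ _ => Subtype.ext (by simp))
  br_self x := Subtype.ext (lie_self (x : 𝔤))
  jacobi x y z := Subtype.ext (leibniz_lie (x : 𝔤) (y : 𝔤) (z : 𝔤))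
  θ := D.Θ.restrict fun x hx => by rw [mem_fixed, ← D.Θ_T, D.mem_fixed.1 hx]
  θ_θ x := Subtype.ext (D.Θ_Θ x)
  θ_br x y := Subtype.ext (D.Θ_lie x y)
  inner_θ x y := by
    rw [inner_eq, inner_eq]
    exact congrArg Neg.neg (D.killingForm_Θ _ _)
  inner_br x y z := by
    rw [inner_eq, inner_eq]
    change -killingForm ℝ 𝔤 ⁅(x : 𝔤), (y : 𝔤)⁆ (D.Θ z) =
      -(-killingForm ℝ 𝔤 (y : 𝔤) (D.Θ ⁅D.Θ x, (z : 𝔤)⁆))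
    rw [killingForm_lie_left, D.Θ_lie, D.Θ_Θ]

lemma coe_br (x y : D.fixed) : (D.euclidean.br x y : 𝔤) = ⁅(x : 𝔤), (y : 𝔤)⁆ := rfl

lemma coe_θ (x : D.fixed) : (D.euclidean.θ x : 𝔤) = D.Θ x := rfl

/-- The vectors of the real form which multiplication by `i` sends into `𝔱`. -/
def imaginary (𝔱 : Submodule ℝ 𝔤) : Submodule ℝ D.fixed where
  carrier := {x | Complex.I • (x : 𝔤) ∈ 𝔱}
  add_mem' hx hy := by
    simp only [Set.mem_ofPred_eq, Submodule.coe_add, smul_add] at *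
    exact add_mem hx hy
  zero_mem' := by simp
  smul_mem' r x hx := by
    simp only [Set.mem_ofPred_eq, Submodule.coe_smul] at *
    rw [smul_comm]
    exact 𝔱.smul_mem r hx

variable {𝔱 : Submodule ℝ 𝔤}

lemma mem_imaginary {x : D.fixed} : x ∈ D.imaginary 𝔱 ↔ Complex.I • (x : 𝔤) ∈ 𝔱 := Iff.rfl

/-- `𝔱` is a maximal abelian subspace of the vectors fixed by `Θ` and negated by `T`. -/
structure IsTorus (𝔱 : Submodule ℝ 𝔤) : Prop where
  lie_eq_zero : ∀ x ∈ 𝔱, ∀ y ∈ 𝔱, ⁅x, y⁆ = 0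
  Θ_eq : ∀ x ∈ 𝔱, D.Θ x = x
  T_eq : ∀ x ∈ 𝔱, D.T x = -x
  mem_of_lie_eq_zero : ∀ x, D.Θ x = x → D.T x = -x → (∀ y ∈ 𝔱, ⁅y, x⁆ = 0) → x ∈ 𝔱

variable {D}

lemma ofReal_smul (r : ℝ) (x : 𝔤) : (r : ℂ) • x = r • x := algebraMap_smul ℂ r x

lemma eq_neg_smul_I (x : 𝔤) : x = -(Complex.I • Complex.I • x) := by
  rw [smul_I_smul_I, neg_neg]

/-- The element `-i y` of the real form, for `y ∈ 𝔱`. -/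
def IsTorus.negI (h : D.IsTorus 𝔱) {y : 𝔤} (hy : y ∈ 𝔱) : D.fixed :=
  ⟨-(Complex.I • y), by rw [mem_fixed, map_neg, D.T_smul_I, h.T_eq y hy, smul_neg, neg_neg]⟩

lemma IsTorus.negI_mem (h : D.IsTorus 𝔱) {y : 𝔤} (hy : y ∈ 𝔱) : h.negI hy ∈ D.imaginary 𝔱 := by
  rw [mem_imaginary, negI]
  simpa only [smul_neg, smul_I_smul_I, neg_neg] using hy

lemma IsTorus.negI_smul_I (h : D.IsTorus 𝔱) {x : D.fixed} (hx : x ∈ D.imaginary 𝔱) :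
    h.negI hx = x :=
  Subtype.ext (eq_neg_smul_I (x : 𝔤)).symm

/-- Both `Θ` and `T` are antilinear, so multiplication by `i` exchanges vectors fixed by `Θ` and
negated by `T` with vectors of the real form negated by `Θ`. -/
lemma IsTorus.isCartanSubspace (h : D.IsTorus 𝔱) :
    D.euclidean.IsCartanSubspace (D.imaginary 𝔱) where
  br_eq_zero x hx y hy := Subtype.ext (by
    rw [coe_br, eq_neg_smul_I (x : 𝔤), eq_neg_smul_I (y : 𝔤), neg_lie, smul_lie, lie_neg, lie_smul,
      h.lie_eq_zero _ hx _ hy]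
    simp)
  θ_eq_neg x hx := Subtype.ext (by
    rw [coe_θ, Submodule.coe_neg]
    conv_lhs => rw [eq_neg_smul_I (x : 𝔤), map_neg, D.Θ_smul_I, h.Θ_eq _ hx, smul_I_smul_I, neg_neg])
  mem_of_br_eq_zero x hθ hx := by
    have hθ' : D.Θ x = -x := congrArg Subtype.val hθ
    refine h.mem_of_lie_eq_zero _ (by rw [D.Θ_smul_I, hθ', smul_neg, neg_neg])
      (by rw [D.T_smul_I, D.mem_fixed.1 x.2]) fun y hy => ?_
    have := congrArg Subtype.val (hx _ (h.negI_mem hy))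
    rw [coe_br, negI, neg_lie, smul_lie] at this
    rw [lie_smul, ← neg_eq_zero]
    exact this

lemma IsTorus.inner_negI (h : D.IsTorus 𝔱) {x y : 𝔤} (hx : x ∈ 𝔱) (hy : y ∈ 𝔱) :
    ⟪h.negI hx, h.negI hy⟫ = -killingForm ℝ 𝔤 x y := by
  rw [inner_eq, negI, negI]
  simp only [map_neg, LinearMap.neg_apply, D.Θ_smul_I, h.Θ_eq _ hy, neg_neg,
    killingForm_smul_left, smul_I_smul_I]

/-- The vectors of weight `-B(c, ·) i` for the action of `𝔱`. -/
def IsWeightVector (𝔱 : Submodule ℝ 𝔤) (c x : 𝔤) : Prop :=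
  ∀ y ∈ 𝔱, ⁅y, x⁆ = (-(killingForm ℝ 𝔤 c y : ℂ) * Complex.I) • x

/-- Replacing `y` by `-iy` turns the imaginary eigenvalues of `𝔱` into real weights. -/
lemma IsTorus.mem_weightSpace (h : D.IsTorus 𝔱) {c : 𝔤} (hc : c ∈ 𝔱) {x : D.fixed} :
    x ∈ D.euclidean.weightSpace (D.imaginary 𝔱) (h.negI hc) ↔ IsWeightVector 𝔱 c (x : 𝔤) := by
  have key : ∀ y (hy : y ∈ 𝔱), D.euclidean.br (h.negI hy) x = ⟪h.negI hy, h.negI hc⟫ • x ↔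
      ⁅y, (x : 𝔤)⁆ = (-(killingForm ℝ 𝔤 c y : ℂ) * Complex.I) • (x : 𝔤) := fun y hy => by
    rw [Subtype.ext_iff, coe_br, Submodule.coe_smul, h.inner_negI, LieModule.traceForm_comm]
    change ⁅-(Complex.I • y), (x : 𝔤)⁆ = (-killingForm ℝ 𝔤 c y) • (x : 𝔤) ↔ _
    rw [neg_lie, smul_lie, neg_smul, neg_inj, ← smul_right_inj (r := Complex.I) (M := 𝔤) Complex.I_ne_zero,
      smul_I_smul_I, neg_eq_iff_eq_neg, ← ofReal_smul, smul_smul, ← neg_smul, neg_mul,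
      mul_comm Complex.I]
  exact ⟨fun hx y hy => (key y hy).1 (hx _ (h.negI_mem hy)), fun hx H hH => by
    have := (key _ hH).2 (hx _ hH)
    rwa [h.negI_smul_I hH] at this⟩

/-- Under a simple non-Hermitian real form, a long weight of multiplicity one admits an oblique
weight of the same length, positively correlated with it. -/
theorem IsTorus.exists_oblique_weight [FiniteDimensional ℝ 𝔤] (h : D.IsTorus 𝔱)
    (hsimple : ∀ W ≤ D.fixed, (∀ x ∈ D.fixed, ∀ y ∈ W, ⁅x, y⁆ ∈ W) → W = ⊥ ∨ W = D.fixed)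
    (hk : ∀ w, D.Θ w = w → D.T w = w → (∀ y, D.Θ y = y → D.T y = y → ⁅w, y⁆ = 0) → w = 0)
    {c e : 𝔤} (hc : c ∈ 𝔱) (hTe : D.T e = e) (he0 : e ≠ 0) (he : IsWeightVector 𝔱 c e)
    (hone : ∀ x, D.T x = x → IsWeightVector 𝔱 c x → ∃ r : ℝ, x = r • e)
    (hlong : ∀ c' ∈ 𝔱, ∀ x, x ≠ 0 → IsWeightVector 𝔱 c' x →
      -killingForm ℝ 𝔤 c' c' ≤ -killingForm ℝ 𝔤 c c) :
    ∃ c' ∈ 𝔱, ∃ w, D.T w = w ∧ w ≠ 0 ∧ IsWeightVector 𝔱 c' w ∧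
      killingForm ℝ 𝔤 c' c' = killingForm ℝ 𝔤 c c ∧ killingForm ℝ 𝔤 c c' < 0 ∧ c' ≠ c ∧
      ⁅w, e⁆ = 0 ∧ ⁅w, D.Θ w⁆ = (-killingForm ℝ 𝔤 w (D.Θ w)) • (Complex.I • c') := by
  have hnorm : ∀ x (hx : x ∈ 𝔱), ‖h.negI hx‖ ^ 2 = -killingForm ℝ 𝔤 x x := fun x hx => by
    rw [← real_inner_self_eq_norm_sq, h.inner_negI]
  obtain ⟨A, hA, w, hw, hw0, hn, hpos, hne, hbr⟩ :=
    h.isCartanSubspace.exists_oblique_longest_weight (A₀ := h.negI hc) (e := ⟨e, hTe⟩) (by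
      intro W hW
      rcases hsimple (W.map D.fixed.subtype) (Submodule.map_subtype_le _ _) (by
        rintro x hx _ ⟨y, hy, rfl⟩
        exact ⟨_, hW ⟨x, hx⟩ y hy, rfl⟩) with h1 | h1
      · left
        exact Submodule.map_injective_of_injective D.fixed.injective_subtype (by rw [h1, Submodule.map_bot])
      · right
        rw [eq_top_iff]
        rintro ⟨x, hx⟩ -
        rw [← h1] at hx
        obtain ⟨y, hy, rfl⟩ := hx
        exact hy)
    (by
      intro x hx
      refine Subtype.ext (D.eq_zero_of_lie_eq_zero fun y => ?_)
      obtain ⟨a, b, ha, hb, rfl⟩ := D.exists_eq_add y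
      have e1 : ⁅(x : 𝔤), a⁆ = 0 := congrArg Subtype.val (hx ⟨a, ha⟩)
      have e2 : ⁅(x : 𝔤), b⁆ = 0 := congrArg Subtype.val (hx ⟨b, hb⟩)
      rw [lie_add, lie_smul, e1, e2, smul_zero, add_zero])
    (by
      intro w hw hw'
      exact Subtype.ext (hk w (congrArg Subtype.val hw) w.2 fun y hy hTy =>
        congrArg Subtype.val (hw' ⟨y, hTy⟩ (Subtype.ext hy))))
    (h.negI_mem hc) ((h.mem_weightSpace hc).2 he) (fun h0 => he0 (congrArg Subtype.val h0))
    (by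
      intro x hx
      obtain ⟨r, hr⟩ := hone x x.2 ((h.mem_weightSpace hc).1 hx)
      exact ⟨r, Subtype.ext hr⟩)
    (by
      intro A hA x hx hx0
      have hA' : Complex.I • (A : 𝔤) ∈ 𝔱 := hA
      rw [show A = h.negI hA' from (h.negI_smul_I hA).symm] at hx ⊢
      refine (sq_le_sq₀ (norm_nonneg _) (norm_nonneg _)).1 ?_
      rw [hnorm, hnorm]
      exact hlong _ hA' x (fun h0 => hx0 (Subtype.ext h0)) ((h.mem_weightSpace hA').1 hx))
  have hA' : Complex.I • (A : 𝔤) ∈ 𝔱 := hA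
  have hAe : h.negI hA' = A := h.negI_smul_I hA
  refine ⟨Complex.I • (A : 𝔤), hA, w, w.2, fun h0 => hw0 (Subtype.ext h0), ?_, ?_, ?_, ?_,
    congrArg Subtype.val hbr, ?_⟩
  · rw [← hAe] at hw
    exact (h.mem_weightSpace hA').1 hw
  · rw [← hAe] at hn
    rw [← neg_inj, ← hnorm _ hA', ← hnorm _ hc, hn]
  · rw [← hAe, h.inner_negI] at hpos
    linarith
  · intro hcc
    refine hne (Subtype.ext ?_)
    change (A : 𝔤) = -(Complex.I • c)
    rw [← hcc]
    exact eq_neg_smul_I _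
  · have h1 := congrArg Subtype.val (h.isCartanSubspace.br_θ_self hw hA)
    rw [coe_br, coe_θ, Submodule.coe_smul, ← real_inner_self_eq_norm_sq, inner_eq] at h1
    rw [h1, smul_I_smul_I, smul_neg, neg_smul]

/-- An `𝔰𝔩₂`-triple adapted to the torus whose coroot takes the value `1` on the given long weight
of multiplicity one. -/
theorem IsTorus.exists_sl2 [FiniteDimensional ℝ 𝔤] (h : D.IsTorus 𝔱)
    (hsimple : ∀ W ≤ D.fixed, (∀ x ∈ D.fixed, ∀ y ∈ W, ⁅x, y⁆ ∈ W) → W = ⊥ ∨ W = D.fixed)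
    (hk : ∀ w, D.Θ w = w → D.T w = w → (∀ y, D.Θ y = y → D.T y = y → ⁅w, y⁆ = 0) → w = 0)
    {c e : 𝔤} (hc : c ∈ 𝔱) (hTe : D.T e = e) (he0 : e ≠ 0) (he : IsWeightVector 𝔱 c e)
    (hone : ∀ x, D.T x = x → IsWeightVector 𝔱 c x → ∃ r : ℝ, x = r • e)
    (hlong : ∀ c' ∈ 𝔱, ∀ x, x ≠ 0 → IsWeightVector 𝔱 c' x →
      -killingForm ℝ 𝔤 c' c' ≤ -killingForm ℝ 𝔤 c c) :
    ∃ H X : 𝔤, D.T X = X ∧ IsSl2Triple H X (-D.Θ X) ∧ Complex.I • H ∈ 𝔱 ∧ ⁅H, e⁆ = e := by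
  obtain ⟨c', hc', w, hTw, hw0, hw, hlen, hneg, hne, hwe, hwΘ⟩ :=
    h.exists_oblique_weight hsimple hk hc hTe he0 he hone hlong
  have hpos : ∀ x ∈ 𝔱, x ≠ 0 → 0 < -killingForm ℝ 𝔤 x x := fun x hx hx0 => by
    have := D.pos x hx0
    rwa [h.Θ_eq x hx] at this
  have hc'0 : c' ≠ 0 := by
    rintro rfl
    simp at hneg
  -- The vectors `c` and `c'` are distinct of equal length, so expanding `‖c' - c‖² > 0` gives
  -- strict Cauchy–Schwarz.
  have hstrict : -killingForm ℝ 𝔤 c c' < -killingForm ℝ 𝔤 c' c' := by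
    have h1 := hpos _ (sub_mem hc' hc) (sub_ne_zero.2 hne)
    simp only [map_sub, LinearMap.sub_apply] at h1
    rw [LieModule.traceForm_comm ℝ 𝔤 𝔤 c' c, hlen] at h1
    rw [hlen]
    linarith
  set a := -killingForm ℝ 𝔤 c' c' with ha
  have ha0 : 0 < a := hpos c' hc' hc'0
  set n := -killingForm ℝ 𝔤 w (D.Θ w) with hn
  have hn0 : 0 < n := D.pos w hw0
  -- Rescaling `w` by `r` makes `[X, -ΘX]` the coroot `H`, that is, `[H, X] = 2X`.
  set r := Real.sqrt (2 / (n * a)) with hr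
  have hr2 : r * r * (n * a) = 2 := by
    rw [hr, Real.mul_self_sqrt (by positivity), div_mul_cancel₀ _ (by positivity)]
  set H : 𝔤 := -((r * r * n) • Complex.I • c') with hH
  set X := r • w with hX
  have hHv : ∀ c₁ x, IsWeightVector 𝔱 c₁ x →
      ⁅H, x⁆ = (r * r * n * -killingForm ℝ 𝔤 c₁ c') • x := fun c₁ x hx => by
    rw [hH, neg_lie, smul_lie, smul_lie, hx c' hc', smul_smul, mul_comm Complex.I,
      mul_assoc (-(_ : ℂ)), Complex.I_mul_I, neg_mul_neg, mul_one, ofReal_smul, smul_smul, ← neg_smul, ← mul_neg]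
  have hHX : ⁅H, X⁆ = (2 : ℝ) • X := by
    rw [hX, lie_smul, hHv c' w hw, ← hr2, ← ha, smul_comm, ← mul_assoc]
  have hΘH : D.Θ H = -H := by
    rw [hH, map_neg, map_smul, D.Θ_smul_I, h.Θ_eq c' hc', smul_neg]
  have hXX : ⁅X, -D.Θ X⁆ = H := by
    rw [hX, map_smul, lie_neg, smul_lie, lie_smul, hwΘ, smul_smul, smul_smul, hH]
  have hHY : ⁅H, -D.Θ X⁆ = -((2 : ℝ) • -D.Θ X) := by
    have h1 := congrArg D.Θ hHX
    rw [D.Θ_lie, hΘH, map_smul _ _ X, neg_lie] at h1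
    rw [lie_neg, h1, smul_neg, neg_neg]
  have hX0 : X ≠ 0 := by
    have : r ≠ 0 := by
      rintro h0
      rw [h0] at hr2
      norm_num at hr2
    exact smul_ne_zero this hw0
  have hH0 : H ≠ 0 := by
    intro h0
    rw [h0, zero_lie, eq_comm, smul_eq_zero] at hHX
    exact hHX.elim (by norm_num) hX0
  have hsl : IsSl2Triple H X (-D.Θ X) := ⟨hH0, hXX, by rw [hHX, ofNat_smul_eq_nsmul], by
    rw [hHY, ofNat_smul_eq_nsmul]⟩
  -- Since `[w, e] = 0`, the vector `e` is primitive and its `H`-eigenvalue is a natural number; it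
  -- lies strictly between `0` and `2`.
  have hprim : hsl.HasPrimitiveVectorWith e (r * r * n * -killingForm ℝ 𝔤 c c') :=
    ⟨he0, hHv c e he, by rw [hX, smul_lie, hwe, smul_zero]⟩
  obtain ⟨m, hm⟩ := hprim.exists_nat
  have hrr : 0 < r * r * n := by
    have : 0 < r * r * n * a := by rw [mul_assoc, hr2]; norm_num
    exact pos_of_mul_pos_left this ha0.le
  have hm1 : m = 1 := by
    have h1 : (0 : ℝ) < m := by rw [← hm]; exact mul_pos hrr (by linarith)
    have h2 : (m : ℝ) < 2 := by
      rw [← hm, ← hr2, ← mul_assoc]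
      exact mul_lt_mul_of_pos_left hstrict hrr
    have h1' : 0 < m := by exact_mod_cast h1
    have h2' : m < 2 := by exact_mod_cast h2
    omega
  refine ⟨H, X, by rw [hX, map_smul, hTw], hsl, ?_, ?_⟩
  · rw [hH, smul_neg, smul_comm, smul_I_smul_I, smul_neg, neg_neg]
    exact 𝔱.smul_mem _ hc'
  · rw [hHv c e he, hm, hm1, Nat.cast_one, one_smul]

end CartanRealForm

end

section

/-! ### The infinitesimal data of a pair of commuting involutions -/

open Complex (I)

lemma CartanRealForm.T_smul {𝔤 : Type*} [LieRing 𝔤] [LieAlgebra ℂ 𝔤] [LieAlgebra ℝ 𝔤]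
    [IsScalarTower ℝ ℂ 𝔤] (D : CartanRealForm 𝔤) (z : ℂ) (x : 𝔤) :
    D.T (z • x) = (starRingEnd ℂ) z • D.T x := by
  have h1 : ∀ w : ℂ, ∀ y : 𝔤, w • y = w.re • y + w.im • I • y := fun w y => by
    rw [← ofReal_smul, ← ofReal_smul, smul_smul, ← add_smul, Complex.re_add_im]
  rw [h1 z, h1 _ (D.T x), map_add, map_smul, map_smul, D.T_smul_I]
  simp

/-- If a complex line spanned by `v` is invariant under the conjugation `T`, then its real points
form a real line. -/
lemma CartanRealForm.exists_real_generator {𝔤 : Type*} [LieRing 𝔤] [LieAlgebra ℂ 𝔤]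
    [LieAlgebra ℝ 𝔤] [IsScalarTower ℝ ℂ 𝔤] (D : CartanRealForm 𝔤) {V : Submodule ℂ 𝔤}
    (hV : Module.finrank ℂ V = 1) (hT : ∀ x ∈ V, D.T x ∈ V) :
    ∃ e ∈ V, D.T e = e ∧ e ≠ 0 ∧ ∀ x ∈ V, D.T x = x → ∃ r : ℝ, x = r • e := by
  obtain ⟨v, hv0, hv⟩ := finrank_eq_one_iff'.1 hV
  have hv0' : (v : 𝔤) ≠ 0 := fun h => hv0 (Subtype.ext h)
  obtain ⟨e, heV, hTe, he0⟩ : ∃ e ∈ V, D.T e = e ∧ e ≠ 0 := by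
    -- Either `v + Tv` is a nonzero real vector, or `Tv = -v` and `iv` is real.
    by_cases h : (v : 𝔤) + D.T v = 0
    · refine ⟨I • (v : 𝔤), V.smul_mem _ v.2, ?_,
        smul_ne_zero Complex.I_ne_zero hv0'⟩
      rw [D.T_smul_I, eq_neg_of_add_eq_zero_right h, smul_neg, neg_neg]
    · exact ⟨_, V.add_mem v.2 (hT _ v.2), by rw [map_add, D.T_T, add_comm], h⟩
  refine ⟨e, heV, hTe, he0, fun x hx hTx => ?_⟩
  obtain ⟨a, ha⟩ := hv ⟨e, heV⟩
  obtain ⟨b, hb⟩ := hv ⟨x, hx⟩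
  have ha' : a • (v : 𝔤) = e := congrArg Subtype.val ha
  have hb' : b • (v : 𝔤) = x := congrArg Subtype.val hb
  have ha0 : a ≠ 0 := by
    rintro rfl
    rw [zero_smul] at ha'
    exact he0 ha'.symm
  have hxe : x = (b / a) • e := by rw [← ha', smul_smul, div_mul_cancel₀ _ ha0, hb']
  have hconj : (starRingEnd ℂ) (b / a) = b / a := by
    have h1 := D.T_smul (b / a) e
    rw [← hxe, hTx, hTe, hxe] at h1
    exact (smul_left_injective ℂ he0 h1).symm
  obtain ⟨r, hr⟩ := Complex.conj_eq_iff_real.1 hconj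
  exact ⟨r, by rw [hxe, hr, CartanRealForm.ofReal_smul]⟩

namespace ComplexLie

variable {E : Type*} [NormedAddCommGroup E] [NormedSpace ℂ E] [CompleteSpace E]
  {G : Type*} [TopologicalSpace G] [T2Space G] [ChartedSpace E G] [Group G] [LieGroup 𝓘(ℂ, E) ω G]

lemma mem_plusSpace {φ : LieAlg E G →ₗ[ℝ] LieAlg E G} {x : LieAlg E G} :
    x ∈ plusSpace φ ↔ φ x = x := by
  rw [plusSpace, LinearMap.mem_ker, LinearMap.sub_apply, LinearMap.id_apply, sub_eq_zero]

lemma mem_minusSpace {φ : LieAlg E G →ₗ[ℝ] LieAlg E G} {x : LieAlg E G} :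
    x ∈ minusSpace φ ↔ φ x = -x := by
  rw [minusSpace, LinearMap.mem_ker, LinearMap.add_apply, LinearMap.id_apply,
    add_eq_zero_iff_eq_neg]

lemma lieExp_zero : lieExp (0 : LieAlg E G) = 1 := by
  simpa using (isOneParameterSubgroup_lieExp (0 : LieAlg E G)).map_zero

lemma lieExp_neg (X : LieAlg E G) : lieExp (-X) = (lieExp X)⁻¹ := by
  have h := (isOneParameterSubgroup_lieExp X).1 (-1) 1
  simp only [neg_add_cancel, zero_smul, neg_smul, one_smul, lieExp_zero] at h
  exact eq_inv_of_mul_eq_one_left h.symm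

/-- The Cayley transform identity: in the image of `SL₂` attached to an `𝔰𝔩₂`-triple `(H, X, Y)`,
`exp(πiH) = -1 = exp(π(X - Y))`. -/
lemma lieExp_pi_of_isSl2Triple {H X Y : LieAlg E G} (h : IsSl2Triple H X Y) :
    lieExp (Real.pi • I • H) = lieExp (Real.pi • (X - Y)) := by
  have hHX : ⁅H, X⁆ = (2 : ℂ) • X := by rw [h.lie_h_e_nsmul, two_nsmul, two_smul]
  have hHY : ⁅H, Y⁆ = (-2 : ℂ) • Y := by
    rw [h.lie_h_f_nsmul, neg_smul, two_nsmul, two_smul]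
  have hXH : ⁅X, H⁆ = (-2 : ℂ) • X := by rw [← lie_skew, hHX, neg_smul]
  have hYH : ⁅Y, H⁆ = (2 : ℂ) • Y := by rw [← lie_skew, hHY, neg_smul, neg_neg]
  have hYX : ⁅Y, X⁆ = -H := by rw [← lie_skew, h.lie_e_f]
  have hr : ∀ (r : ℝ) (x : LieAlg E G), r • x = (r : ℂ) • x := fun r x =>
    (Complex.coe_smul r x).symm
  set t := lieExp (Real.pi • I • H) with ht
  -- `U` generates the Cayley transform `k`: `ad U` has eigenvectors `H ± (X - Y)` with eigenvalues
  -- `∓πi/2`, so `Ad k` carries `πiH` to `π(X - Y)`. As `t` fixes `X` and `Y` (eigenvalues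
  -- `e^{±2πi}`), it commutes with `k`, and conjugation by `k` leaves `t` unchanged.
  set U := ((Real.pi / 4 : ℂ) * I) • (X + Y) with hU
  set k := lieExp U with hk
  have hUP : ⁅U, H + (X - Y)⁆ = (-(Real.pi / 2 : ℂ) * I) • (H + (X - Y)) := by
    rw [hU, smul_lie, add_lie, lie_add, lie_add, lie_sub, lie_sub, hXH, hYH, hYX, h.lie_e_f,
      lie_self, lie_self]
    module
  have hUQ : ⁅U, H - (X - Y)⁆ = ((Real.pi / 2 : ℂ) * I) • (H - (X - Y)) := by
    rw [hU, smul_lie, add_lie, lie_sub, lie_sub, lie_sub, lie_sub, hXH, hYH, hYX, h.lie_e_f,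
      lie_self, lie_self]
    module
  have hP := Ad_lieExp_of_lie_eq_smul hUP
  have hQ := Ad_lieExp_of_lie_eq_smul hUQ
  rw [Complex.exp_pi_div_two_mul_I] at hQ
  rw [neg_mul, Complex.exp_neg, Complex.exp_pi_div_two_mul_I, Complex.inv_I] at hP
  have hkH : Ad k (Real.pi • I • H) = Real.pi • (X - Y) := by
    have h1 : Real.pi • I • H = ((Real.pi / 2 : ℂ) * I) • ((H + (X - Y)) + (H - (X - Y))) := by
      rw [hr]
      module
    rw [h1, map_smul, map_add, hP, hQ, hr]
    have h2 : -I • (H + (X - Y)) + I • (H - (X - Y)) = (-2 * I) • (X - Y) := by module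
    rw [h2, smul_smul]
    congr 1
    linear_combination (-Real.pi : ℂ) * Complex.I_mul_I
  have htX : Ad t X = X := by
    have h1 : ⁅Real.pi • I • H, X⁆ = (2 * Real.pi * I) • X := by
      rw [hr, smul_lie, smul_lie, hHX]
      module
    rw [ht, Ad_lieExp_of_lie_eq_smul h1, Complex.exp_two_pi_mul_I, one_smul]
  have htY : Ad t Y = Y := by
    have h1 : ⁅Real.pi • I • H, Y⁆ = (-(2 * Real.pi * I)) • Y := by
      rw [hr, smul_lie, smul_lie, hHY]
      module
    rw [ht, Ad_lieExp_of_lie_eq_smul h1, Complex.exp_neg, Complex.exp_two_pi_mul_I, inv_one,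
      one_smul]
  have htU : Ad t U = U := by rw [hU, map_smul, map_add, htX, htY]
  have hcomm : t * k * t⁻¹ = k := by rw [hk, ← lieExp_conj, htU]
  rw [← hkH, lieExp_conj, ← ht, ← mul_inv_eq_iff_eq_mul.1 hcomm, mul_inv_cancel_right]

namespace RealFormData

variable (D : RealFormData E G)

lemma τ_involution : IsLieInvolution E (D.θ.trans D.σ) :=
  ⟨D.σ_involution.1.comp D.θ_cartan.1.1, fun x => by
    simp only [MulEquiv.trans_apply]
    rw [← D.comm, D.θ_cartan.1.2, D.σ_involution.2]⟩

lemma dAut_τ (X : LieAlg E G) :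
    dAut (fun x => D.σ (D.θ x)) X = dAut D.σ (dAut D.θ X) :=
  dAut_comp D.σ_involution D.θ_cartan.1 X

lemma dAut_σ (X : LieAlg E G) :
    dAut D.σ X = dAut (fun x => D.σ (D.θ x)) (dAut D.θ X) := by
  rw [dAut_τ, D.θ_cartan.1.dAut_dAut]

/-- The infinitesimal data of `D`. -/
noncomputable def toCartanRealForm : CartanRealForm (LieAlg E G) where
  Θ := dAut D.θ
  T := dAut fun x => D.σ (D.θ x)
  Θ_Θ := D.θ_cartan.1.dAut_dAut
  T_T := D.τ_involution.dAut_dAut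
  Θ_lie := D.θ_cartan.1.dAut_lie
  T_lie := D.τ_involution.dAut_lie
  Θ_T x := by
    have h1 := dAut_comp D.θ_cartan.1 D.σ_involution (dAut D.θ x)
    have h2 := dAut_comp D.σ_involution D.θ_cartan.1 (dAut D.θ x)
    rw [dAut_τ, dAut_τ, ← h1, ← h2]
    simp only [D.comm]
  pos := D.θ_cartan.2
  exists_eq_add x := by
    have hx : x ∈ plusSpace (dAut fun x : G => D.σ (D.θ x)) ⊔
        I • plusSpace (dAut fun x : G => D.σ (D.θ x)) := by
      rw [D.realForm.sup_eq_top]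
      trivial
    obtain ⟨a, ha, b, hb, rfl⟩ := Submodule.mem_sup.1 hx
    obtain ⟨b, hb', rfl⟩ := (Submodule.mem_smul_pointwise_iff_exists _ _ _).1 hb
    exact ⟨a, b, mem_plusSpace.1 ha, mem_plusSpace.1 hb', rfl⟩
  eq_zero_of_eq_smul a b ha hb hab :=
    Submodule.disjoint_def.1 D.realForm.disjoint a (mem_plusSpace.2 ha)
      (hab ▸ Submodule.smul_mem_pointwise_smul _ _ _ (mem_plusSpace.2 hb))

lemma toCartanRealForm_Θ : D.toCartanRealForm.Θ = dAut D.θ := rfl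

lemma toCartanRealForm_T : D.toCartanRealForm.T = dAut fun x => D.σ (D.θ x) := rfl

lemma mem_fixed_iff {x : LieAlg E G} : x ∈ D.toCartanRealForm.fixed ↔ x ∈ D.𝔥' := by
  rw [CartanRealForm.mem_fixed, 𝔥', mem_plusSpace, toCartanRealForm_T]

lemma mem_𝔨_inf_𝔮 {x : LieAlg E G} : x ∈ D.𝔨 ⊓ D.𝔮 ↔
    D.toCartanRealForm.Θ x = x ∧ D.toCartanRealForm.T x = -x := by
  rw [Submodule.mem_inf, 𝔨, 𝔮, mem_plusSpace, mem_minusSpace, toCartanRealForm_T,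
    toCartanRealForm_Θ]
  refine and_congr_right fun h => ?_
  rw [dAut_τ, h]

lemma isTorus {𝔱 : Submodule ℝ (LieAlg E G)} (h𝔱 : IsMaxAbelianIn 𝔱 (D.𝔨 ⊓ D.𝔮)) :
    D.toCartanRealForm.IsTorus 𝔱 where
  lie_eq_zero := h𝔱.prop.2
  Θ_eq x hx := (D.mem_𝔨_inf_𝔮.1 (h𝔱.prop.1 hx)).1
  T_eq x hx := (D.mem_𝔨_inf_𝔮.1 (h𝔱.prop.1 hx)).2
  mem_of_lie_eq_zero x hΘ hT hx := by
    -- Adjoining `x` to `𝔱` keeps it abelian, so maximality absorbs `x`.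
    have h1 : 𝔱 ⊔ Submodule.span ℝ {x} ≤ 𝔱 := by
      refine h𝔱.le_of_ge ⟨sup_le h𝔱.prop.1 ?_, ?_⟩ le_sup_left
      · rw [Submodule.span_singleton_le_iff_mem]
        exact D.mem_𝔨_inf_𝔮.2 ⟨hΘ, hT⟩
      · intro u hu v hv
        obtain ⟨a, ha, b, hb, rfl⟩ := Submodule.mem_sup.1 hu
        obtain ⟨a', ha', b', hb', rfl⟩ := Submodule.mem_sup.1 hv
        obtain ⟨r, rfl⟩ := Submodule.mem_span_singleton.1 hb
        obtain ⟨r', rfl⟩ := Submodule.mem_span_singleton.1 hb'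
        have hx' : ⁅x, a'⁆ = 0 := by rw [← lie_skew, hx a' ha', neg_zero]
        simp only [add_lie, lie_add, smul_lie, lie_smul, hx a ha, hx', h𝔱.prop.2 a ha a' ha',
          lie_self, smul_zero, add_zero]
    exact h1 (Submodule.mem_sup_right (Submodule.mem_span_singleton_self x))

lemma simple_fixed (W : Submodule ℝ (LieAlg E G)) (hW : W ≤ D.toCartanRealForm.fixed)
    (hideal : ∀ x ∈ D.toCartanRealForm.fixed, ∀ y ∈ W, ⁅x, y⁆ ∈ W) :
    W = ⊥ ∨ W = D.toCartanRealForm.fixed := by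
  obtain ⟨L, hL, hs⟩ := D.simple
  have hLfix : ∀ x, x ∈ L ↔ x ∈ D.toCartanRealForm.fixed := fun x => by
    rw [mem_fixed_iff, 𝔥', ← hL]
    rfl
  let K : LieIdeal ℝ L :=
    { W.comap L.toSubmodule.subtype with
      lie_mem := fun {x y} hy => hideal _ ((hLfix _).1 x.2) _ hy }
  have hK : ∀ x : L, x ∈ K ↔ (x : LieAlg E G) ∈ W := fun x => Iff.rfl
  rcases hs.eq_bot_or_eq_top K with h | h
  · left
    rw [eq_bot_iff]
    intro x hx
    have h1 : (⟨x, (hLfix x).2 (hW hx)⟩ : L) ∈ K := hx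
    rw [h, LieSubmodule.mem_bot] at h1
    exact congrArg Subtype.val h1
  · right
    refine le_antisymm hW fun x hx => ?_
    have h1 : (⟨x, (hLfix x).2 hx⟩ : L) ∈ K := by rw [h]; exact LieSubmodule.mem_top _
    exact h1

/-- The whole one-parameter group of `X` lies in `G^σ` and joins the element to `1`. -/
lemma lieExp_mem_H {X : LieAlg E G} (hX : dAut D.σ X = X) (r : ℝ) : lieExp (r • X) ∈ D.H := by
  have hc : IsPreconnected (Set.range fun s : ℝ => lieExp (s • X)) :=
    isPreconnected_range (continuous_lieExp_smul X)
  refine hc.subset_connectedComponentIn ⟨0, by simp only [zero_smul, lieExp_zero]⟩ ?_ ⟨r, rfl⟩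
  rintro _ ⟨s, rfl⟩
  change D.σ (lieExp (s • X)) = lieExp (s • X)
  rw [← D.σ_involution.lieExp_dAut, map_smul, hX]

end RealFormData

end ComplexLie

end

section

/-! ### The reflection -/

open Complex (I)

namespace ComplexLie

variable {E : Type*} [NormedAddCommGroup E] [NormedSpace ℂ E] [CompleteSpace E]
  {G : Type*} [TopologicalSpace G] [T2Space G] [ChartedSpace E G] [Group G] [LieGroup 𝓘(ℂ, E) ω G]

instance finiteDimensional_real_lieAlg [FiniteDimensional ℂ E] :
    FiniteDimensional ℝ (LieAlg E G) :=
  FiniteDimensional.complexToReal E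

namespace RealFormData

variable (D : RealFormData E G) {𝔱 : Submodule ℝ (LieAlg E G)}

/-- The Killing form is negative definite on `𝔱`, because `Θ` fixes `𝔱`; so it identifies `𝔱` with
its dual. -/
lemma exists_represents [FiniteDimensional ℂ E] (h : D.toCartanRealForm.IsTorus 𝔱)
    {α : 𝔱 →ₗ[ℝ] ℂ} (hα : ∀ Y, (α Y).re = 0) : ∃ C : 𝔱, Represents C α := by
  let f : 𝔱 →ₗ[ℝ] Module.Dual ℝ 𝔱 := (killingForm ℝ (LieAlg E G)).domRestrict₁₂ 𝔱 𝔱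
  have hf : Function.Injective f := by
    rw [injective_iff_map_eq_zero]
    intro x hx
    refine Subtype.ext (D.toCartanRealForm.eq_zero_of_killingForm_Θ_nonneg ?_)
    rw [h.Θ_eq x x.2]
    exact (DFunLike.congr_fun hx x).ge
  have hs : Function.Surjective f :=
    (LinearMap.injective_iff_surjective_of_finrank_eq_finrank
      (Subspace.dual_finrank_eq (K := ℝ) (V := 𝔱)).symm).1 hf
  obtain ⟨C, hC⟩ := hs (-(Complex.imLm.comp α))
  refine ⟨C, fun Y => ?_⟩
  have h1 : B (C : LieAlg E G) (Y : LieAlg E G) = -(α Y).im := DFunLike.congr_fun hC Y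
  rw [h1]
  apply Complex.ext <;> simp [hα Y]

lemma isWeightVector_iff {α : 𝔱 →ₗ[ℝ] ℂ} {C : 𝔱} (hC : Represents C α) {X : LieAlg E G} :
    CartanRealForm.IsWeightVector 𝔱 (C : LieAlg E G) X ↔ X ∈ rootSpace α :=
  ⟨fun h Y => by rw [hC Y]; exact h Y Y.2, fun h Y hY => by rw [h ⟨Y, hY⟩, hC ⟨Y, hY⟩]; rfl⟩

/-- `T` negates `𝔱` and conjugates the imaginary number `α Y`; the two signs cancel. -/
lemma T_mem_rootSpace (h : D.toCartanRealForm.IsTorus 𝔱) {α : 𝔱 →ₗ[ℝ] ℂ}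
    (hα : ∀ Y, (α Y).re = 0) {X : LieAlg E G} (hX : X ∈ rootSpace α) :
    D.toCartanRealForm.T X ∈ rootSpace α := fun Y => by
  have h1 := congrArg D.toCartanRealForm.T (hX Y)
  have h2 : (starRingEnd ℂ) (α Y) = -α Y := by
    apply Complex.ext <;> simp [hα Y]
  rw [D.toCartanRealForm.T_lie, h.T_eq Y Y.2, D.toCartanRealForm.T_smul, h2, neg_lie, neg_smul,
    neg_inj] at h1
  exact h1

/-- A long root of multiplicity one admits an adapted `𝔰𝔩₂`-triple whose coroot takes the value `1`
on it. -/
theorem exists_sl2 [FiniteDimensional ℂ E] (hnH : ¬ D.IsHermitianType)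
    (h𝔱 : IsMaxAbelianIn 𝔱 (D.𝔨 ⊓ D.𝔮)) {α : 𝔱 →ₗ[ℝ] ℂ} (hα : IsLongestRoot α)
    (hmult : Module.finrank ℂ (rootSpace α) = 1) :
    ∃ e ∈ rootSpace α, e ≠ 0 ∧ ∃ H X : LieAlg E G, D.toCartanRealForm.T X = X ∧
      IsSl2Triple H X (-D.toCartanRealForm.Θ X) ∧ I • H ∈ 𝔱 ∧ ⁅H, e⁆ = e := by
  have h := D.isTorus h𝔱
  obtain ⟨C, hC⟩ := D.exists_represents h hα.1.2.1
  obtain ⟨e, he, hTe, he0, hreal⟩ := D.toCartanRealForm.exists_real_generator hmult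
    fun x hx => D.T_mem_rootSpace h hα.1.2.1 hx
  have hneg : ∀ x ∈ 𝔱, x ≠ 0 → 0 < -killingForm ℝ (LieAlg E G) x x := fun x hx hx0 => by
    have := D.toCartanRealForm.pos x hx0
    rwa [h.Θ_eq x hx] at this
  refine ⟨e, he, he0, h.exists_sl2 D.simple_fixed ?_ C.2 hTe he0 ((isWeightVector_iff hC).2 he)
    (fun x hTx hx => hreal x ((isWeightVector_iff hC).1 hx) hTx) ?_⟩
  · intro w hΘ hT hw
    by_contra hw0
    refine hnH ⟨w, ⟨mem_plusSpace.2 hΘ, mem_plusSpace.2 hT⟩, hw0, fun Y hY => ?_⟩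
    exact hw Y (mem_plusSpace.1 hY.1) (mem_plusSpace.1 hY.2)
  · intro c' hc' x hx0 hx
    -- The weight `0` is not in `Σ(𝔱)`, so maximality of `α` says nothing about it, but its length
    -- is `0`.
    by_cases hc0 : c' = 0
    · rw [hc0, map_zero, neg_zero]
      by_cases hC0 : (C : LieAlg E G) = 0
      · rw [hC0, map_zero, neg_zero]
      · exact (hneg C C.2 hC0).le
    · let β : 𝔱 →ₗ[ℝ] ℂ := (LinearMap.toSpanSingleton ℝ ℂ (-I)).comp
        ((killingForm ℝ (LieAlg E G) c').comp 𝔱.subtype)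
      have hβ : Represents ⟨c', hc'⟩ β := fun Y => by
        change killingForm ℝ (LieAlg E G) c' Y • (-I) = _
        rw [Complex.real_smul, mul_neg, neg_mul]
        rfl
      have hβ0 : β ≠ 0 := fun h0 => by
        have h1 := hβ ⟨c', hc'⟩
        rw [h0, LinearMap.zero_apply, eq_comm, mul_eq_zero, neg_eq_zero,
          Complex.ofReal_eq_zero] at h1
        have h2 := hneg c' hc' hc0
        have h3 : killingForm ℝ (LieAlg E G) c' c' = 0 := h1.resolve_right Complex.I_ne_zero
        rw [h3, neg_zero] at h2
        exact lt_irrefl _ h2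
      have hβr : β ∈ restrictedRoots 𝔱 := by
        refine ⟨hβ0, fun Y => ?_, fun hbot => ?_⟩
        · rw [hβ Y]
          simp
        · have h1 : x ∈ rootSpace β := (isWeightVector_iff hβ).1 hx
          rw [hbot] at h1
          exact hx0 ((Submodule.mem_bot ℂ).1 h1)
      exact hα.2 β hβr C ⟨c', hc'⟩ hC hβ

/-- The summands other than `ℝZ` lie in `i𝔱'`, which commutes with `𝔱`. -/
lemma exists_eq_add_of_mem_𝔧 (hab : IsAbelianSubspace 𝔱) {𝔱' : Submodule ℝ (LieAlg E G)}
    (hab' : IsAbelianSubspace 𝔱') (h𝔱𝔱' : 𝔱 ≤ 𝔱') {α : 𝔱 →ₗ[ℝ] ℂ} {Z W : LieAlg E G}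
    (hW : W ∈ D.𝔧 𝔱' α Z) : ∃ (r : ℝ) (U : LieAlg E G), W = r • Z + U ∧ ∀ Y ∈ 𝔱, ⁅Y, U⁆ = 0 := by
  obtain ⟨W', hW', v, hv, rfl⟩ := Submodule.mem_sup.1 hW
  obtain ⟨z, hz, u, hu, rfl⟩ := Submodule.mem_sup.1 hW'
  obtain ⟨r, rfl⟩ := Submodule.mem_span_singleton.1 hz
  obtain ⟨u, hu', rfl⟩ := (Submodule.mem_smul_pointwise_iff_exists _ _ _).1 hu
  obtain ⟨v, hv', rfl⟩ := (Submodule.mem_smul_pointwise_iff_exists _ _ _).1 hv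
  obtain ⟨u, -, rfl⟩ := hu'
  refine ⟨r, I • (u : LieAlg E G) + I • v, by rw [add_assoc]; rfl, fun Y hY => ?_⟩
  rw [lie_add, lie_smul, lie_smul, hab Y hY u u.2, hab' Y (h𝔱𝔱' hY) v hv'.1, smul_zero, add_zero]

end RealFormData

/-- If `t ∈ exp 𝔱` acts by `-1` on the root spaces of `±α`, then it acts on vectors of the
Cayley-transformed subspace as the reflection in the transformed root vector. -/
lemma isReflectionOn_of_root {𝔱 : Submodule ℝ (LieAlg E G)} {α : 𝔱 →ₗ[ℝ] ℂ} {Y Y₀ : 𝔱}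
    (hY : α Y = (Real.pi / 2 : ℂ) * I) (hY₀ : Complex.exp (α Y₀) = -1)
    {Z : LieAlg E G} (hZ : Z ∈ rootSpace α ⊔ rootSpace (-α)) (hB : B Z Z ≠ 0)
    {V : Submodule ℝ (LieAlg E G)} (hZV : Z ∈ V)
    (hV : ∀ W ∈ V, ∃ (r : ℝ) (U : LieAlg E G), W = r • Z + U ∧ ∀ Y ∈ 𝔱, ⁅Y, U⁆ = 0) :
    IsReflectionOn (Ad (lieExp (Y₀ : LieAlg E G)))
      (V.map ((Ad (lieExp (Y : LieAlg E G))⁻¹).restrictScalars ℝ))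
      (Ad (lieExp (Y : LieAlg E G))⁻¹ Z) := by
  have hr : ∀ (r : ℝ) (x : LieAlg E G), r • x = (r : ℂ) • x := fun r x =>
    (Complex.coe_smul r x).symm
  obtain ⟨P, hP, Q, hQ, rfl⟩ := Submodule.mem_sup.1 hZ
  have hYP : ⁅(Y : LieAlg E G), P⁆ = ((Real.pi / 2 : ℂ) * I) • P := by rw [hP Y, hY]
  have hYQ : ⁅(Y : LieAlg E G), Q⁆ = (-((Real.pi / 2 : ℂ) * I)) • Q := by
    rw [hQ Y, LinearMap.neg_apply, hY]
  have hinv : (lieExp (Y : LieAlg E G))⁻¹ = lieExp (-(Y : LieAlg E G)) := (lieExp_neg _).symm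
  have hAP : Ad (lieExp (Y : LieAlg E G))⁻¹ P = (-I) • P := by
    rw [hinv, Ad_lieExp_of_lie_eq_smul (c := -((Real.pi / 2 : ℂ) * I))
      (by rw [neg_lie, hYP, neg_smul]), Complex.exp_neg, Complex.exp_pi_div_two_mul_I,
      Complex.inv_I]
  have hAQ : Ad (lieExp (Y : LieAlg E G))⁻¹ Q = I • Q := by
    rw [hinv, Ad_lieExp_of_lie_eq_smul (c := (Real.pi / 2 : ℂ) * I)
      (by rw [neg_lie, hYQ, neg_smul, neg_neg]), Complex.exp_pi_div_two_mul_I]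
  set Z' := Ad (lieExp (Y : LieAlg E G))⁻¹ (P + Q) with hZ'
  have hZ'eq : Z' = (-I) • P + I • Q := by rw [hZ', map_add, hAP, hAQ]
  have hpi : (Real.pi / 2 : ℝ) ≠ 0 := by positivity
  have hYZ : ⁅(Y : LieAlg E G), P + Q⁆ = (-(Real.pi / 2) : ℝ) • Z' := by
    rw [lie_add, hYP, hYQ, hZ'eq, hr]
    push_cast
    module
  have hYZ' : ⁅(Y : LieAlg E G), Z'⁆ = (Real.pi / 2 : ℝ) • (P + Q) := by
    rw [hZ'eq, lie_add, lie_smul, lie_smul, hYP, hYQ, hr, smul_smul, smul_smul, smul_add]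
    push_cast
    congr 2
    · linear_combination (-(Real.pi / 2 : ℂ)) * Complex.I_mul_I
    · linear_combination (-(Real.pi / 2 : ℂ)) * Complex.I_mul_I
  have hBsmul : ∀ (r : ℝ) (x y : LieAlg E G), B (r • x) y = r * B x y := fun r x y => by
    simp only [B, map_smul, LinearMap.smul_apply, smul_eq_mul]
  have hBsmul' : ∀ (r : ℝ) (x y : LieAlg E G), B x (r • y) = r * B x y := fun r x y => by
    simp only [B, map_smul, smul_eq_mul]
  have hBinv : ∀ x y z : LieAlg E G, B ⁅x, y⁆ z = -B y ⁅x, z⁆ := killingForm_lie_left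
  -- Up to the factors `∓π/2`, `ad Y` exchanges `Z` and `Z'`; invariance of `B` under `ad Y` then
  -- compares their lengths and makes `Z'` orthogonal to the centralizer of `𝔱`.
  have hBZ' : B Z' Z' = B (P + Q) (P + Q) := by
    have h1 := hBinv (Y : LieAlg E G) (P + Q) Z'
    rw [hYZ, hYZ', hBsmul, hBsmul', neg_mul, neg_inj] at h1
    exact mul_left_cancel₀ hpi h1
  have hBU : ∀ U : LieAlg E G, (∀ Y ∈ 𝔱, ⁅Y, U⁆ = 0) → B U Z' = 0 := fun U hU => by
    have h1 := hBinv (Y : LieAlg E G) U (P + Q)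
    rw [hU Y Y.2, hYZ, hBsmul'] at h1
    have h2 : B (0 : LieAlg E G) (P + Q) = 0 := by simp only [B, map_zero, LinearMap.zero_apply]
    rw [h2, neg_mul, neg_neg, eq_comm] at h1
    exact (mul_eq_zero.1 h1).resolve_left hpi
  have htZ' : Ad (lieExp (Y₀ : LieAlg E G)) Z' = -Z' := by
    have h1 : Complex.exp ((-α) Y₀) = -1 := by
      rw [LinearMap.neg_apply, Complex.exp_neg, hY₀]
      norm_num
    rw [hZ'eq, map_add, map_smul, map_smul, Ad_lieExp_of_lie_eq_smul (hP Y₀),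
      Ad_lieExp_of_lie_eq_smul (hQ Y₀), hY₀, h1]
    module
  refine ⟨⟨_, hZV, rfl⟩, by rwa [hBZ'], ?_⟩
  rintro _ ⟨W, hW, rfl⟩
  obtain ⟨r, U, rfl, hU⟩ := hV W hW
  have hUY : Ad (lieExp (Y : LieAlg E G))⁻¹ U = U := by
    rw [hinv]
    exact Ad_lieExp_of_lie_eq_zero (by rw [neg_lie, hU Y Y.2, neg_zero])
  have hUY₀ : Ad (lieExp (Y₀ : LieAlg E G)) U = U := Ad_lieExp_of_lie_eq_zero (hU Y₀ Y₀.2)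
  have hWe : ((Ad (lieExp (Y : LieAlg E G))⁻¹).restrictScalars ℝ) (r • (P + Q) + U) =
      r • Z' + U := by
    rw [map_add, map_smul]
    exact congrArg₂ (fun a b => r • a + b) rfl hUY
  have hBW : B (r • Z' + U) Z' = r * B Z' Z' := by
    rw [← hBsmul, ← add_zero (B (r • Z') Z'), ← hBU U hU]
    simp only [B, map_add, LinearMap.add_apply]
  rw [hWe, hBW, map_add, hUY₀, hr, map_smul, htZ', ← hr, ← mul_assoc,
    mul_div_cancel_right₀ _ (by rwa [hBZ'])]
  module

end ComplexLie

end

/-! ### The main theorem. -/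

open ComplexLie in
theorem lemma7p2 {E : Type*} [NormedAddCommGroup E] [NormedSpace ℂ E] [CompleteSpace E]
    [FiniteDimensional ℂ E] {G : Type*} [TopologicalSpace G] [T2Space G] [ConnectedSpace G]
    [ChartedSpace E G] [Group G] [LieGroup 𝓘(ℂ, E) ω G]
    (D : RealFormData E G) (hnH : ¬ D.IsHermitianType)
    (𝔱 : Submodule ℝ (LieAlg E G)) (h𝔱 : IsMaxAbelianIn 𝔱 (D.𝔨 ⊓ D.𝔮))
    (α : 𝔱 →ₗ[ℝ] ℂ) (hα : IsLongestRoot α) (hmult : Module.finrank ℂ (rootSpace α) = 1)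
    (Yα : 𝔱) (hYα : IsYElement α Yα)
    (Z : LieAlg E G) (hZ : D.IsZElement α Z)
    (𝔱' : Submodule ℝ (LieAlg E G)) (h𝔱' : IsMaxAbelianIn 𝔱' D.𝔨) (h𝔱𝔱' : 𝔱 ≤ 𝔱') :
    ∃ t : G, t ∈ torus 𝔱 ∩ D.H ∧
      (∀ Y : 𝔱, lieExp (Y : LieAlg E G) = t → Complex.exp (α Y) = -1) ∧
      IsReflectionOn (Ad t)
        ((D.𝔧 𝔱' α Z).map ((Ad (lieExp (Yα : LieAlg E G))⁻¹).restrictScalars ℝ))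
        (Ad (lieExp (Yα : LieAlg E G))⁻¹ Z) := by
  obtain ⟨e, he, he0, H, X, hTX, hsl, hH, hHe⟩ := D.exists_sl2 hnH h𝔱 hα hmult
  -- The required element is `t = exp(πiH)`; since `[H, e] = e`, it acts on `e` by `e^{πi} = -1`.
  let Y₀ : 𝔱 := ⟨Real.pi • Complex.I • H, 𝔱.smul_mem _ hH⟩
  have hAde : Ad (lieExp (Y₀ : LieAlg E G)) e = (-1 : ℂ) • e := by
    have h1 : ⁅(Y₀ : LieAlg E G), e⁆ = (Real.pi * Complex.I : ℂ) • e := by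
      change ⁅Real.pi • Complex.I • H, e⁆ = _
      rw [smul_lie, smul_lie, hHe, ← Complex.coe_smul, smul_smul]
    rw [Ad_lieExp_of_lie_eq_smul h1, Complex.exp_pi_mul_I]
  -- The value `e^{α(Y)}` is read off from `Ad(t) e`, so it depends only on `t = exp Y`.
  have hexp : ∀ Y : 𝔱, lieExp (Y : LieAlg E G) = lieExp (Y₀ : LieAlg E G) →
      Complex.exp (α Y) = -1 := fun Y hY => by
    have h1 := Ad_lieExp_of_lie_eq_smul (he Y)
    rw [hY, hAde] at h1
    exact (smul_left_injective ℂ he0 h1).symm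
  have hBZ : B Z Z ≠ 0 := by
    have h1 := D.θ_cartan.2 Z hZ.1
    rw [mem_minusSpace.1 hZ.2.1] at h1
    simp only [B, map_neg, neg_neg] at h1
    exact h1.ne'
  refine ⟨lieExp (Y₀ : LieAlg E G), ⟨⟨Y₀, rfl⟩, ?_⟩, hexp,
    isReflectionOn_of_root hYα.1 (hexp Y₀ rfl) hZ.2.2.2 hBZ ?_ fun W hW =>
      D.exists_eq_add_of_mem_𝔧 h𝔱.prop.2 h𝔱'.prop.2 h𝔱𝔱' hW⟩
  · change lieExp (Real.pi • Complex.I • H) ∈ D.H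
    -- Rewritten as `exp(π(X + θX))`, the element visibly belongs to a one-parameter group fixed by
    -- `σ = τθ`.
    rw [lieExp_pi_of_isSl2Triple hsl, sub_neg_eq_add]
    refine D.lieExp_mem_H ?_ _
    rw [D.dAut_σ]
    change D.toCartanRealForm.T (D.toCartanRealForm.Θ _) = _
    rw [map_add, map_add, D.toCartanRealForm.Θ_Θ, ← D.toCartanRealForm.Θ_T, hTX, add_comm]
  · exact Submodule.mem_sup_left (Submodule.mem_sup_left (Submodule.mem_span_singleton_self Z))
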